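/- Consider the equation $$h''-\tanh(x)\,h'+\sin(2h)=0\qquad(x\in\mathbb R).\tag{$*$}$$ For $b\in\mathbb R$ the $b$-orbit is the solution with $h(x)=bx+O(x^3)$ as $x\to0$, and for $d\in\mathbb R$ the $d$-orbit is the solution with $h(x)=d+O(x^2)$ as $x\to0$. A solution is called connecting if for some sign $\sigma\in\{1,-1\}$ and some $c>0$ $$\sigma h(x)=-\frac{\pi}{2}+c\,e^{-x}+O(e^{-3x})\qquad(x\to\infty),$$ so that $h(x)\to-\sigma\pi/2$. For an orbit that stays in $(-\pi/2,\pi/2)$ for all $x>0$, let $\theta$ be the continuous function on $[0,\infty)$ such that $(\cos\theta,\sin\theta)$ is parallel to $(h,h')$ (so $\tan\theta=h'/h$ where $h\ne0$), normalized by $\theta(0)=-\pi/2$ for $b$-orbits with $b>0$ and by $\theta(0)=0$ for $d$-orbits with $d>0$; its rotation number is $\Omega=-\frac1\pi\lim_{x\to\infty}(\theta(x)-\theta(0))$, when this limit exists. (i) For each odd $n\ge1$ there is $b_n>0$ such that the $b_n$-orbit $h_n$ satisfies $-\pi/2<h_n(x)<\pi/2$ for all $x>0$, is connecting, and has rotation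 number $\Omega=n/2$. (ii) For each even $n\ge2$ there is $d_n>0$ such that the $d_n$-orbit $h_n$ satisfies $-\pi/2<h_n(x)<\pi/2$ for all $x>0$, is connecting, and has rotation number $\Omega=n/2$. (iii) Let $(\psi,\vartheta,\varphi)$ be hyperspherical coordinates on the round sphere $S^3$. For odd $n$, with $\sigma$ the sign above, the $SO(3)$-symmetric map $u_n:(\psi,\vartheta,\varphi)\mapsto(f_n(\psi),\vartheta,\varphi)$, where $f_n$ is continuous on $[0,\pi]$ and $f_n(\psi)=\frac\pi2-\sigma h_n(\ln\tan(\psi/2))$ for $0<\psi<\pi$, is a well-defined smooth harmonic map $S^3\to S^3$ (a smooth critical point of the energy $\int_{S^3}|du|^2$ under all smooth variations) of degree one. For even $n\ge2$ the map $u_n$ defined in the same way with $f_n(\psi)=\frac\pi2+h_n(\ln\tan(\psi/2))$ is a smooth harmonic map $S^3\to S^3$ of degree zero. Within each of the two families the maps $u_n$ are pairwise distinct; so there are two countably infinite families of $SO(3)$-symmetric harmonic maps $S^3\to S^3$, of degree one and of degree zero. -/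

import Mathlib

open Set Filter Topology MeasureTheory Asymptotics
open scoped Manifold ContDiff

noncomputable section

/-! ## The ordinary differential equation and its orbits -/

/-- `h` is a (global, twice differentiable) solution of `h'' - tanh(x) h' + sin(2h) = 0`. -/
def IsSolution (h : ℝ → ℝ) : Prop :=
  ∀ x : ℝ, DifferentiableAt ℝ h x ∧ DifferentiableAt ℝ (deriv h) x ∧
    deriv (deriv h) x - Real.tanh x * deriv h x + Real.sin (2 * h x) = 0

/-- The `b`-orbit: the solution with `h(x) = b x + O(x³)` at `x = 0`. -/
def IsOddOrbit (b : ℝ) (h : ℝ → ℝ) : Prop :=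
  IsSolution h ∧ (fun x : ℝ => h x - b * x) =O[𝓝 0] fun x : ℝ => x ^ 3

/-- The `d`-orbit: the solution with `h(x) = d + O(x²)` at `x = 0`. -/
def IsEvenOrbit (d : ℝ) (h : ℝ → ℝ) : Prop :=
  IsSolution h ∧ (fun x : ℝ => h x - d) =O[𝓝 0] fun x : ℝ => x ^ 2

/-- `h` stays in the open strip `(-π/2, π/2)` for all `x > 0`. -/
def StaysInStrip (h : ℝ → ℝ) : Prop :=
  ∀ x : ℝ, 0 < x → h x ∈ Ioo (-(Real.pi / 2)) (Real.pi / 2)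

/-- `σ h(x) = -π/2 + c e^{-x} + O(e^{-3x})` as `x → ∞`; used with `σ = ±1`. -/
def HasConnectingAsymptotics (h : ℝ → ℝ) (σ c : ℝ) : Prop :=
  (fun x : ℝ => σ * h x - (-(Real.pi / 2) + c * Real.exp (-x)))
    =O[atTop] fun x : ℝ => Real.exp (-(3 * x))

/-- Rotation number of an orbit that stays in the strip for all `x > 0`. The angle `θ` is the
continuous determination on `[0, ∞)` of `arctan (h' / h)` with `θ(0) = θ₀`, that is, `(cos θ, sin θ)`
is parallel to `(h, h')`. The rotation number is `-(θ(∞) - θ₀) / π`, where `θ(∞)` is the limit. -/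
def HasRotationNumber (h : ℝ → ℝ) (θ₀ Ω : ℝ) : Prop :=
  ∃ θ : ℝ → ℝ, ContinuousOn θ (Ici 0) ∧ θ 0 = θ₀ ∧
    (∀ x : ℝ, 0 ≤ x → deriv h x * Real.cos (θ x) = h x * Real.sin (θ x)) ∧
    Tendsto (fun x : ℝ => -(1 / Real.pi) * (θ x - θ₀)) atTop (𝓝 Ω)

/-! ## Harmonic maps from the three-sphere to itself -/

/-- The ambient space of the three-sphere. -/
abbrev E4 : Type := EuclideanSpace ℝ (Fin 4)

/-- The unit three-sphere. -/
abbrev S3 : Type := Metric.sphere (0 : E4) 1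

/-- The model dimension of `S3`, as used by Mathlib's smooth structure on spheres. -/
instance factFinrankE4 : Fact (Module.finrank ℝ E4 = 3 + 1) := ⟨by simp⟩

/-- Smooth maps of the three-sphere to itself. -/
def IsSmoothMap (u : S3 → S3) : Prop := ContMDiff (𝓡 3) (𝓡 3) ∞ u

/-- The extension `x ↦ u (x / |x|)` of `u` to the punctured space, constant on rays (with value `0`
at the origin). Its derivative at a point `p` of the sphere is the differential of `u` on the
tangent space at `p` and vanishes in the normal direction. -/
def radialExtension (u : S3 → S3) (x : E4) : E4 :=
  open Classical in
  if hx : x = 0 then 0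
  else (u ⟨‖x‖⁻¹ • x, by
    rw [mem_sphere_zero_iff_norm, norm_smul, norm_inv, norm_norm,
      inv_mul_cancel₀ (norm_ne_zero_iff.mpr hx)]⟩ : E4)

/-- The energy density `|du|²` (squared Hilbert-Schmidt norm of the differential) for the round
metrics. -/
def energyDensity (u : S3 → S3) (p : S3) : ℝ :=
  ∑ i : Fin 4, ‖fderiv ℝ (radialExtension u) (p : E4) (EuclideanSpace.single i (1 : ℝ))‖ ^ 2

/-- The energy `∫ |du|²` of `u` with respect to the surface measure of the sphere. -/
def energy (u : S3 → S3) : ℝ :=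
  ∫ p : S3, energyDensity u p ∂((volume : Measure E4).toSphere)

/-- Harmonic maps: smooth critical points of the energy under all smooth variations. -/
def IsHarmonicMap (u : S3 → S3) : Prop :=
  IsSmoothMap u ∧
    ∀ F : ℝ → S3 → S3,
      ContMDiff (𝓘(ℝ, ℝ).prod (𝓡 3)) (𝓡 3) ∞ (fun q : ℝ × S3 => F q.1 q.2) →
      F 0 = u → HasDerivAt (fun t : ℝ => energy (F t)) 0 0

/-- The Jacobian determinant of `u` at `p` (with respect to oriented orthonormal bases of the
tangent spaces), computed as the determinant of the derivative at `p` of the positively homogeneous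
extension `x ↦ |x| u (x / |x|)`, which maps `p` to `u p` and is the differential of `u` on the
tangent space. -/
def jacobianDet (u : S3 → S3) (p : S3) : ℝ :=
  (fderiv ℝ (fun x : E4 => ‖x‖ • radialExtension u x) (p : E4)).det

/-- The smooth map `u` has (Brouwer) degree `k`: the preimages of a regular value, counted with the
sign of the Jacobian determinant, add up to `k` (this number is the same for all regular values). -/
def HasDegree (u : S3 → S3) (k : ℤ) : Prop :=
  IsSmoothMap u ∧ ∃ (q : S3) (s : Finset S3), (∀ p : S3, p ∈ s ↔ u p = q) ∧
    (∀ p ∈ s, jacobianDet u p ≠ 0) ∧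
    ∑ p ∈ s, ((SignType.sign (jacobianDet u p) : SignType) : ℤ) = k

/-- The point of the three-sphere with hyperspherical coordinates `(ψ, ϑ, φ)`. -/
def hyperspherical (ψ ϑ φ : ℝ) : S3 :=
  ⟨!₂[Real.cos ψ, Real.sin ψ * Real.cos ϑ, Real.sin ψ * Real.sin ϑ * Real.cos φ,
      Real.sin ψ * Real.sin ϑ * Real.sin φ], by
    rw [mem_sphere_zero_iff_norm, EuclideanSpace.norm_eq, Real.sqrt_eq_one]
    simp only [Fin.sum_univ_four, Real.norm_eq_abs, sq_abs]
    simp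
    linear_combination
      (Real.sin ψ ^ 2 * Real.sin ϑ ^ 2) * Real.sin_sq_add_cos_sq φ +
      Real.sin ψ ^ 2 * Real.sin_sq_add_cos_sq ϑ + Real.sin_sq_add_cos_sq ψ⟩

/-- `u` is the `SO(3)`-symmetric map `Ψ = f(ψ)`, `Θ = ϑ`, `Φ = φ` with (continuous) profile `f`. -/
def HasProfile (u : S3 → S3) (f : ℝ → ℝ) : Prop :=
  ContinuousOn f (Icc 0 Real.pi) ∧
    ∀ ψ ∈ Icc 0 Real.pi, ∀ ϑ φ : ℝ, u (hyperspherical ψ ϑ φ) = hyperspherical (f ψ) ϑ φ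

/-- `u` is the `SO(3)`-symmetric map whose profile `f` corresponds to `h` through
`h(x) = f(ψ) - π/2`, `x = ln (tan (ψ / 2))`. -/
def IsInducedBy (u : S3 → S3) (h : ℝ → ℝ) : Prop :=
  ∃ f : ℝ → ℝ, HasProfile u f ∧
    ∀ ψ ∈ Ioo 0 Real.pi, f ψ = h (Real.log (Real.tan (ψ / 2))) + Real.pi / 2

end

/-! The orbits are shot from the end x = ∞ instead of from x = 0. Put y = a - x and δ = e^{-2a}. The
equation becomes H'' + τH' + sin 2H = 0 with friction τ = (1 - δe^{2y})/(1 + δe^{2y}), and H is the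
solution that leaves -π/2 like 2e^y as y → -∞. Such a solution is automatically connecting, so δ ∈
(0, 1] is the only shooting parameter. The point x = 0 is y = -(log δ)/2; by uniqueness the orbit is
odd in x if H vanishes there and even if H' does.

The continuous phase of (H, H') starts at 0 for y → -∞ and can cross the zeros of H only downwards.
For δ = 1 the solution is 2 arctan(e^y) - π/2, which is the identity map, and its phase at x = 0 is
at least -π/2. For δ = 0 the friction is identically 1 and the damped pendulum is underdamped at its
rest point: a Lyapunov function forces a solution without zeros close to 0, and a Riccati estimate
for H'/H then forces a zero. Hence H has arbitrarily late zeros and its phase is unbounded below.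
The flow is continuous in δ down to δ = 0, so the phase at x = 0 attains each value -kπ/2 with k ≥ 1
(`BaseFamily.exists_phase_eq`); odd k gives H = 0 and even k gives H' = 0. The energy H'²/2 + sin² H
tends to 1 at the pole and is dissipated while x ≥ 0, which keeps the orbit in the strip
(`BaseFamily.energy_lt_one`).

Regularity at the singular end comes from H = 2 arctan(r m(r²)) - π/2 with r = e^y. Writing n = r
dm/dr = r²Y and integrating over [0, r₁] with r = r₁ς turns the equation into a fixed point equation
in C([0, 1]), with parameters r₁² and δr₁², which is trivial at zero parameters. The implicit
function theorem solves it (`exists_regularFamily`). Smoothness of m in s = r² gives both the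
O(e^{-3x}) remainder and the smoothness of the map at the poles of the sphere.

In coordinates the map is p ↦ (A(p₀), B(p₀)p₁, B(p₀)p₂, B(p₀)p₃). The equation makes the Laplacian
of its extension constant on rays normal to the target sphere (`ProfilePair.isHarmonicMap`).
Differentiation under the integral and a divergence theorem on the sphere turn this into criticality
(`isHarmonicMap_of_laplacian`). The degree is read off from the preimages of a pole. The maps are
distinct because B(-1) = δ^{-1/2}, and δ determines k through the phase. -/

noncomputable section

/-! ## Regular solutions at the singular point -/

/-- The real Banach algebra of continuous functions on the unit interval. -/
abbrev CI : Type := C(unitInterval, ℝ)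

/-- The averaging operator `φ ↦ (ς ↦ ∫₀¹ ξ ^ k φ (ξ ς) dξ)`. -/
def avg (k : ℕ) : CI →L[ℝ] CI :=
  LinearMap.mkContinuous
    { toFun := fun φ =>
        ⟨fun ς => ∫ ξ in (0 : ℝ)..1, ξ ^ k * φ (projIcc 0 1 zero_le_one ξ * ς),
          intervalIntegral.continuous_parametric_intervalIntegral_of_continuous'
            (by
              have : Continuous fun p : unitInterval × ℝ =>
                  p.2 ^ k * φ (projIcc 0 1 zero_le_one p.2 * p.1) := by
                have h : Continuous fun p : unitInterval × ℝ =>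
                    projIcc (0 : ℝ) 1 zero_le_one p.2 := continuous_projIcc.comp continuous_snd
                fun_prop
              exact this) 0 1⟩
      map_add' := by
        intro φ χ
        ext ς
        simp only [ContinuousMap.coe_mk, ContinuousMap.add_apply, mul_add]
        have h : Continuous (projIcc (0 : ℝ) 1 zero_le_one) := continuous_projIcc
        apply intervalIntegral.integral_add <;>
          exact Continuous.intervalIntegrable (by fun_prop) _ _
      map_smul' := by
        intro c φ
        ext ς
        simp only [ContinuousMap.coe_mk, ContinuousMap.smul_apply, smul_eq_mul, RingHom.id_apply]
        rw [← intervalIntegral.integral_const_mul]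
        congr 1
        ext ξ
        ring }
    1 (by
      intro φ
      rw [one_mul, ContinuousMap.norm_le _ (norm_nonneg _)]
      intro ς
      have := intervalIntegral.norm_integral_le_of_norm_le_const (a := 0) (b := 1) (C := ‖φ‖)
        (f := fun ξ : ℝ => ξ ^ k * φ (projIcc 0 1 zero_le_one ξ * ς)) (by
          intro ξ hξ
          rw [uIoc_of_le zero_le_one] at hξ
          rw [norm_mul, Real.norm_eq_abs, abs_of_nonneg (pow_nonneg hξ.1.le k)]
          calc ξ ^ k * ‖φ (projIcc 0 1 zero_le_one ξ * ς)‖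
              ≤ 1 * ‖φ‖ := mul_le_mul (pow_le_one₀ hξ.1.le hξ.2) (φ.norm_coe_le_norm _)
                (norm_nonneg _) zero_le_one
            _ = ‖φ‖ := one_mul _)
      simpa using this)

theorem avg_apply (k : ℕ) (φ : CI) (ς : unitInterval) :
    avg k φ ς = ∫ ξ in (0 : ℝ)..1, ξ ^ k * φ (projIcc 0 1 zero_le_one ξ * ς) := rfl

/-- Substitution a = ξς. It shows that `avg k` inverts φ ↦ ς^{-k} (ς^{k+1} φ)', the form taken by
both first order equations for the profile. -/
theorem pow_mul_avg_apply (k : ℕ) (φ : CI) (ς : unitInterval) :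
    (ς : ℝ) ^ (k + 1) * avg k φ ς
      = ∫ a in (0 : ℝ)..ς, a ^ k * φ (projIcc 0 1 zero_le_one a) := by
  have h := intervalIntegral.mul_integral_comp_mul_right (a := 0) (b := 1)
    (f := fun a : ℝ => a ^ k * φ (projIcc 0 1 zero_le_one a)) (ς : ℝ)
  rw [zero_mul, one_mul] at h
  rw [← h, avg_apply, pow_succ', mul_assoc]
  congr 1
  rw [← intervalIntegral.integral_const_mul]
  apply intervalIntegral.integral_congr
  intro ξ hξ
  rw [uIcc_of_le zero_le_one] at hξ
  have hmem : ξ * (ς : ℝ) ∈ Icc (0 : ℝ) 1 :=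
    ⟨mul_nonneg hξ.1 ς.2.1, mul_le_one₀ hξ.2 ς.2.1 ς.2.2⟩
  simp only
  rw [projIcc_of_mem zero_le_one hmem, projIcc_of_mem zero_le_one hξ, mul_pow]
  have : (⟨ξ, hξ⟩ : unitInterval) * ς = ⟨ξ * ς, hmem⟩ := rfl
  rw [this]
  ring

/-- The coordinate function on the unit interval. -/
def coordI : CI := ⟨Subtype.val, continuous_subtype_val⟩

@[simp] theorem coordI_apply (ς : unitInterval) : coordI ς = (ς : ℝ) := rfl

/-- Precomposition with the dilation by `t`. -/
def dilate (t : unitInterval) (φ : CI) : CI := φ.comp ⟨fun ς => t * ς, by fun_prop⟩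

@[simp] theorem dilate_apply (t : unitInterval) (φ : CI) (ς : unitInterval) :
    dilate t φ ς = φ (t * ς) := rfl

theorem norm_dilate_le (t : unitInterval) (φ : CI) : ‖dilate t φ‖ ≤ ‖φ‖ := by
  rw [ContinuousMap.norm_le _ (norm_nonneg _)]
  intro ς
  exact φ.norm_coe_le_norm _

theorem avg_dilate (k : ℕ) (t : unitInterval) (φ : CI) :
    avg k (dilate t φ) = dilate t (avg k φ) := by
  ext ς
  simp only [avg_apply, dilate_apply]
  congr 1
  ext ξ
  rw [mul_left_comm]

/-- The profile `m` expressed through the unknown `Y`. -/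
def profM (Y : CI) : CI := 1 + coordI ^ 2 * avg 1 Y

/-- The logarithmic derivative term `n` expressed through the unknown `Y`. -/
def profN (Y : CI) : CI := coordI ^ 2 * Y

/-- First denominator of the nonlinearity. -/
def den₁ (lam : ℝ) (Y : CI) : CI := 1 + lam • (coordI ^ 2 * profM Y ^ 2)

/-- Second denominator of the nonlinearity. -/
def den₂ (μ : ℝ) : CI := 1 + μ • coordI ^ 2

/-- The nonlinearity of the profile equation. -/
def nonlin (lam μ : ℝ) (Y : CI) : CI :=
  (2 * lam) • (profM Y * (profM Y + profN Y) ^ 2 * Ring.inverse (den₁ lam Y))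
    + (2 * μ) • ((profM Y + profN Y) * Ring.inverse (den₂ μ))
    - (4 * lam) • (profM Y ^ 3 * Ring.inverse (den₁ lam Y))

/-- The equation satisfied by `Y`. -/
def profEq (v : (ℝ × ℝ) × CI) : CI := v.2 - avg 4 (nonlin v.1.1 v.1.2 v.2)

theorem ringInverse_apply {a : CI} (ha : IsUnit a) (ς : unitInterval) :
    Ring.inverse a ς = (a ς)⁻¹ := by
  have h := congrArg (fun f : CI => f ς) (Ring.mul_inverse_cancel a ha)
  simp only [ContinuousMap.mul_apply, ContinuousMap.one_apply] at h
  exact eq_inv_of_mul_eq_one_right h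

theorem contDiff_profM : ContDiff ℝ ω profM := by
  unfold profM
  exact contDiff_const.add (contDiff_const.mul (avg 1).contDiff)

theorem contDiff_profN : ContDiff ℝ ω profN := by
  unfold profN
  exact contDiff_const.mul contDiff_id

theorem contDiffAt_profEq : ContDiffAt ℝ ω profEq ((0, 0), 0) := by
  have hl : ContDiff ℝ ω fun v : (ℝ × ℝ) × CI => v.1.1 := contDiff_fst.fst
  have hμ : ContDiff ℝ ω fun v : (ℝ × ℝ) × CI => v.1.2 := contDiff_fst.snd
  have hm : ContDiff ℝ ω fun v : (ℝ × ℝ) × CI => profM v.2 := contDiff_profM.comp contDiff_snd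
  have hn : ContDiff ℝ ω fun v : (ℝ × ℝ) × CI => profN v.2 := contDiff_profN.comp contDiff_snd
  have hd₁ : ContDiff ℝ ω fun v : (ℝ × ℝ) × CI => den₁ v.1.1 v.2 :=
    contDiff_const.add (hl.smul (contDiff_const.mul (hm.pow 2)))
  have hd₂ : ContDiff ℝ ω fun v : (ℝ × ℝ) × CI => den₂ v.1.2 :=
    contDiff_const.add (hμ.smul contDiff_const)
  have hi₁ : ContDiffAt ℝ ω (fun v : (ℝ × ℝ) × CI => Ring.inverse (den₁ v.1.1 v.2))
      ((0, 0), 0) := by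
    have h0 : den₁ 0 0 = ((1 : CIˣ) : CI) := by simp [den₁]
    have h1 := contDiffAt_ringInverse (n := ω) ℝ (1 : CIˣ)
    rw [← h0] at h1
    exact h1.comp (f := fun v : (ℝ × ℝ) × CI => den₁ v.1.1 v.2) (((0, 0), 0) : (ℝ × ℝ) × CI) hd₁.contDiffAt
  have hi₂ : ContDiffAt ℝ ω (fun v : (ℝ × ℝ) × CI => Ring.inverse (den₂ v.1.2))
      ((0, 0), 0) := by
    have h0 : den₂ 0 = ((1 : CIˣ) : CI) := by simp [den₂]
    have h1 := contDiffAt_ringInverse (n := ω) ℝ (1 : CIˣ)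
    rw [← h0] at h1
    exact h1.comp (f := fun v : (ℝ × ℝ) × CI => den₂ v.1.2) (((0, 0), 0) : (ℝ × ℝ) × CI) hd₂.contDiffAt
  refine contDiff_snd.contDiffAt.sub ((avg 4).contDiff.contDiffAt.comp _ ?_)
  refine ContDiffAt.sub (ContDiffAt.add ?_ ?_) ?_
  · exact (contDiff_const.mul hl).contDiffAt.smul
      ((hm.mul ((hm.add hn).pow 2)).contDiffAt.mul hi₁)
  · exact (contDiff_const.mul hμ).contDiffAt.smul ((hm.add hn).contDiffAt.mul hi₂)
  · exact (contDiff_const.mul hl).contDiffAt.smul ((hm.pow 3).contDiffAt.mul hi₁)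

theorem profEq_zero (Y : CI) : profEq ((0, 0), Y) = Y := by
  simp [profEq, nonlin]

/-- Every term of the nonlinearity carries a factor `lam` or `μ`, so at zero parameters the equation
is just Y = 0 and its partial derivative in Y is the identity. -/
theorem profEq_invertible :
    (fderiv ℝ profEq ((0, 0), 0) ∘L .inr ℝ (ℝ × ℝ) CI).IsInvertible := by
  have h : fderiv ℝ profEq ((0, 0), 0) ∘L .inr ℝ (ℝ × ℝ) CI = ContinuousLinearMap.id ℝ CI := by
    have h1 : HasFDerivAt profEq (fderiv ℝ profEq ((0, 0), 0)) ((0, 0), 0) :=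
      (contDiffAt_profEq.differentiableAt (by simp)).hasFDerivAt
    have h2 : HasFDerivAt (fun Y : CI => ((((0 : ℝ), (0 : ℝ)), Y) : (ℝ × ℝ) × CI))
        (ContinuousLinearMap.inr ℝ (ℝ × ℝ) CI) 0 := hasFDerivAt_prodMk_right _ _
    have h3 := h1.comp (0 : CI) h2
    have h4 : profEq ∘ (fun Y : CI => ((((0 : ℝ), (0 : ℝ)), Y) : (ℝ × ℝ) × CI)) = id := by
      ext1 Y
      exact profEq_zero Y
    rw [h4] at h3
    exact h3.unique (hasFDerivAt_id 0)
  rw [h]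
  exact ⟨ContinuousLinearEquiv.refl ℝ CI, rfl⟩

/-- The parameters stand for r₁² and δr₁² on the interval [0, r₁]. Shrinking r₁ by t is the
substitution ς ↦ tς, under which Y, being n/ς², picks up the factor t². This and the next lemmas
check that every ingredient is covariant. -/
theorem profM_dilate (t : unitInterval) (Y : CI) :
    profM ((t : ℝ) ^ 2 • dilate t Y) = dilate t (profM Y) := by
  ext ς
  simp only [profM, map_smul, avg_dilate, ContinuousMap.add_apply, ContinuousMap.one_apply,
    ContinuousMap.mul_apply, ContinuousMap.pow_apply, coordI_apply, ContinuousMap.smul_apply,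
    dilate_apply, smul_eq_mul, Set.Icc.coe_mul]
  ring

theorem profN_dilate (t : unitInterval) (Y : CI) :
    profN ((t : ℝ) ^ 2 • dilate t Y) = dilate t (profN Y) := by
  ext ς
  simp only [profN, ContinuousMap.mul_apply, ContinuousMap.pow_apply, coordI_apply,
    ContinuousMap.smul_apply, dilate_apply, smul_eq_mul, Set.Icc.coe_mul]
  ring

theorem den₁_dilate (t : unitInterval) (lam : ℝ) (Y : CI) :
    den₁ (lam * (t : ℝ) ^ 2) ((t : ℝ) ^ 2 • dilate t Y) = dilate t (den₁ lam Y) := by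
  ext ς
  simp only [den₁, profM_dilate, ContinuousMap.add_apply, ContinuousMap.one_apply,
    ContinuousMap.mul_apply, ContinuousMap.pow_apply, coordI_apply, ContinuousMap.smul_apply,
    dilate_apply, smul_eq_mul, Set.Icc.coe_mul]
  ring

theorem den₂_dilate (t : unitInterval) (μ : ℝ) :
    den₂ (μ * (t : ℝ) ^ 2) = dilate t (den₂ μ) := by
  ext ς
  simp only [den₂, ContinuousMap.add_apply, ContinuousMap.one_apply,
    ContinuousMap.pow_apply, coordI_apply, ContinuousMap.smul_apply,
    dilate_apply, smul_eq_mul, Set.Icc.coe_mul]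
  ring

theorem ringInverse_dilate (t : unitInterval) {a : CI} (ha : IsUnit a) :
    Ring.inverse (dilate t a) = dilate t (Ring.inverse a) := by
  have hu : IsUnit (dilate t a) := by
    rw [ContinuousMap.isUnit_iff_forall_ne_zero] at ha ⊢
    intro ς
    exact ha _
  ext ς
  rw [ringInverse_apply hu, dilate_apply, dilate_apply, ringInverse_apply ha]

theorem nonlin_dilate (t : unitInterval) {lam μ : ℝ} {Y : CI} (h₁ : IsUnit (den₁ lam Y))
    (h₂ : IsUnit (den₂ μ)) :
    nonlin (lam * (t : ℝ) ^ 2) (μ * (t : ℝ) ^ 2) ((t : ℝ) ^ 2 • dilate t Y)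
      = (t : ℝ) ^ 2 • dilate t (nonlin lam μ Y) := by
  rw [nonlin, den₁_dilate, den₂_dilate, ringInverse_dilate t h₁, ringInverse_dilate t h₂,
    profM_dilate, profN_dilate]
  ext ς
  simp only [nonlin, ContinuousMap.add_apply, ContinuousMap.sub_apply,
    ContinuousMap.mul_apply, ContinuousMap.pow_apply, ContinuousMap.smul_apply,
    dilate_apply, smul_eq_mul]
  ring

theorem isUnit_den₁ {lam : ℝ} (h : 0 ≤ lam) (Y : CI) : IsUnit (den₁ lam Y) := by
  rw [ContinuousMap.isUnit_iff_forall_ne_zero]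
  intro ς
  simp only [den₁, ContinuousMap.add_apply, ContinuousMap.one_apply,
    ContinuousMap.mul_apply, ContinuousMap.pow_apply, ContinuousMap.smul_apply, smul_eq_mul]
  positivity

theorem isUnit_den₂ {μ : ℝ} (h : 0 ≤ μ) : IsUnit (den₂ μ) := by
  rw [ContinuousMap.isUnit_iff_forall_ne_zero]
  intro ς
  simp only [den₂, ContinuousMap.add_apply, ContinuousMap.one_apply,
    ContinuousMap.pow_apply, ContinuousMap.smul_apply, smul_eq_mul]
  positivity

theorem profEq_dilate (t : unitInterval) {lam μ : ℝ} (hl : 0 ≤ lam) (hμ : 0 ≤ μ) {Y : CI}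
    (h : profEq ((lam, μ), Y) = 0) :
    profEq ((lam * (t : ℝ) ^ 2, μ * (t : ℝ) ^ 2), (t : ℝ) ^ 2 • dilate t Y) = 0 := by
  simp only [profEq] at h ⊢
  rw [nonlin_dilate t (isUnit_den₁ hl Y) (isUnit_den₂ hμ), map_smul, avg_dilate, ← smul_sub]
  rw [sub_eq_zero] at h
  nth_rw 1 [h]
  rw [sub_self, smul_zero]

/-- A smooth family of solutions of the profile equation, with dilation covariance. -/
theorem exists_profile_family :
    ∃ ε > 0, ∃ ψ : ℝ × ℝ → CI,
      (∀ p : ℝ × ℝ, ‖p‖ < ε → ContDiffAt ℝ ω ψ p) ∧ ψ 0 = 0 ∧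
      (∀ p : ℝ × ℝ, ‖p‖ < ε → ‖ψ p‖ < 1 / 4) ∧
      (∀ p : ℝ × ℝ, ‖p‖ < ε → profEq (p, ψ p) = 0) ∧
      (∀ s : ℝ, |s| < ε → ψ (s, s) = 0) ∧
      ∀ lam μ : ℝ, 0 ≤ lam → 0 ≤ μ → ‖(lam, μ)‖ < ε → ∀ t : unitInterval,
        ψ (lam * (t : ℝ) ^ 2, μ * (t : ℝ) ^ 2) = (t : ℝ) ^ 2 • dilate t (ψ (lam, μ)) := by
  have hω : (ω : ℕ∞ω) ≠ 0 := by simp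
  set ψ := contDiffAt_profEq.implicitFunction hω profEq_invertible with hψ
  have h0 : ψ 0 = 0 := contDiffAt_profEq.implicitFunction_apply_self hω profEq_invertible
  have hsm : ContDiffAt ℝ ω ψ 0 := contDiffAt_profEq.contDiffAt_implicitFunction hω _
  have heq : ∀ᶠ p in 𝓝 (0 : ℝ × ℝ), profEq (p, ψ p) = 0 := by
    have := contDiffAt_profEq.eventually_apply_implicitFunction hω profEq_invertible
    rw [profEq_zero] at this
    exact this
  have huniq : ∀ᶠ v in 𝓝 (((0, 0), 0) : (ℝ × ℝ) × CI), profEq v = 0 ↔ ψ v.1 = v.2 := by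
    have := contDiffAt_profEq.eventually_apply_eq_iff_implicitFunction hω profEq_invertible
    rw [profEq_zero] at this
    exact this
  have hsm' := hsm.eventually (by simp)
  obtain ⟨r, hr, hru⟩ := Metric.eventually_nhds_iff_ball.1 huniq
  have hcont : ∀ᶠ p in 𝓝 (0 : ℝ × ℝ), ‖ψ p‖ < min r (1 / 4) := by
    have : Tendsto (fun p => ‖ψ p‖) (𝓝 0) (𝓝 ‖ψ 0‖) := hsm.continuousAt.norm
    rw [h0, norm_zero] at this
    exact this.eventually (gt_mem_nhds (lt_min hr (by norm_num)))
  obtain ⟨ε, hε, hall⟩ := Metric.eventually_nhds_iff_ball.1 (hsm'.and (heq.and hcont))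
  have hall' : ∀ p : ℝ × ℝ, ‖p‖ < ε → ContDiffAt ℝ ω ψ p ∧ profEq (p, ψ p) = 0 ∧ ‖ψ p‖ < min r (1 / 4) :=
    fun p hp => hall p (by simpa using hp)
  have hru' : ∀ p : ℝ × ℝ, ∀ Y : CI, ‖p‖ < r → ‖Y‖ < r → profEq (p, Y) = 0 → ψ p = Y := by
    intro p Y hp hY h
    refine (hru (p, Y) ?_).1 h
    rw [mem_ball_iff_norm]
    have : ((p, Y) : (ℝ × ℝ) × CI) - ((0, 0), 0) = (p, Y) := by
      rw [show (((0, 0), 0) : (ℝ × ℝ) × CI) = 0 from rfl, sub_zero]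
    rw [this, Prod.norm_def]
    exact max_lt hp hY
  refine ⟨min ε r, lt_min hε hr, ψ, fun p hp => (hall' p (hp.trans_le (min_le_left _ _))).1, h0,
    fun p hp => (hall' p (hp.trans_le (min_le_left _ _))).2.2.trans_le (min_le_right _ _),
    fun p hp => (hall' p (hp.trans_le (min_le_left _ _))).2.1, ?_, ?_⟩
  -- Equal parameters mean δ = 1, where m = 1, n = 0 (the identity map) solves the equation; local
  -- uniqueness then gives Y = 0.
  · intro s hs
    apply hru'
    · rw [Prod.norm_def]
      exact max_lt (hs.trans_le (min_le_right _ _)) (hs.trans_le (min_le_right _ _))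
    · simpa using hr
    -- All three terms have the same denominator here, and their coefficients 2s + 2s - 4s cancel.
    · have h : nonlin s s 0 = 0 := by
        have hd : den₁ s 0 = den₂ s := by simp [den₁, den₂, profM]
        rw [nonlin, hd]
        simp only [profM, profN, map_zero, mul_zero, add_zero, one_pow, one_mul]
        rw [← add_smul, ← sub_smul]
        ring_nf
        simp
      simp [profEq, h]
  · intro lam μ hl hμ hp t
    have ht0 : (0 : ℝ) ≤ (t : ℝ) ^ 2 := sq_nonneg _
    have ht1 : (t : ℝ) ^ 2 ≤ 1 := pow_le_one₀ t.2.1 t.2.2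
    obtain ⟨-, h2, h3⟩ := hall' (lam, μ) (hp.trans_le (min_le_left _ _))
    apply hru'
    · refine lt_of_le_of_lt ?_ (hp.trans_le (min_le_right _ _))
      have : ((lam * (t : ℝ) ^ 2, μ * (t : ℝ) ^ 2) : ℝ × ℝ) = (t : ℝ) ^ 2 • (lam, μ) := by
        ext <;> simp [mul_comm]
      rw [this, norm_smul, Real.norm_eq_abs, abs_of_nonneg ht0]
      exact mul_le_of_le_one_left (norm_nonneg _) ht1
    · refine lt_of_le_of_lt ?_ (h3.trans_le (min_le_left _ _))
      rw [norm_smul, Real.norm_eq_abs, abs_of_nonneg ht0]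
      exact (mul_le_of_le_one_left (norm_nonneg _) ht1).trans (norm_dilate_le _ _)
    · exact profEq_dilate t hl hμ h2

/-- The right-hand side of the profile equation. -/
def profRhs (δ s m n : ℝ) : ℝ :=
  2 * m * (m + n) ^ 2 / (1 + s * m ^ 2) + 2 * δ / (1 + δ * s) * (m + n)
    - 4 * m ^ 3 / (1 + s * m ^ 2)

/-- A family of solutions `m δ` of the singular profile equation, smooth up to the singular point
`s = 0` and continuous in the parameter `δ`. -/
structure RegularFamily (ε : ℝ) (m n : ℝ → ℝ → ℝ) : Prop where
  pos : 0 < ε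
  contDiffAt : ∀ δ ∈ Icc (0 : ℝ) 1, ∀ s, |s| < ε → ContDiffAt ℝ ∞ (m δ) s
  continuousOn_fst : ContinuousOn (fun p : ℝ × ℝ => m p.1 p.2) (Icc 0 1 ×ˢ Ioo (-ε) ε)
  continuousOn_snd : ContinuousOn (fun p : ℝ × ℝ => n p.1 p.2) (Icc 0 1 ×ˢ Ioo (-ε) ε)
  fst_zero : ∀ δ, m δ 0 = 1
  hasDerivAt_fst : ∀ δ ∈ Icc (0 : ℝ) 1, ∀ r, 0 < r → r ^ 2 < ε →
    HasDerivAt (fun r => m δ (r ^ 2)) (n δ (r ^ 2) / r) r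
  hasDerivAt_snd : ∀ δ ∈ Icc (0 : ℝ) 1, ∀ r, 0 < r → r ^ 2 < ε →
    HasDerivAt (fun r => n δ (r ^ 2))
      (-3 * n δ (r ^ 2) / r + r * profRhs δ (r ^ 2) (m δ (r ^ 2)) (n δ (r ^ 2))) r
  fst_one : ∀ s, |s| < ε → m 1 s = 1
  snd_one : ∀ s, |s| < ε → n 1 s = 0
  abs_fst_sub_one_lt : ∀ δ ∈ Icc (0 : ℝ) 1, ∀ s, |s| < ε → |m δ s - 1| < 1 / 4
  abs_snd_lt : ∀ δ ∈ Icc (0 : ℝ) 1, ∀ s, |s| < ε → |n δ s| < 1 / 4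

theorem continuous_mul_projIcc (k : ℕ) (φ : CI) :
    Continuous fun a : ℝ => a ^ k * φ (projIcc 0 1 zero_le_one a) := by
  have h : Continuous (projIcc (0 : ℝ) 1 zero_le_one) := continuous_projIcc
  fun_prop

theorem hasDerivAt_integral_projIcc (k : ℕ) (φ : CI) (ς : ℝ) :
    HasDerivAt (fun x : ℝ => ∫ a in (0 : ℝ)..x, a ^ k * φ (projIcc 0 1 zero_le_one a))
      (ς ^ k * φ (projIcc 0 1 zero_le_one ς)) ς :=
  (continuous_mul_projIcc k φ).integral_hasStrictDerivAt 0 ς |>.hasDerivAt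

theorem nonlin_apply {lam μ : ℝ} (hl : 0 ≤ lam) (hμ : 0 ≤ μ) (Y : CI) (ς : unitInterval) :
    nonlin lam μ Y ς =
      2 * lam * (profM Y ς * (profM Y ς + profN Y ς) ^ 2
        * (1 + lam * ((ς : ℝ) ^ 2 * profM Y ς ^ 2))⁻¹)
      + 2 * μ * ((profM Y ς + profN Y ς) * (1 + μ * (ς : ℝ) ^ 2)⁻¹)
      - 4 * lam * (profM Y ς ^ 3 * (1 + lam * ((ς : ℝ) ^ 2 * profM Y ς ^ 2))⁻¹) := by
  simp only [nonlin, ContinuousMap.add_apply, ContinuousMap.sub_apply,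
    ContinuousMap.mul_apply, ContinuousMap.pow_apply, ContinuousMap.smul_apply,
    ringInverse_apply (isUnit_den₁ hl Y), ringInverse_apply (isUnit_den₂ hμ), smul_eq_mul]
  simp only [den₁, den₂, ContinuousMap.add_apply, ContinuousMap.one_apply,
    ContinuousMap.mul_apply, ContinuousMap.pow_apply, ContinuousMap.smul_apply, smul_eq_mul,
    coordI_apply]

/-- The profile at s is read off at ς = 1 from the solution with parameters (s, δs), so its
smoothness in s, across s = 0 and for s < 0 as well, is that of the implicit function. Dilation
covariance identifies these values, for all r ≤ r₁, with one fixed element of C([0, 1]), whose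
integral formulas can be differentiated to recover the differential equations. -/
theorem exists_regularFamily : ∃ ε m n, RegularFamily ε m n := by
  obtain ⟨ε, hε, ψ, hsm, h0, hsmall, heq, hone, hdil⟩ := exists_profile_family
  have hnorm : ∀ δ ∈ Icc (0 : ℝ) 1, ∀ s, |s| < ε → ‖((s, δ * s) : ℝ × ℝ)‖ < ε := by
    intro δ hδ s hs
    rw [Prod.norm_def]
    refine max_lt hs ?_
    rw [Real.norm_eq_abs, abs_mul, abs_of_nonneg hδ.1]
    exact (mul_le_of_le_one_left (abs_nonneg _) hδ.2).trans_lt hs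
  let ev : CI →L[ℝ] ℝ := ContinuousMap.evalCLM ℝ (1 : unitInterval)
  -- the solution on an interval in terms of the profile with the largest parameter
  have key : ∀ δ ∈ Icc (0 : ℝ) 1, ∀ r₁, 0 < r₁ → r₁ ^ 2 < ε → ∀ r (hr : r / r₁ ∈ Icc (0 : ℝ) 1),
      ψ (r ^ 2, δ * r ^ 2) = (r / r₁) ^ 2 • dilate ⟨r / r₁, hr⟩ (ψ (r₁ ^ 2, δ * r₁ ^ 2)) := by
    intro δ hδ r₁ hr₁ hr₁ε r hr
    have := hdil (r₁ ^ 2) (δ * r₁ ^ 2) (sq_nonneg _) (mul_nonneg hδ.1 (sq_nonneg _))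
      (hnorm δ hδ _ (by rwa [abs_of_nonneg (sq_nonneg _)])) ⟨r / r₁, hr⟩
    simp only at this
    rw [← this]
    have h1 : r₁ ^ 2 * (r / r₁) ^ 2 = r ^ 2 := by field_simp
    rw [mul_assoc, h1]
  have hcont : ContinuousOn (fun p : ℝ × ℝ => ψ (p.2, p.1 * p.2)) (Icc 0 1 ×ˢ Ioo (-ε) ε) := by
    intro p hp
    have h1 : ContinuousAt ψ (p.2, p.1 * p.2) :=
      (hsm _ (hnorm p.1 hp.1 p.2 (abs_lt.2 hp.2))).continuousAt
    exact (ContinuousAt.comp (f := fun p : ℝ × ℝ => (p.2, p.1 * p.2)) h1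
      (by fun_prop)).continuousWithinAt
  -- closed formulas on `[0, r₁]`
  have hm : ∀ δ ∈ Icc (0 : ℝ) 1, ∀ r₁, 0 < r₁ → r₁ ^ 2 < ε → ∀ r (hr : r / r₁ ∈ Icc (0 : ℝ) 1),
      1 + avg 1 (ψ (r ^ 2, δ * r ^ 2)) 1 = profM (ψ (r₁ ^ 2, δ * r₁ ^ 2)) ⟨r / r₁, hr⟩ := by
    intro δ hδ r₁ hr₁ hr₁ε r hr
    rw [key δ hδ r₁ hr₁ hr₁ε r hr, map_smul, avg_dilate]
    simp [profM]
  have hn : ∀ δ ∈ Icc (0 : ℝ) 1, ∀ r₁, 0 < r₁ → r₁ ^ 2 < ε → ∀ r (hr : r / r₁ ∈ Icc (0 : ℝ) 1),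
      ψ (r ^ 2, δ * r ^ 2) 1 = profN (ψ (r₁ ^ 2, δ * r₁ ^ 2)) ⟨r / r₁, hr⟩ := by
    intro δ hδ r₁ hr₁ hr₁ε r hr
    rw [key δ hδ r₁ hr₁ hr₁ε r hr]
    simp [profN]
  refine ⟨ε, fun δ s => 1 + avg 1 (ψ (s, δ * s)) 1, fun δ s => ψ (s, δ * s) 1, hε, ?_, ?_, ?_, ?_,
    ?_, ?_, ?_, ?_, ?_, ?_⟩
  · intro δ hδ s hs
    have h1 : ContDiffAt ℝ ∞ (fun s => ψ (s, δ * s)) s :=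
      ContDiffAt.comp (f := fun s : ℝ => (s, δ * s)) s ((hsm _ (hnorm δ hδ s hs)).of_le le_top)
        (by fun_prop)
    exact contDiffAt_const.add ((ev ∘L avg 1).contDiff.contDiffAt.comp s h1)
  · exact continuousOn_const.add ((ev ∘L avg 1).continuous.comp_continuousOn hcont)
  · exact ev.continuous.comp_continuousOn hcont
  · intro δ
    have : ψ (0, δ * 0) = 0 := by rw [mul_zero]; exact h0
    simp only [this, map_zero, ContinuousMap.zero_apply, add_zero]
  · intro δ hδ r hr hrε
    -- A slightly larger r₁ makes r/r₁ an interior point, as a two-sided derivative requires.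
    obtain ⟨r₁, hrr₁, hr₁⟩ : ∃ r₁, r < r₁ ∧ r₁ ^ 2 < ε := by
      have hc : ContinuousAt (fun x : ℝ => x ^ 2) r := by fun_prop
      have h1 := (hc.eventually (gt_mem_nhds hrε)).filter_mono (nhdsWithin_le_nhds (s := Ioi r))
      obtain ⟨x, hx1, hx2⟩ := (h1.and self_mem_nhdsWithin).exists
      exact ⟨x, hx2, hx1⟩
    have hr₁0 : 0 < r₁ := hr.trans hrr₁
    set Y := ψ (r₁ ^ 2, δ * r₁ ^ 2) with hY
    have hnear : ∀ᶠ x in 𝓝 r, x / r₁ ∈ Icc (0 : ℝ) 1 := by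
      filter_upwards [Ioo_mem_nhds hr hrr₁] with x hx
      exact ⟨by have := hx.1; positivity, (div_le_one hr₁0).2 hx.2.le⟩
    have hfor : ∀ x (hx : x / r₁ ∈ Icc (0 : ℝ) 1), 1 + avg 1 (ψ (x ^ 2, δ * x ^ 2)) 1
        = 1 + ∫ a in (0 : ℝ)..(x / r₁), a ^ 1 * Y (projIcc 0 1 zero_le_one a) := by
      intro x hx
      rw [hm δ hδ r₁ hr₁0 hr₁ x hx]
      have := pow_mul_avg_apply 1 Y ⟨x / r₁, hx⟩
      simp only [profM, ContinuousMap.add_apply, ContinuousMap.one_apply,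
        ContinuousMap.mul_apply, ContinuousMap.pow_apply, coordI_apply]
      rw [← this]
    have hmem : r / r₁ ∈ Icc (0 : ℝ) 1 := hnear.self_of_nhds
    have hd : HasDerivAt (fun x : ℝ => x / r₁) (1 / r₁) r := (hasDerivAt_id r).div_const r₁
    have h1 := ((hasDerivAt_integral_projIcc 1 Y (r / r₁)).comp r hd).const_add 1
    refine (h1.congr_of_eventuallyEq ?_).congr_deriv ?_
    · filter_upwards [hnear] with x hx
      exact hfor x hx
    · rw [hn δ hδ r₁ hr₁0 hr₁ r hmem, projIcc_of_mem _ hmem]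
      simp only [profN, ContinuousMap.mul_apply, ContinuousMap.pow_apply, coordI_apply, ← hY]
      field_simp
  · intro δ hδ r hr hrε
    obtain ⟨r₁, hrr₁, hr₁⟩ : ∃ r₁, r < r₁ ∧ r₁ ^ 2 < ε := by
      have hc : ContinuousAt (fun x : ℝ => x ^ 2) r := by fun_prop
      have h1 := (hc.eventually (gt_mem_nhds hrε)).filter_mono (nhdsWithin_le_nhds (s := Ioi r))
      obtain ⟨x, hx1, hx2⟩ := (h1.and self_mem_nhdsWithin).exists
      exact ⟨x, hx2, hx1⟩
    have hr₁0 : 0 < r₁ := hr.trans hrr₁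
    have hl : 0 ≤ r₁ ^ 2 := sq_nonneg _
    have hμ : 0 ≤ δ * r₁ ^ 2 := mul_nonneg hδ.1 hl
    have heqY := heq (r₁ ^ 2, δ * r₁ ^ 2)
      (hnorm δ hδ _ (by rwa [abs_of_nonneg (sq_nonneg _)]))
    set Y := ψ (r₁ ^ 2, δ * r₁ ^ 2) with hY
    set R := nonlin (r₁ ^ 2) (δ * r₁ ^ 2) Y with hR
    have hYR : Y = avg 4 R := sub_eq_zero.1 heqY
    have hnear : ∀ᶠ x in 𝓝 r, 0 < x ∧ x / r₁ ∈ Icc (0 : ℝ) 1 := by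
      filter_upwards [Ioo_mem_nhds hr hrr₁] with x hx
      exact ⟨hx.1, by have := hx.1; positivity, (div_le_one hr₁0).2 hx.2.le⟩
    have hfor : ∀ x, 0 < x → ∀ (hx : x / r₁ ∈ Icc (0 : ℝ) 1), ψ (x ^ 2, δ * x ^ 2) 1
        = (∫ a in (0 : ℝ)..(x / r₁), a ^ 4 * R (projIcc 0 1 zero_le_one a)) / (x / r₁) ^ 3 := by
      intro x hx0 hx
      rw [hn δ hδ r₁ hr₁0 hr₁ x hx]
      have := pow_mul_avg_apply 4 R ⟨x / r₁, hx⟩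
      simp only [profN, ContinuousMap.mul_apply, ContinuousMap.pow_apply, coordI_apply]
      rw [← hY, hYR]
      simp only at this
      rw [← this, eq_div_iff (by positivity)]
      ring
    have hmem : r / r₁ ∈ Icc (0 : ℝ) 1 := hnear.self_of_nhds.2
    have hd : HasDerivAt (fun x : ℝ => x / r₁) (1 / r₁) r := (hasDerivAt_id r).div_const r₁
    have hne : (r / r₁) ^ 3 ≠ 0 := by positivity
    have h1 := ((hasDerivAt_integral_projIcc 4 R (r / r₁)).comp r hd).div (hd.pow 3) hne
    refine (h1.congr_of_eventuallyEq ?_).congr_deriv ?_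
    · filter_upwards [hnear] with x hx
      exact hfor x hx.1 hx.2
    · have hJ := hfor r hr hmem
      rw [eq_div_iff hne] at hJ
      simp only [Function.comp_apply, Pi.pow_apply]
      rw [← hJ, projIcc_of_mem _ hmem, hR, nonlin_apply hl hμ]
      rw [hY, ← hm δ hδ r₁ hr₁0 hr₁ r hmem, ← hn δ hδ r₁ hr₁0 hr₁ r hmem, profRhs]
      generalize 1 + avg 1 (ψ (r ^ 2, δ * r ^ 2)) 1 = M
      generalize ψ (r ^ 2, δ * r ^ 2) 1 = N
      have e1 : 1 + r₁ ^ 2 * ((r / r₁) ^ 2 * M ^ 2) = 1 + r ^ 2 * M ^ 2 := by field_simp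
      have e2 : 1 + δ * r₁ ^ 2 * (r / r₁) ^ 2 = 1 + δ * r ^ 2 := by field_simp
      have e3 : (3 - 1 : ℕ) = 2 := rfl
      simp only [e1, e2, e3, Nat.cast_ofNat]
      have p1 : 1 + r ^ 2 * M ^ 2 ≠ 0 := by positivity
      have p2 : 1 + δ * r ^ 2 ≠ 0 := by have := hδ.1; positivity
      field_simp
      ring
  · intro s hs
    have : ψ (s, 1 * s) = 0 := by rw [one_mul]; exact hone s hs
    simp only [this, map_zero, ContinuousMap.zero_apply, add_zero]
  · intro s hs
    have : ψ (s, 1 * s) = 0 := by rw [one_mul]; exact hone s hs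
    simp only [this, ContinuousMap.zero_apply]
  · intro δ hδ s hs
    rw [add_sub_cancel_left]
    refine lt_of_le_of_lt ?_ (hsmall _ (hnorm δ hδ s hs))
    refine ((avg 1 (ψ (s, δ * s))).norm_coe_le_norm 1).trans ?_
    refine ((avg 1).le_opNorm _).trans ?_
    exact mul_le_of_le_one_left (norm_nonneg _)
      (LinearMap.mkContinuous_norm_le _ zero_le_one _)
  · intro δ hδ s hs
    exact ((ψ (s, δ * s)).norm_coe_le_norm 1).trans_lt (hsmall _ (hnorm δ hδ s hs))

/-! ## Global solutions of the ordinary differential equation -/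

/-- The uniform time lemma: local integral curves of one fixed length through every point glue to a
global one. -/
theorem exists_global_integralCurve {E : Type*} [NormedAddCommGroup E] [NormedSpace ℝ E]
    [CompleteSpace E] {V : E → E} (hV : ContDiff ℝ 1 V) {ε : ℝ} (hε : 0 < ε)
    (h : ∀ x : E, ∃ γ : ℝ → E, γ 0 = x ∧ ∀ t ∈ Ioo (-ε) ε, HasDerivAt γ (V (γ t)) t) (x : E) :
    ∃ γ : ℝ → E, γ 0 = x ∧ ∀ t, HasDerivAt γ (V (γ t)) t := by
  obtain ⟨γ, h0, hγ⟩ := exists_isMIntegralCurve_of_isMIntegralCurveOn (I := 𝓘(ℝ, E)) (M := E)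
    (v := V) (contMDiff_vectorSpace_iff_contDiff.2 hV) hε (by
      intro x
      obtain ⟨γ, h0, hγ⟩ := h x
      refine ⟨γ, h0, fun t ht => ?_⟩
      exact (hγ t ht).hasFDerivAt.hasMFDerivAt.hasMFDerivWithinAt) x
  refine ⟨γ, h0, fun t => ?_⟩
  have h1 : HasFDerivAt γ ((1 : ℝ →L[ℝ] ℝ).smulRight (V (γ t))) t :=
    hasMFDerivAt_iff_hasFDerivAt.1 (hγ t)
  simpa using h1.hasDerivAt

/-- The first order system attached to `H'' + τ(t) H' + sin (2 H) = 0`. -/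
def odeField (τ : ℝ → ℝ) (t : ℝ) (p : ℝ × ℝ) : ℝ × ℝ :=
  (p.2, -τ t * p.2 - Real.sin (2 * p.1))

theorem abs_sin_sub_sin_le (x y : ℝ) : |Real.sin x - Real.sin y| ≤ |x - y| := by
  have := Real.lipschitzWith_sin.dist_le_mul x y
  simpa [Real.dist_eq] using this

theorem lipschitzWith_odeField {τ : ℝ → ℝ} (hτ : ∀ t, |τ t| ≤ 1) (t : ℝ) :
    LipschitzWith 3 (odeField τ t) := by
  apply LipschitzWith.of_dist_le_mul
  intro p q
  rw [Prod.dist_eq, Prod.dist_eq]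
  set d := max (dist p.1 q.1) (dist p.2 q.2) with hd
  have h1 : |p.1 - q.1| ≤ d := le_max_left _ _
  have h2 : |p.2 - q.2| ≤ d := le_max_right _ _
  have h0 : 0 ≤ d := (abs_nonneg _).trans h1
  simp only [odeField, Real.dist_eq, NNReal.coe_ofNat]
  apply max_le
  · linarith
  · have h3 := abs_sin_sub_sin_le (2 * p.1) (2 * q.1)
    rw [← mul_sub, abs_mul, abs_two] at h3
    have h4 : |τ t * (p.2 - q.2)| ≤ 1 * d := by
      rw [abs_mul]
      exact mul_le_mul (hτ t) h2 (abs_nonneg _) zero_le_one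
    have h5 : -τ t * p.2 - Real.sin (2 * p.1) - (-τ t * q.2 - Real.sin (2 * q.1))
        = -(τ t * (p.2 - q.2)) - (Real.sin (2 * p.1) - Real.sin (2 * q.1)) := by ring
    rw [h5]
    refine (abs_sub _ _).trans ?_
    rw [abs_neg]
    linarith

theorem exists_global_solution {τ : ℝ → ℝ} (hτ : ContDiff ℝ 1 τ) (hτ1 : ∀ t, |τ t| ≤ 1)
    (t₀ a₀ b₀ : ℝ) :
    ∃ H K : ℝ → ℝ, H t₀ = a₀ ∧ K t₀ = b₀ ∧ (∀ t, HasDerivAt H (K t) t) ∧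
      ∀ t, HasDerivAt K (-τ t * K t - Real.sin (2 * H t)) t := by
  let V : ℝ × ℝ × ℝ → ℝ × ℝ × ℝ := fun p => (1, odeField τ p.1 p.2)
  have hV : ContDiff ℝ 1 V := by
    unfold V odeField
    have : ContDiff ℝ 1 fun p : ℝ × ℝ × ℝ => τ p.1 := hτ.comp contDiff_fst
    have : ContDiff ℝ 1 fun p : ℝ × ℝ × ℝ => Real.sin (2 * p.2.1) := by fun_prop
    fun_prop
  have hloc : ∀ x : ℝ × ℝ × ℝ, ∃ γ : ℝ → ℝ × ℝ × ℝ, γ 0 = x ∧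
      ∀ t ∈ Ioo (-(1 / 2) : ℝ) (1 / 2), HasDerivAt γ (V (γ t)) t := by
    rintro ⟨s, p⟩
    have hmem : (0 : ℝ) ∈ Icc (-(1 / 2) : ℝ) (1 / 2) := by constructor <;> norm_num
    -- On the ball of radius ‖p‖ + 1 about p the field is bounded by 2‖p‖ + 2, so the time 1/2 works
    -- for every starting point. Time is carried along as a coordinate to make the system
    -- autonomous.
    have hPL : IsPicardLindelof (fun t => odeField τ (s + t)) (tmin := -(1 / 2)) (tmax := 1 / 2)
        ⟨0, hmem⟩ p (‖p‖₊ + 1) 0 (2 * ‖p‖₊ + 2) 3 := by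
      refine ⟨fun t _ => (lipschitzWith_odeField hτ1 _).lipschitzOnWith, fun x _ => ?_, ?_, ?_⟩
      · have h1 := hτ.continuous
        unfold odeField
        fun_prop
      · intro t _ x hx
        have h1 : ‖x‖ ≤ ‖p‖ + (‖p‖ + 1) := by
          have h2 := norm_sub_le_of_le (le_refl ‖x - p‖) (le_refl ‖p‖)
          have h3 : ‖x - p‖ ≤ ‖p‖ + 1 := by simpa [dist_eq_norm] using hx
          have h4 := norm_add_le p (x - p)
          rw [add_sub_cancel] at h4
          linarith
        have h2 : |x.2| ≤ ‖x‖ := norm_snd_le x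
        push_cast
        rw [Prod.norm_def]
        apply max_le
        · simp only [odeField, Real.norm_eq_abs]
          linarith
        · simp only [odeField, Real.norm_eq_abs]
          refine (abs_sub _ _).trans ?_
          have h3 := Real.abs_sin_le_one (2 * x.1)
          have h4 : |-τ (s + t) * x.2| ≤ 1 * |x.2| := by
            rw [abs_mul, abs_neg]
            exact mul_le_mul_of_nonneg_right (hτ1 _) (abs_nonneg _)
          linarith
      · simp only [sub_zero, zero_sub, neg_neg, max_self, NNReal.coe_zero]
        push_cast
        linarith
    obtain ⟨α, hα0, hα⟩ := hPL.exists_eq_forall_mem_Icc_hasDerivWithinAt₀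
    refine ⟨fun t => (s + t, α t), by simpa using hα0, fun t ht => ?_⟩
    exact ((hasDerivAt_id t).const_add s).prodMk
      ((hα t (Ioo_subset_Icc_self ht)).hasDerivAt (Icc_mem_nhds ht.1 ht.2))
  obtain ⟨γ, hγ0, hγ⟩ := exists_global_integralCurve hV (by norm_num : (0 : ℝ) < 1 / 2) hloc
    (t₀, a₀, b₀)
  have hγ1 : ∀ t, HasDerivAt (fun t => (γ t).1) 1 t := fun t => (hγ t).fst
  have hγ2 : ∀ t, HasDerivAt (fun t => (γ t).2.1) (γ t).2.2 t := fun t => (hγ t).snd.fst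
  have hγ3 : ∀ t, HasDerivAt (fun t => (γ t).2.2)
      (-τ (γ t).1 * (γ t).2.2 - Real.sin (2 * (γ t).2.1)) t := fun t => (hγ t).snd.snd
  have htime : ∀ t, (γ t).1 = t₀ + t := by
    intro t
    have h1 : ∀ t, HasDerivAt (fun t => (γ t).1 - t) 0 t := fun t =>
      ((hγ1 t).sub (hasDerivAt_id t)).congr_deriv (sub_self 1)
    have h2 := is_const_of_deriv_eq_zero (fun t => (h1 t).differentiableAt)
      (fun t => (h1 t).deriv) t 0
    simp only [hγ0, sub_zero] at h2
    linarith
  refine ⟨fun t => (γ (t - t₀)).2.1, fun t => (γ (t - t₀)).2.2, by simp [hγ0], by simp [hγ0],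
    fun t => (hγ2 (t - t₀)).comp_sub_const t t₀, fun t => ?_⟩
  have := (hγ3 (t - t₀)).comp_sub_const t t₀
  rwa [htime, add_sub_cancel] at this

theorem solution_pair_unique {τ : ℝ → ℝ} (hτ1 : ∀ t, |τ t| ≤ 1) {a b t₀ : ℝ}
    (ht : t₀ ∈ Ioo a b) {H K H' K' : ℝ → ℝ}
    (hH : ∀ t ∈ Ioo a b, HasDerivAt H (K t) t)
    (hK : ∀ t ∈ Ioo a b, HasDerivAt K (-τ t * K t - Real.sin (2 * H t)) t)
    (hH' : ∀ t ∈ Ioo a b, HasDerivAt H' (K' t) t)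
    (hK' : ∀ t ∈ Ioo a b, HasDerivAt K' (-τ t * K' t - Real.sin (2 * H' t)) t)
    (h₁ : H t₀ = H' t₀) (h₂ : K t₀ = K' t₀) {t : ℝ} (htt : t ∈ Ioo a b) :
    H t = H' t ∧ K t = K' t := by
  have := ODE_solution_unique_of_mem_Ioo (v := odeField τ) (K := 3) (s := fun _ => univ)
    (f := fun t => (H t, K t)) (g := fun t => (H' t, K' t))
    (fun t _ => (lipschitzWith_odeField hτ1 t).lipschitzOnWith) ht
    (fun t ht => ⟨(hH t ht).prodMk (hK t ht), mem_univ _⟩)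
    (fun t ht => ⟨(hH' t ht).prodMk (hK' t ht), mem_univ _⟩) (by simp [h₁, h₂]) htt
  exact ⟨congrArg Prod.fst this, congrArg Prod.snd this⟩

/-- The friction coefficient in reversed, rescaled time. -/
def friction (δ y : ℝ) : ℝ := (1 - δ * Real.exp y ^ 2) / (1 + δ * Real.exp y ^ 2)

theorem abs_friction_le {δ : ℝ} (hδ : 0 ≤ δ) (y : ℝ) : |friction δ y| ≤ 1 := by
  have h : 0 ≤ δ * Real.exp y ^ 2 := by positivity
  rw [friction, abs_div, abs_of_pos (by linarith : 0 < 1 + δ * Real.exp y ^ 2),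
    div_le_one (by linarith), abs_le]
  constructor <;> linarith

theorem contDiff_friction {δ : ℝ} (hδ : 0 ≤ δ) {k : ℕ∞ω} : ContDiff ℝ k (friction δ) := by
  unfold friction
  refine ContDiff.div ?_ ?_ fun y => by positivity
  · exact contDiff_const.sub (contDiff_const.mul (Real.contDiff_exp.pow 2))
  · exact contDiff_const.add (contDiff_const.mul (Real.contDiff_exp.pow 2))

theorem continuousOn_friction :
    ContinuousOn (fun p : ℝ × ℝ => friction p.1 p.2) (Icc 0 1 ×ˢ univ) := by
  unfold friction
  refine ContinuousOn.div (by fun_prop) (by fun_prop) ?_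
  rintro ⟨δ, y⟩ ⟨hδ, -⟩
  have := hδ.1
  positivity

theorem abs_friction_sub_le {δ δ' : ℝ} (hδ : 0 ≤ δ) (hδ' : 0 ≤ δ') (y : ℝ) :
    |friction δ y - friction δ' y| ≤ 2 * Real.exp y ^ 2 * |δ - δ'| := by
  have h : 0 ≤ δ * Real.exp y ^ 2 := by positivity
  have h' : 0 ≤ δ' * Real.exp y ^ 2 := by positivity
  set q := Real.exp y ^ 2 with hq
  have hq0 : 0 < q := by positivity
  have e : friction δ y - friction δ' y
      = (2 * q * (δ' - δ)) / ((1 + δ * q) * (1 + δ' * q)) := by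
    rw [friction, friction, ← hq]
    field_simp
    ring
  rw [e, abs_div, abs_mul, abs_of_pos (by positivity : 0 < 2 * q), abs_sub_comm δ' δ,
    abs_of_pos (by positivity : 0 < (1 + δ * q) * (1 + δ' * q))]
  apply div_le_self (by positivity)
  nlinarith [mul_nonneg h h']

/-! ### The family of solutions regular at the pole, in the time y = log r -/

theorem sin_two_mul_arctan (x : ℝ) : Real.sin (2 * Real.arctan x) = 2 * x / (1 + x ^ 2) := by
  have h : 0 < 1 + x ^ 2 := by positivity
  rw [Real.sin_two_mul, Real.sin_arctan, Real.cos_arctan]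
  have h2 : √(1 + x ^ 2) * √(1 + x ^ 2) = 1 + x ^ 2 := Real.mul_self_sqrt h.le
  rw [show 2 * (x / √(1 + x ^ 2)) * (1 / √(1 + x ^ 2)) = 2 * x / (√(1 + x ^ 2) * √(1 + x ^ 2)) by
    ring, h2]

theorem cos_two_mul_arctan (x : ℝ) :
    Real.cos (2 * Real.arctan x) = (1 - x ^ 2) / (1 + x ^ 2) := by
  have h : 0 < 1 + x ^ 2 := by positivity
  rw [Real.cos_two_mul, Real.cos_sq_arctan]
  field_simp
  ring

/-- The angle of the solution regular at the pole in terms of `r = exp y`. -/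
def poleAngle (m : ℝ → ℝ → ℝ) (δ r : ℝ) : ℝ := 2 * Real.arctan (r * m δ (r ^ 2)) - Real.pi / 2

/-- The `y`-derivative of the angle of the solution regular at the pole. -/
def poleSpeed (m n : ℝ → ℝ → ℝ) (δ r : ℝ) : ℝ :=
  2 * r * (m δ (r ^ 2) + n δ (r ^ 2)) / (1 + (r * m δ (r ^ 2)) ^ 2)

theorem sin_two_mul_poleAngle (m : ℝ → ℝ → ℝ) (δ r : ℝ) :
    Real.sin (2 * poleAngle m δ r) = -(4 * (r * m δ (r ^ 2)) * (1 - (r * m δ (r ^ 2)) ^ 2)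
      / (1 + (r * m δ (r ^ 2)) ^ 2) ^ 2) := by
  rw [poleAngle]
  set x := r * m δ (r ^ 2)
  rw [show 2 * (2 * Real.arctan x - Real.pi / 2) = 2 * (2 * Real.arctan x) - Real.pi by ring,
    Real.sin_sub_pi, Real.sin_two_mul, sin_two_mul_arctan, cos_two_mul_arctan]
  have h : 1 + x ^ 2 ≠ 0 := by positivity
  field_simp
  ring

theorem RegularFamily.hasDerivAt_poleAngle {ε : ℝ} {m n : ℝ → ℝ → ℝ} (F : RegularFamily ε m n)
    {δ : ℝ} (hδ : δ ∈ Icc (0 : ℝ) 1) {r : ℝ} (hr : 0 < r) (hrε : r ^ 2 < ε) :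
    HasDerivAt (poleAngle m δ) (poleSpeed m n δ r / r) r := by
  have h1 := F.hasDerivAt_fst δ hδ r hr hrε
  have h2 := ((((hasDerivAt_id r).mul h1).arctan).const_mul 2).sub_const (Real.pi / 2)
  refine h2.congr_deriv ?_
  simp only [poleSpeed, Pi.mul_apply, id]
  field_simp

/-- The origin of `profRhs`: it is what the pendulum equation becomes for H = 2 arctan(r m) - π/2
when d/dy = r d/dr. -/
theorem RegularFamily.hasDerivAt_poleSpeed {ε : ℝ} {m n : ℝ → ℝ → ℝ} (F : RegularFamily ε m n)
    {δ : ℝ} (hδ : δ ∈ Icc (0 : ℝ) 1) {r : ℝ} (hr : 0 < r) (hrε : r ^ 2 < ε) :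
    HasDerivAt (poleSpeed m n δ)
      ((-((1 - δ * r ^ 2) / (1 + δ * r ^ 2)) * poleSpeed m n δ r
        - Real.sin (2 * poleAngle m δ r)) / r) r := by
  have h1 := F.hasDerivAt_fst δ hδ r hr hrε
  have h2 := F.hasDerivAt_snd δ hδ r hr hrε
  have hden : 1 + (r * m δ (r ^ 2)) ^ 2 ≠ 0 := by positivity
  have h3 := (((hasDerivAt_id r).const_mul 2).mul (h1.add h2)).div
    ((((hasDerivAt_id r).mul h1).pow 2).const_add 1) hden
  refine h3.congr_deriv ?_
  rw [sin_two_mul_poleAngle]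
  simp only [poleSpeed, Pi.mul_apply, Pi.add_apply, Pi.pow_apply, id, profRhs]
  generalize m δ (r ^ 2) = M at *
  generalize n δ (r ^ 2) = N at *
  have hδr : 1 + δ * r ^ 2 ≠ 0 := by have := hδ.1; positivity
  have hrM : 1 + r ^ 2 * M ^ 2 ≠ 0 := by positivity
  have e3 : (2 - 1 : ℕ) = 1 := rfl
  simp only [e3, Nat.cast_ofNat, pow_one]
  have e4 : (1 - δ * r ^ 2) / (1 + δ * r ^ 2) = 1 - r ^ 2 * (2 * δ / (1 + δ * r ^ 2)) := by
    field_simp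
    ring
  rw [show (1 + (r * M) ^ 2) = 1 + r ^ 2 * M ^ 2 by ring, e4]
  generalize 2 * δ / (1 + δ * r ^ 2) = w
  field_simp
  ring

/-- The family, indexed by `δ`, of solutions of `H'' + friction δ * H' + sin (2 H) = 0` that are
regular at the pole. -/
structure BaseFamily (ε : ℝ) (m n : ℝ → ℝ → ℝ) (y₁ : ℝ) (H K : ℝ → ℝ → ℝ) : Prop
    extends RegularFamily ε m n where
  hasDerivAt_angle : ∀ δ ∈ Icc (0 : ℝ) 1, ∀ y, HasDerivAt (H δ) (K δ y) y
  hasDerivAt_speed : ∀ δ ∈ Icc (0 : ℝ) 1, ∀ y,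
    HasDerivAt (K δ) (-friction δ y * K δ y - Real.sin (2 * H δ y)) y
  exp_lt : Real.exp y₁ ^ 2 ≤ ε
  exp_le : Real.exp y₁ ≤ 1 / 2
  angle_eq : ∀ δ ∈ Icc (0 : ℝ) 1, ∀ y < y₁, H δ y = poleAngle m δ (Real.exp y)
  speed_eq : ∀ δ ∈ Icc (0 : ℝ) 1, ∀ y < y₁, K δ y = poleSpeed m n δ (Real.exp y)

theorem exists_baseFamily : ∃ ε m n y₁ H K, BaseFamily ε m n y₁ H K := by
  obtain ⟨ε, m, n, F⟩ := exists_regularFamily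
  have hε := F.pos
  -- The bound 1/2 on r, with |m - 1| < 1/4, keeps r m < 1, so that the angle is still negative for
  -- y < y₁.
  obtain ⟨y₁, hy₁⟩ : ∃ y₁, Real.exp y₁ = min (√ε) (1 / 2) :=
    ⟨Real.log (min (√ε) (1 / 2)), Real.exp_log (lt_min (Real.sqrt_pos.2 hε) (by norm_num))⟩
  have h1 : Real.exp y₁ ^ 2 ≤ ε := by
    calc Real.exp y₁ ^ 2 ≤ √ε ^ 2 := by
          rw [hy₁]
          exact pow_le_pow_left₀ (le_min (Real.sqrt_nonneg _) (by norm_num)) (min_le_left _ _) 2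
      _ = ε := Real.sq_sqrt hε.le
  have hloc : ∀ y < y₁, Real.exp y ^ 2 < ε := fun y hy =>
    (pow_lt_pow_left₀ (Real.exp_lt_exp.2 hy) (Real.exp_pos y).le two_ne_zero).trans_le h1
  have hex : ∀ δ : ℝ, ∃ H K : ℝ → ℝ, δ ∈ Icc (0 : ℝ) 1 →
      H (y₁ - 1) = poleAngle m δ (Real.exp (y₁ - 1)) ∧
      K (y₁ - 1) = poleSpeed m n δ (Real.exp (y₁ - 1)) ∧ (∀ t, HasDerivAt H (K t) t) ∧
      ∀ t, HasDerivAt K (-friction δ t * K t - Real.sin (2 * H t)) t := by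
    intro δ
    by_cases hδ : δ ∈ Icc (0 : ℝ) 1
    · obtain ⟨H, K, h⟩ := exists_global_solution (contDiff_friction hδ.1) (abs_friction_le hδ.1)
        (y₁ - 1) (poleAngle m δ (Real.exp (y₁ - 1))) (poleSpeed m n δ (Real.exp (y₁ - 1)))
      exact ⟨H, K, fun _ => h⟩
    · exact ⟨0, 0, fun h => absurd h hδ⟩
  choose H K hHK using hex
  have heq : ∀ δ ∈ Icc (0 : ℝ) 1, ∀ y < y₁, H δ y = poleAngle m δ (Real.exp y) ∧
      K δ y = poleSpeed m n δ (Real.exp y) := by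
    intro δ hδ y hy
    obtain ⟨h2, h3, h4, h5⟩ := hHK δ hδ
    refine solution_pair_unique (abs_friction_le hδ.1) (a := min y y₁ - 2) (b := y₁)
      (t₀ := y₁ - 1) ⟨by have := min_le_right y y₁; linarith, by linarith⟩
      (H' := fun y => poleAngle m δ (Real.exp y)) (K' := fun y => poleSpeed m n δ (Real.exp y))
      (fun t _ => h4 t) (fun t _ => h5 t) ?_ ?_ h2 h3
      ⟨by have := min_le_left y y₁; linarith, hy⟩
    · intro t ht
      refine ((F.hasDerivAt_poleAngle hδ (Real.exp_pos t) (hloc t ht.2)).comp t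
        (Real.hasDerivAt_exp t)).congr_deriv ?_
      field_simp
    · intro t ht
      refine ((F.hasDerivAt_poleSpeed hδ (Real.exp_pos t) (hloc t ht.2)).comp t
        (Real.hasDerivAt_exp t)).congr_deriv ?_
      rw [friction]
      field_simp
  exact ⟨ε, m, n, y₁, H, K,
    { toRegularFamily := F
      hasDerivAt_angle := fun δ hδ => (hHK δ hδ).2.2.1
      hasDerivAt_speed := fun δ hδ => (hHK δ hδ).2.2.2
      exp_lt := h1
      exp_le := hy₁ ▸ min_le_right _ _
      angle_eq := fun δ hδ y hy => (heq δ hδ y hy).1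
      speed_eq := fun δ hδ y hy => (heq δ hδ y hy).2 }⟩

/-! ### Continuous dependence on δ, including δ = 0 -/

namespace BaseFamily

variable {ε : ℝ} {m n : ℝ → ℝ → ℝ} {y₁ : ℝ} {H K : ℝ → ℝ → ℝ}

theorem exp_sq_lt (F : BaseFamily ε m n y₁ H K) {y : ℝ} (hy : y < y₁) : Real.exp y ^ 2 < ε :=
  (pow_lt_pow_left₀ (Real.exp_lt_exp.2 hy) (Real.exp_pos y).le two_ne_zero).trans_le F.exp_lt

theorem abs_exp_sq_lt (F : BaseFamily ε m n y₁ H K) {y : ℝ} (hy : y < y₁) :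
    |Real.exp y ^ 2| < ε := by
  rw [abs_of_nonneg (sq_nonneg _)]
  exact F.exp_sq_lt hy

theorem continuousOn_local (F : BaseFamily ε m n y₁ H K) :
    ContinuousOn (fun p : ℝ × ℝ => (H p.1 p.2, K p.1 p.2)) (Icc 0 1 ×ˢ Iio y₁) := by
  have hmap : MapsTo (fun p : ℝ × ℝ => (p.1, Real.exp p.2 ^ 2)) (Icc 0 1 ×ˢ Iio y₁)
      (Icc 0 1 ×ˢ Ioo (-ε) ε) := by
    rintro ⟨δ, y⟩ ⟨hδ, hy⟩
    exact ⟨hδ, by have := sq_nonneg (Real.exp y); have := F.pos; linarith, F.exp_sq_lt hy⟩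
  have hc : ContinuousOn (fun p : ℝ × ℝ => (p.1, Real.exp p.2 ^ 2)) (Icc 0 1 ×ˢ Iio y₁) := by
    fun_prop
  have hm : ContinuousOn (fun p : ℝ × ℝ => m p.1 (Real.exp p.2 ^ 2)) (Icc 0 1 ×ˢ Iio y₁) :=
    F.continuousOn_fst.comp hc hmap
  have hn : ContinuousOn (fun p : ℝ × ℝ => n p.1 (Real.exp p.2 ^ 2)) (Icc 0 1 ×ˢ Iio y₁) :=
    F.continuousOn_snd.comp hc hmap
  have hexp : ContinuousOn (fun p : ℝ × ℝ => Real.exp p.2) (Icc 0 1 ×ˢ Iio y₁) := by fun_prop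
  have hA : ContinuousOn (fun p : ℝ × ℝ => poleAngle m p.1 (Real.exp p.2))
      (Icc 0 1 ×ˢ Iio y₁) := by
    unfold poleAngle
    exact (continuousOn_const.mul (Real.continuous_arctan.comp_continuousOn
      (hexp.mul hm))).sub continuousOn_const
  have hB : ContinuousOn (fun p : ℝ × ℝ => poleSpeed m n p.1 (Real.exp p.2))
      (Icc 0 1 ×ˢ Iio y₁) := by
    unfold poleSpeed
    refine ContinuousOn.div ((continuousOn_const.mul hexp).mul (hm.add hn))
      (continuousOn_const.add ((hexp.mul hm).pow 2)) fun p _ => ?_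
    positivity
  refine (hA.prodMk hB).congr ?_
  rintro ⟨δ, y⟩ ⟨hδ, hy⟩
  simp only [F.angle_eq δ hδ y hy, F.speed_eq δ hδ y hy]

/-- Grönwall: the trajectory for δ' solves the equation for δ up to the defect (friction δ -
friction δ') K, which is controlled on bounded intervals. -/
theorem dist_le (F : BaseFamily ε m n y₁ H K) {δ δ' : ℝ} (hδ : δ ∈ Icc (0 : ℝ) 1)
    (hδ' : δ' ∈ Icc (0 : ℝ) 1) {a b C : ℝ} (hC : ∀ t ∈ Icc a b, |K δ' t| ≤ C) :
    ∀ t ∈ Icc a b, dist (H δ t, K δ t) (H δ' t, K δ' t)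
      ≤ gronwallBound (dist (H δ a, K δ a) (H δ' a, K δ' a)) (3 : NNReal)
        (0 + 2 * Real.exp b ^ 2 * |δ - δ'| * C) (t - a) := by
  have hp : ∀ δ ∈ Icc (0 : ℝ) 1, ∀ t, HasDerivAt (fun t => (H δ t, K δ t))
      (odeField (friction δ) t (H δ t, K δ t)) t := fun δ hδ t =>
    (F.hasDerivAt_angle δ hδ t).prodMk (F.hasDerivAt_speed δ hδ t)
  refine dist_le_of_approx_trajectories_ODE (v := odeField (friction δ))
    (f' := fun t => odeField (friction δ) t (H δ t, K δ t))
    (g' := fun t => odeField (friction δ') t (H δ' t, K δ' t))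
    (lipschitzWith_odeField (abs_friction_le hδ.1))
    (fun t _ => (hp δ hδ t).continuousAt.continuousWithinAt)
    (fun t _ => (hp δ hδ t).hasDerivWithinAt) (fun t _ => (dist_self _).le)
    (fun t _ => (hp δ' hδ' t).continuousAt.continuousWithinAt)
    (fun t _ => (hp δ' hδ' t).hasDerivWithinAt) ?_ le_rfl
  intro t ht
  have h1 := hC t (Ico_subset_Icc_self ht)
  have h2 := abs_friction_sub_le hδ.1 hδ'.1 t
  have h3 : Real.exp t ^ 2 ≤ Real.exp b ^ 2 :=
    pow_le_pow_left₀ (Real.exp_pos t).le (Real.exp_le_exp.2 ht.2.le) 2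
  rw [Prod.dist_eq]
  simp only [odeField, Real.dist_eq, sub_self, abs_zero]
  have h0 : 0 ≤ C := (abs_nonneg _).trans h1
  apply max_le (by positivity)
  rw [show -friction δ' t * K δ' t - Real.sin (2 * H δ' t)
    - (-friction δ t * K δ' t - Real.sin (2 * H δ' t))
    = (friction δ t - friction δ' t) * K δ' t by ring, abs_mul]
  refine mul_le_mul (h2.trans ?_) h1 (abs_nonneg _) (by positivity)
  exact mul_le_mul_of_nonneg_right (by linarith) (abs_nonneg _)

/-- Below y₁ the explicit formula is jointly continuous. From y₁ - 1 on, that initial continuity is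
transported by the Grönwall estimate against the fixed trajectory for δ₀. -/
theorem continuousOn (F : BaseFamily ε m n y₁ H K) :
    ContinuousOn (fun p : ℝ × ℝ => (H p.1 p.2, K p.1 p.2)) (Icc 0 1 ×ˢ univ) := by
  rintro ⟨δ₀, y₀⟩ ⟨hδ₀, -⟩
  set a := y₁ - 1 with ha
  by_cases hy : y₀ < y₁
  · have h1 := F.continuousOn_local (δ₀, y₀) ⟨hδ₀, hy⟩
    refine h1.mono_of_mem_nhdsWithin ?_
    have : (univ : Set ℝ) ×ˢ Iio y₁ ∈ 𝓝 (δ₀, y₀) := prod_mem_nhds univ_mem (Iio_mem_nhds hy)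
    filter_upwards [self_mem_nhdsWithin, mem_nhdsWithin_of_mem_nhds this] with p h1 h2
    exact ⟨h1.1, h2.2⟩
  have hay : a < y₀ := by rw [ha]; linarith [not_lt.1 hy]
  set b := y₀ + 1 with hb
  have hKc : Continuous (K δ₀) :=
    continuous_iff_continuousAt.2 fun t => (F.hasDerivAt_speed δ₀ hδ₀ t).continuousAt
  have hHc : Continuous (H δ₀) :=
    continuous_iff_continuousAt.2 fun t => (F.hasDerivAt_angle δ₀ hδ₀ t).continuousAt
  obtain ⟨C, hC⟩ := (isCompact_Icc (a := a) (b := b)).exists_bound_of_continuousOn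
    hKc.continuousOn
  have hinit : Tendsto (fun p : ℝ × ℝ => dist (H p.1 a, K p.1 a) (H δ₀ a, K δ₀ a))
      (𝓝[Icc 0 1 ×ˢ univ] (δ₀, y₀)) (𝓝 0) := by
    have h1 := F.continuousOn_local (δ₀, a) ⟨hδ₀, by rw [ha]; simp⟩
    have h2 : Tendsto (fun p : ℝ × ℝ => (p.1, a)) (𝓝[Icc 0 1 ×ˢ univ] (δ₀, y₀))
        (𝓝[Icc 0 1 ×ˢ Iio y₁] (δ₀, a)) := by
      apply tendsto_nhdsWithin_of_tendsto_nhds_of_eventually_within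
      · refine Tendsto.mono_left ?_ nhdsWithin_le_nhds
        exact Continuous.tendsto' (by fun_prop) _ _ rfl
      · filter_upwards [self_mem_nhdsWithin] with p hp
        exact ⟨hp.1, by rw [ha]; simp⟩
    have h3 := Tendsto.comp h1 h2
    exact tendsto_iff_dist_tendsto_zero.1 h3
  have hbound : Tendsto (fun p : ℝ × ℝ =>
      gronwallBound (dist (H p.1 a, K p.1 a) (H δ₀ a, K δ₀ a)) (3 : NNReal)
        (0 + 2 * Real.exp b ^ 2 * |p.1 - δ₀| * C) (p.2 - a)
      + dist (H δ₀ p.2, K δ₀ p.2) (H δ₀ y₀, K δ₀ y₀))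
      (𝓝[Icc 0 1 ×ˢ univ] (δ₀, y₀)) (𝓝 0) := by
    have h3 : ((3 : NNReal) : ℝ) ≠ 0 := by norm_num
    simp only [gronwallBound_of_K_ne_0 h3]
    have t1 : Tendsto (fun p : ℝ × ℝ => Real.exp ((3 : NNReal) * (p.2 - a)))
        (𝓝[Icc 0 1 ×ˢ univ] (δ₀, y₀)) (𝓝 (Real.exp ((3 : NNReal) * (y₀ - a)))) :=
      Tendsto.mono_left (Continuous.tendsto' (by fun_prop) _ _ rfl) nhdsWithin_le_nhds
    have t2 : Tendsto (fun p : ℝ × ℝ => (0 + 2 * Real.exp b ^ 2 * |p.1 - δ₀| * C) / (3 : NNReal))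
        (𝓝[Icc 0 1 ×ˢ univ] (δ₀, y₀)) (𝓝 0) :=
      Tendsto.mono_left (Continuous.tendsto' (by fun_prop) _ _ (by simp)) nhdsWithin_le_nhds
    have t3 : Tendsto (fun p : ℝ × ℝ => dist (H δ₀ p.2, K δ₀ p.2) (H δ₀ y₀, K δ₀ y₀))
        (𝓝[Icc 0 1 ×ˢ univ] (δ₀, y₀)) (𝓝 0) :=
      Tendsto.mono_left (Continuous.tendsto' (by fun_prop) _ _ (by simp)) nhdsWithin_le_nhds
    have := ((hinit.mul t1).add (t2.mul (t1.sub_const 1))).add t3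
    simpa using this
  refine tendsto_iff_dist_tendsto_zero.2 (squeeze_zero' (.of_forall fun _ => dist_nonneg) ?_
    hbound)
  have hmem : (univ : Set ℝ) ×ˢ Ioo a b ∈ 𝓝 (δ₀, y₀) :=
    prod_mem_nhds univ_mem (Ioo_mem_nhds hay (by rw [hb]; linarith))
  filter_upwards [self_mem_nhdsWithin, mem_nhdsWithin_of_mem_nhds hmem] with p h1 h2
  refine (dist_triangle _ (H δ₀ p.2, K δ₀ p.2) _).trans ?_
  gcongr
  exact F.dist_le h1.1 hδ₀ hC p.2 (Ioo_subset_Icc_self h2.2)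

end BaseFamily

/-! ## Energy, phase and rotation -/

theorem image_sub_le_of_hasDerivAt_le {f f' : ℝ → ℝ} {a b C : ℝ} (hab : a ≤ b)
    (hf : ∀ t ∈ Icc a b, HasDerivAt f (f' t) t) (hC : ∀ t ∈ Icc a b, f' t ≤ C) :
    f b - f a ≤ C * (b - a) := by
  refine (convex_Icc a b).image_sub_le_mul_sub_of_deriv_le
    (fun t ht => (hf t ht).continuousAt.continuousWithinAt)
    (fun t ht => (hf t (interior_subset ht)).differentiableAt.differentiableWithinAt)
    (fun t ht => ?_) a (left_mem_Icc.2 hab) b (right_mem_Icc.2 hab) hab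
  rw [(hf t (interior_subset ht)).deriv]
  exact hC t (interior_subset ht)

/-- A function that decreases strictly wherever it takes the value `L` stays below `L`. -/
theorem lt_of_hasDerivAt_neg_at_level {φ φ' : ℝ → ℝ} (hφ : ∀ y, HasDerivAt φ (φ' y) y) {L : ℝ}
    (hL : ∀ y, φ y = L → φ' y < 0) {y₀ y : ℝ} (h0 : φ y₀ ≤ L) (hy : y₀ < y) : φ y < L := by
  have hle : ∀ z, y₀ ≤ z → φ z ≤ L := by
    intro z hz
    exact image_le_of_deriv_right_lt_deriv_boundary (f := φ) (f' := φ') (a := y₀) (b := z)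
      (B := fun _ => L) (B' := fun _ => 0)
      (fun t _ => (hφ t).continuousAt.continuousWithinAt)
      (fun t _ => (hφ t).hasDerivWithinAt) h0 (fun t => hasDerivAt_const t L)
      (fun t _ ht => hL t ht) (right_mem_Icc.2 hz)
  refine lt_of_le_of_ne (hle y hy.le) fun heq => ?_
  have h1 : IsLocalMaxOn φ (Icc y₀ y) y := by
    filter_upwards [self_mem_nhdsWithin] with t ht
    rw [heq]
    exact hle t ht.1
  have h2 : (y₀ - y) ∈ posTangentConeAt (Icc y₀ y) y := by
    apply sub_mem_posTangentConeAt_of_segment_subset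
    rw [segment_symm, segment_eq_Icc hy.le]
  have h3 := h1.hasFDerivWithinAt_nonpos (hφ y).hasFDerivAt.hasFDerivWithinAt h2
  simp only [ContinuousLinearMap.toSpanSingleton_apply, smul_eq_mul] at h3
  nlinarith [hL y heq]

/-- A positive solution of the autonomous equation below the separatrix cannot persist. -/
theorem false_of_pos_autonomous {h k : ℝ → ℝ} {y₀ : ℝ} (hh : ∀ y, HasDerivAt h (k y) y)
    (hk : ∀ y, HasDerivAt k (-k y - Real.sin (2 * h y)) y) (hpos : ∀ y, y₀ ≤ y → 0 < h y)
    (hlt : ∀ y, y₀ ≤ y → h y < Real.pi / 2)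
    (hE : k y₀ ^ 2 / 2 + Real.sin (h y₀) ^ 2 < 1) : False := by
  have hpi := Real.pi_gt_three
  have hpi' := Real.pi_lt_four
  set E : ℝ → ℝ := fun y => k y ^ 2 / 2 + Real.sin (h y) ^ 2 with hEdef
  have hEd : ∀ y, HasDerivAt E (-k y ^ 2) y := by
    intro y
    refine ((((hk y).pow 2).div_const 2).add ((hh y).sin.pow 2)).congr_deriv ?_
    rw [Real.sin_two_mul]
    push_cast
    ring
  have hEanti : ∀ y z, y ≤ z → E z ≤ E y := by
    intro y z hyz
    have := image_sub_le_of_hasDerivAt_le hyz (fun t _ => hEd t)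
      (fun t _ => neg_nonpos.2 (sq_nonneg (k t)))
    linarith
  set κ := 1 - E y₀ with hκ
  have hκ0 : 0 < κ := by rw [hκ]; simp only [hEdef]; linarith
  have hE0 : ∀ y, 0 ≤ E y := fun y => by simp only [hEdef]; positivity
  have hκ1 : κ ≤ 1 := by have := hE0 y₀; linarith
  have hjordan : ∀ y, y₀ ≤ y → h y ≤ 2 * Real.sin (h y) := by
    intro y hy
    have h1 := Real.mul_le_sin (hpos y hy).le (hlt y hy).le
    have h2 : 1 / 2 ≤ 2 / Real.pi := by
      rw [div_le_div_iff₀ (by norm_num) Real.pi_pos]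
      linarith
    nlinarith [hpos y hy]
  have hsin : ∀ y, y₀ ≤ y → κ * h y ≤ Real.sin (2 * h y) := by
    intro y hy
    have hc : 0 < Real.cos (h y) :=
      Real.cos_pos_of_mem_Ioo ⟨by linarith [hpos y hy], hlt y hy⟩
    have hc1 : κ ≤ Real.cos (h y) ^ 2 := by
      have h1 := hEanti y₀ y hy
      have h2 : Real.sin (h y) ^ 2 ≤ E y := by
        simp only [hEdef]; nlinarith [sq_nonneg (k y)]
      have h3 := Real.sin_sq_add_cos_sq (h y)
      linarith
    have hc2 : κ ≤ Real.cos (h y) := by nlinarith [Real.cos_le_one (h y)]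
    rw [Real.sin_two_mul]
    nlinarith [hjordan y hy, hpos y hy]
  -- Lyapunov function V = E + k + h, with V' = -k² - sin 2h. While E ≥ 1/2, either k² or h is
  -- bounded below, and V decreases at rate at least κ/4.
  obtain ⟨y₂, hy₂, hE₂⟩ : ∃ y, y₀ ≤ y ∧ E y < 1 / 2 := by
    by_contra! hcon
    have hV : ∀ y, HasDerivAt (fun y => E y + (k y + h y))
        (-k y ^ 2 + (-k y - Real.sin (2 * h y) + k y)) y := fun y =>
      (hEd y).add ((hk y).add (hh y))
    set V₀ := E y₀ + (k y₀ + h y₀) with hV₀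
    -- By this time V would have fallen to at most -3, but E ≥ 0, h > 0 and k > -2 keep it above -2.
    set z := y₀ + (4 / κ) * (|V₀| + 3) with hz
    have hzy : y₀ ≤ z := by
      have : 0 ≤ (4 / κ) * (|V₀| + 3) := by positivity
      linarith
    have hdec := image_sub_le_of_hasDerivAt_le hzy (fun t _ => hV t) (C := -(κ / 4)) (by
      intro t ht
      have h1 := hcon t ht.1
      have h2 := hsin t ht.1
      have h3 : Real.sin (h t) ≤ h t := Real.sin_le (hpos t ht.1).le
      have h4 : 0 ≤ Real.sin (h t) := by linarith [hjordan t ht.1, hpos t ht.1]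
      have h5 := hpos t ht.1
      have h6 := hlt t ht.1
      have h7 : Real.sin (h t) ^ 2 ≤ 2 * h t := by nlinarith
      simp only [hEdef] at h1
      nlinarith [sq_nonneg (k t)])
    have h1 : κ / 4 * (z - y₀) = |V₀| + 3 := by
      rw [hz]
      field_simp
      ring
    have h2 := hpos z hzy
    have h3 := hE0 z
    have h4 : -2 < k z := by
      have h5 := hEanti y₀ z hzy
      have h6 : k z ^ 2 / 2 ≤ E z := by simp only [hEdef]; nlinarith [sq_nonneg (Real.sin (h z))]
      nlinarith
    have h5 := le_abs_self V₀
    linarith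
  have hquart : ∀ y, y₂ ≤ y → h y ≤ Real.sin (2 * h y) := by
    intro y hy
    have hy' := hy₂.trans hy
    have h1 : Real.sin (h y) ^ 2 < 1 / 2 := by
      have h2 := hEanti y₂ y hy
      have h3 : Real.sin (h y) ^ 2 ≤ E y := by
        simp only [hEdef]; nlinarith [sq_nonneg (k y)]
      linarith
    have h2 : 0 < Real.cos (2 * h y) := by
      rw [Real.cos_two_mul]
      have := Real.sin_sq_add_cos_sq (h y)
      linarith
    have h3 : 2 * h y ≤ Real.pi / 2 := by
      by_contra! hcon
      have := Real.cos_nonpos_of_pi_div_two_le_of_le hcon.le (by linarith [hlt y hy'])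
      linarith
    have h4 := Real.mul_le_sin (by linarith [hpos y hy'] : 0 ≤ 2 * h y) h3
    have h5 : 1 / 2 ≤ 2 / Real.pi := by
      rw [div_le_div_iff₀ (by norm_num) Real.pi_pos]
      linarith
    nlinarith [hpos y hy']
  -- For w = k/h the Riccati equation gives w' ≤ -(w² + w + 1) = -((w + 1/2)² + 3/4), so arctan(w +
  -- 1/2) falls at rate at least 3/4. Over length 8 it would fall by 6, more than the width π of its
  -- range.
  have hA : ∀ y, y₂ ≤ y → HasDerivAt (fun y => Real.arctan (k y / h y + 1 / 2))
      (1 / (1 + (k y / h y + 1 / 2) ^ 2) *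
        (((-k y - Real.sin (2 * h y)) * h y - k y * k y) / h y ^ 2)) y := fun y hy =>
    ((((hk y).div (hh y) (hpos y (hy₂.trans hy)).ne').add_const (1 / 2)).arctan)
  have hdec := image_sub_le_of_hasDerivAt_le (by linarith : y₂ ≤ y₂ + 8)
    (fun t ht => hA t ht.1) (C := -(3 / 4)) (by
      intro t ht
      have h1 := hpos t (hy₂.trans ht.1)
      have h2 := hquart t ht.1
      set w := k t / h t with hw
      have h3 : ((-k t - Real.sin (2 * h t)) * h t - k t * k t) / h t ^ 2
          = -w - Real.sin (2 * h t) / h t - w ^ 2 := by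
        rw [hw]
        field_simp
      have h4 : 1 ≤ Real.sin (2 * h t) / h t := (one_le_div h1).2 h2
      rw [h3, one_div, inv_mul_le_iff₀ (by positivity)]
      nlinarith)
  have h1 := Real.neg_pi_div_two_lt_arctan (k (y₂ + 8) / h (y₂ + 8) + 1 / 2)
  have h2 := Real.arctan_lt_pi_div_two (k y₂ / h y₂ + 1 / 2)
  linarith

/-! ### Bounds on angle and energy -/

namespace BaseFamily

variable {ε : ℝ} {m n : ℝ → ℝ → ℝ} {y₁ : ℝ} {H K : ℝ → ℝ → ℝ} {δ : ℝ}

theorem profile_bounds (F : BaseFamily ε m n y₁ H K) (hδ : δ ∈ Icc (0 : ℝ) 1) {y : ℝ}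
    (hy : y < y₁) :
    |m δ (Real.exp y ^ 2) - 1| < 1 / 4 ∧ |n δ (Real.exp y ^ 2)| < 1 / 4 ∧ Real.exp y < 1 / 2 :=
  ⟨F.abs_fst_sub_one_lt δ hδ _ (F.abs_exp_sq_lt hy), F.abs_snd_lt δ hδ _ (F.abs_exp_sq_lt hy),
    (Real.exp_lt_exp.2 hy).trans_le F.exp_le⟩

theorem angle_mem_of_lt (F : BaseFamily ε m n y₁ H K) (hδ : δ ∈ Icc (0 : ℝ) 1) {y : ℝ}
    (hy : y < y₁) : H δ y ∈ Ioo (-(Real.pi / 2)) 0 := by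
  obtain ⟨h1, -, h3⟩ := F.profile_bounds hδ hy
  rw [abs_lt] at h1
  have hr := Real.exp_pos y
  rw [F.angle_eq δ hδ y hy, poleAngle]
  have h4 : 0 < Real.exp y * m δ (Real.exp y ^ 2) := mul_pos hr (by linarith)
  have h5 : Real.exp y * m δ (Real.exp y ^ 2) < 1 := by nlinarith
  have h6 : 0 < Real.arctan (Real.exp y * m δ (Real.exp y ^ 2)) := Real.arctan_pos.2 h4
  have h7 : Real.arctan (Real.exp y * m δ (Real.exp y ^ 2)) < Real.pi / 4 := by
    rw [← Real.arctan_one]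
    exact Real.arctan_strictMono h5
  constructor <;> linarith

/-- Explicitly 1 - E = 2r²(2m² - (m + n)²)/(1 + r²m²)², which is positive since m and n are within
1/4 of 1 and 0. -/
theorem energy_lt_one_of_lt (F : BaseFamily ε m n y₁ H K) (hδ : δ ∈ Icc (0 : ℝ) 1) {y : ℝ}
    (hy : y < y₁) : K δ y ^ 2 / 2 + Real.sin (H δ y) ^ 2 < 1 := by
  obtain ⟨h1, h2, h3⟩ := F.profile_bounds hδ hy
  rw [abs_lt] at h1 h2
  have hr := Real.exp_pos y
  rw [F.angle_eq δ hδ y hy, F.speed_eq δ hδ y hy, poleAngle, poleSpeed, Real.sin_sub_pi_div_two,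
    cos_two_mul_arctan]
  generalize m δ (Real.exp y ^ 2) = M at *
  generalize n δ (Real.exp y ^ 2) = N at *
  generalize Real.exp y = r at *
  have hd : 0 < 1 + (r * M) ^ 2 := by positivity
  have h4 : (2 * r * (M + N) / (1 + (r * M) ^ 2)) ^ 2 / 2
      + (-((1 - (r * M) ^ 2) / (1 + (r * M) ^ 2))) ^ 2
      = 1 - (2 * r ^ 2 * (2 * M ^ 2 - (M + N) ^ 2)) / (1 + (r * M) ^ 2) ^ 2 := by
    field_simp
    ring
  rw [h4]
  have h5 : 0 < 2 * M ^ 2 - (M + N) ^ 2 := by nlinarith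
  have : 0 < (2 * r ^ 2 * (2 * M ^ 2 - (M + N) ^ 2)) / (1 + (r * M) ^ 2) ^ 2 := by positivity
  linarith

/-- The condition on y says x ≥ 0; there the friction is nonnegative, so the energy cannot rise
above its value near the pole. -/
theorem energy_lt_one (F : BaseFamily ε m n y₁ H K) (hδ : δ ∈ Icc (0 : ℝ) 1) {y : ℝ}
    (hy : δ * Real.exp y ^ 2 ≤ 1) : K δ y ^ 2 / 2 + Real.sin (H δ y) ^ 2 < 1 := by
  by_cases hyy : y < y₁
  · exact F.energy_lt_one_of_lt hδ hyy
  have hEd : ∀ t, HasDerivAt (fun y => K δ y ^ 2 / 2 + Real.sin (H δ y) ^ 2)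
      (-friction δ t * K δ t ^ 2) t := by
    intro t
    refine ((((F.hasDerivAt_speed δ hδ t).pow 2).div_const 2).add
      ((F.hasDerivAt_angle δ hδ t).sin.pow 2)).congr_deriv ?_
    rw [Real.sin_two_mul]
    push_cast
    ring
  have h1 := image_sub_le_of_hasDerivAt_le (by linarith : y₁ - 1 ≤ y) (fun t _ => hEd t)
    (C := 0) (by
      intro t ht
      have h2 : δ * Real.exp t ^ 2 ≤ 1 := by
        refine le_trans (mul_le_mul_of_nonneg_left ?_ hδ.1) hy
        exact pow_le_pow_left₀ (Real.exp_pos t).le (Real.exp_le_exp.2 ht.2) 2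
      have h3 : 0 ≤ δ * Real.exp t ^ 2 := mul_nonneg hδ.1 (sq_nonneg _)
      have h4 : 0 ≤ friction δ t := div_nonneg (by linarith) (by linarith)
      nlinarith [mul_nonneg h4 (sq_nonneg (K δ t))])
  have h2 := F.energy_lt_one_of_lt hδ (by linarith : y₁ - 1 < y₁)
  linarith

theorem continuous_angle (F : BaseFamily ε m n y₁ H K) (hδ : δ ∈ Icc (0 : ℝ) 1) :
    Continuous (H δ) :=
  continuous_iff_continuousAt.2 fun t => (F.hasDerivAt_angle δ hδ t).continuousAt

/-- Leaving the strip would require sin² H = 1 at some earlier time, against the energy bound. -/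
theorem angle_mem (F : BaseFamily ε m n y₁ H K) (hδ : δ ∈ Icc (0 : ℝ) 1) {y : ℝ}
    (hy : δ * Real.exp y ^ 2 ≤ 1) : H δ y ∈ Ioo (-(Real.pi / 2)) (Real.pi / 2) := by
  have hpi := Real.pi_pos
  by_cases hyy : y < y₁
  · have := F.angle_mem_of_lt hδ hyy
    exact ⟨this.1, this.2.trans (by linarith)⟩
  have hle : y₁ - 1 ≤ y := by linarith
  have hcont : ContinuousOn (H δ) (Icc (y₁ - 1) y) := (F.continuous_angle hδ).continuousOn
  have h0 := F.angle_mem_of_lt hδ (by linarith : y₁ - 1 < y₁)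
  have hsin : ∀ t ∈ Icc (y₁ - 1) y, Real.sin (H δ t) ^ 2 < 1 := by
    intro t ht
    have h2 : δ * Real.exp t ^ 2 ≤ 1 := by
      refine le_trans (mul_le_mul_of_nonneg_left ?_ hδ.1) hy
      exact pow_le_pow_left₀ (Real.exp_pos t).le (Real.exp_le_exp.2 ht.2) 2
    have := F.energy_lt_one hδ h2
    nlinarith [sq_nonneg (K δ t)]
  constructor
  · by_contra! hcon
    obtain ⟨t, ht, hHt⟩ := intermediate_value_Icc' hle hcont ⟨hcon, h0.1.le⟩
    have := hsin t ht
    simp [hHt] at this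
  · by_contra! hcon
    obtain ⟨t, ht, hHt⟩ := intermediate_value_Icc hle hcont
      (⟨by linarith [h0.2], hcon⟩ : Real.pi / 2 ∈ Icc _ _)
    have := hsin t ht
    simp [hHt] at this

/-- By uniqueness a trajectory through the origin is identically zero, but near the pole the angle
is negative. This makes the phase well defined. -/
theorem normSq_pos (F : BaseFamily ε m n y₁ H K) (hδ : δ ∈ Icc (0 : ℝ) 1) (y : ℝ) :
    0 < H δ y ^ 2 + K δ y ^ 2 := by
  rcases (add_nonneg (sq_nonneg (H δ y)) (sq_nonneg (K δ y))).lt_or_eq with h | h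
  · exact h
  exfalso
  have hH : H δ y = 0 := by nlinarith [sq_nonneg (H δ y), sq_nonneg (K δ y)]
  have hK : K δ y = 0 := by nlinarith [sq_nonneg (H δ y), sq_nonneg (K δ y)]
  have h1 := solution_pair_unique (abs_friction_le hδ.1) (a := min y y₁ - 2) (b := max y y₁ + 1)
    (t₀ := y) (t := y₁ - 1)
    ⟨by have := min_le_left y y₁; linarith, by have := le_max_left y y₁; linarith⟩
    (fun t _ => F.hasDerivAt_angle δ hδ t) (fun t _ => F.hasDerivAt_speed δ hδ t)
    (H' := fun _ => 0) (K' := fun _ => 0) (fun t _ => hasDerivAt_const t 0)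
    (fun t _ => by simpa using hasDerivAt_const t (0 : ℝ)) hH hK
    ⟨by have := min_le_right y y₁; linarith, by have := le_max_right y y₁; linarith⟩
  have h2 := F.angle_mem_of_lt hδ (by linarith : y₁ - 1 < y₁)
  rw [h1.1] at h2
  exact lt_irrefl _ h2.2

end BaseFamily

/-- Angular velocity of `(H, K)` for the equation with friction. -/
def phaseRate (H K : ℝ → ℝ → ℝ) (δ y : ℝ) : ℝ :=
  (H δ y * (-friction δ y * K δ y - Real.sin (2 * H δ y)) - K δ y ^ 2)
    / (H δ y ^ 2 + K δ y ^ 2)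

/-- The continuous phase of `(H, K)`, equal to `arctan (K / H)` at `y₀`. -/
def phase (H K : ℝ → ℝ → ℝ) (y₀ δ y : ℝ) : ℝ :=
  Real.arctan (K δ y₀ / H δ y₀) + ∫ t in y₀..y, phaseRate H K δ t

/-! ### The phase, its barriers and its values at x = 0 -/

namespace BaseFamily

variable {ε : ℝ} {m n : ℝ → ℝ → ℝ} {y₁ : ℝ} {H K : ℝ → ℝ → ℝ} {δ : ℝ}

theorem continuousOn_phaseRate (F : BaseFamily ε m n y₁ H K) :
    ContinuousOn (fun p : ℝ × ℝ => phaseRate H K p.1 p.2) (Icc 0 1 ×ˢ univ) := by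
  have h := F.continuousOn
  have hH : ContinuousOn (fun p : ℝ × ℝ => H p.1 p.2) (Icc 0 1 ×ˢ univ) := h.fst
  have hK : ContinuousOn (fun p : ℝ × ℝ => K p.1 p.2) (Icc 0 1 ×ˢ univ) := h.snd
  unfold phaseRate
  refine ContinuousOn.div ((hH.mul ((continuousOn_friction.neg.mul hK).sub
    (Real.continuous_sin.comp_continuousOn (continuousOn_const.mul hH)))).sub (hK.pow 2))
    ((hH.pow 2).add (hK.pow 2)) ?_
  rintro ⟨δ, y⟩ ⟨hδ, -⟩
  exact (F.normSq_pos hδ y).ne'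

theorem continuous_phaseRate (F : BaseFamily ε m n y₁ H K) (hδ : δ ∈ Icc (0 : ℝ) 1) :
    Continuous (phaseRate H K δ) := by
  have : ContinuousOn (fun t : ℝ => ((δ, t) : ℝ × ℝ)) univ := by fun_prop
  have h := F.continuousOn_phaseRate.comp this (fun t _ => ⟨hδ, mem_univ _⟩)
  exact continuousOn_univ.1 h

theorem hasDerivAt_phase (F : BaseFamily ε m n y₁ H K) (hδ : δ ∈ Icc (0 : ℝ) 1) (y₀ y : ℝ) :
    HasDerivAt (phase H K y₀ δ) (phaseRate H K δ y) y :=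
  ((F.continuous_phaseRate hδ).integral_hasStrictDerivAt y₀ y).hasDerivAt.const_add _

theorem continuous_phase (F : BaseFamily ε m n y₁ H K) :
    Continuous fun p : Icc (0 : ℝ) 1 × ℝ => phase H K (y₁ - 1) p.1 p.2 := by
  have h : ∀ y, Continuous fun p : Icc (0 : ℝ) 1 × ℝ => (H p.1 y, K p.1 y) := by
    intro y
    have h1 : ContinuousOn (fun p : Icc (0 : ℝ) 1 × ℝ => (((p.1 : ℝ), y) : ℝ × ℝ)) univ := by
      fun_prop
    exact continuousOn_univ.1 (F.continuousOn.comp h1 (fun p _ => ⟨p.1.2, mem_univ _⟩))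
  have h0 := h (y₁ - 1)
  have h1 : Continuous fun p : Icc (0 : ℝ) 1 × ℝ =>
      Real.arctan (K p.1 (y₁ - 1) / H p.1 (y₁ - 1)) :=
    Real.continuous_arctan.comp (h0.snd.div h0.fst fun p =>
      (F.angle_mem_of_lt p.1.2 (by linarith : y₁ - 1 < y₁)).2.ne)
  have h2 : Continuous fun q : (Icc (0 : ℝ) 1 × ℝ) × ℝ => phaseRate H K q.1.1 q.2 := by
    have h3 : ContinuousOn
        (fun q : (Icc (0 : ℝ) 1 × ℝ) × ℝ => (((q.1.1 : ℝ), q.2) : ℝ × ℝ)) univ := by fun_prop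
    exact continuousOn_univ.1 (F.continuousOn_phaseRate.comp h3
      (fun q _ => ⟨q.1.1.2, mem_univ _⟩))
  exact h1.add (intervalIntegral.continuous_parametric_intervalIntegral_of_continuous
    (f := fun (p : Icc (0 : ℝ) 1 × ℝ) t => phaseRate H K p.1 t) h2 continuous_snd)

/-- With N = H² + K², the quantity (K cos φ - H sin φ)²/N has zero derivative when φ' is the angular
velocity, and it vanishes at the base point by the choice of the arctangent. -/
theorem cos_phase (F : BaseFamily ε m n y₁ H K) (hδ : δ ∈ Icc (0 : ℝ) 1) (y : ℝ) :
    K δ y * Real.cos (phase H K (y₁ - 1) δ y) = H δ y * Real.sin (phase H K (y₁ - 1) δ y) := by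
  set φ := phase H K (y₁ - 1) δ with hφ
  set Q : ℝ → ℝ := fun y => (K δ y * Real.cos (φ y) - H δ y * Real.sin (φ y)) ^ 2
    / (H δ y ^ 2 + K δ y ^ 2) with hQ
  have hQd : ∀ y, HasDerivAt Q 0 y := by
    intro y
    have h1 := F.hasDerivAt_angle δ hδ y
    have h2 := F.hasDerivAt_speed δ hδ y
    have h3 : HasDerivAt φ (phaseRate H K δ y) y := F.hasDerivAt_phase hδ _ y
    have hN := (F.normSq_pos hδ y).ne'
    have h4 := (((h2.mul h3.cos).sub (h1.mul h3.sin)).pow 2).div ((h1.pow 2).add (h2.pow 2)) hN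
    refine h4.congr_deriv ?_
    simp only [phaseRate, Pi.mul_apply, Pi.sub_apply, Pi.pow_apply, Pi.add_apply]
    have e : (2 - 1 : ℕ) = 1 := rfl
    simp only [e, pow_one, Nat.cast_ofNat]
    generalize -friction δ y * K δ y - Real.sin (2 * H δ y) = L
    generalize H δ y = A at *
    generalize K δ y = B at *
    field_simp
    ring
  have h0 : Q (y₁ - 1) = 0 := by
    have hne : H δ (y₁ - 1) ≠ 0 := (F.angle_mem_of_lt hδ (by linarith : y₁ - 1 < y₁)).2.ne
    have h1 : φ (y₁ - 1) = Real.arctan (K δ (y₁ - 1) / H δ (y₁ - 1)) := by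
      simp [hφ, phase]
    have h2 : K δ (y₁ - 1) * Real.cos (φ (y₁ - 1)) - H δ (y₁ - 1) * Real.sin (φ (y₁ - 1)) = 0 := by
      rw [h1, Real.sin_arctan, Real.cos_arctan]
      field_simp
      ring
    simp only [hQ, h2]
    simp
  have h1 := is_const_of_deriv_eq_zero (fun y => (hQd y).differentiableAt)
    (fun y => (hQd y).deriv) y (y₁ - 1)
  rw [h0] at h1
  simp only [hQ] at h1
  rw [div_eq_zero_iff] at h1
  rcases h1 with h1 | h1
  · have := pow_eq_zero_iff (two_ne_zero) |>.1 h1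
    linarith
  · exact absurd h1 (F.normSq_pos hδ y).ne'

theorem angle_eq_zero_of_cos_phase (F : BaseFamily ε m n y₁ H K) (hδ : δ ∈ Icc (0 : ℝ) 1) {y : ℝ}
    (h : Real.cos (phase H K (y₁ - 1) δ y) = 0) : H δ y = 0 := by
  have h1 := F.cos_phase hδ y
  rw [h, mul_zero] at h1
  rcases mul_eq_zero.1 h1.symm with h2 | h2
  · exact h2
  · have := Real.sin_sq_add_cos_sq (phase H K (y₁ - 1) δ y)
    rw [h, h2] at this
    norm_num at this

theorem cos_phase_eq_zero (F : BaseFamily ε m n y₁ H K) (hδ : δ ∈ Icc (0 : ℝ) 1) {y : ℝ}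
    (h : H δ y = 0) : Real.cos (phase H K (y₁ - 1) δ y) = 0 := by
  have h1 := F.cos_phase hδ y
  have h2 := F.normSq_pos hδ y
  rw [h, zero_mul] at h1
  rcases mul_eq_zero.1 h1 with h3 | h3
  · rw [h, h3] at h2
    norm_num at h2
  · exact h3

/-- At a zero of H the rate is exactly -1, whatever the friction. -/
theorem phaseRate_neg (F : BaseFamily ε m n y₁ H K) (hδ : δ ∈ Icc (0 : ℝ) 1) {y : ℝ}
    (h : H δ y = 0) : phaseRate H K δ y < 0 := by
  have h2 := F.normSq_pos hδ y
  rw [phaseRate]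
  apply div_neg_of_neg_of_pos _ h2
  rw [h] at h2 ⊢
  nlinarith

/-- The levels with cos L = 0 are one-way barriers: the phase can meet them only at zeros of H,
where it is decreasing. -/
theorem phase_lt (F : BaseFamily ε m n y₁ H K) (hδ : δ ∈ Icc (0 : ℝ) 1) {L y₀ y : ℝ}
    (hL : Real.cos L = 0) (h0 : phase H K (y₁ - 1) δ y₀ ≤ L) (hy : y₀ < y) :
    phase H K (y₁ - 1) δ y < L :=
  lt_of_hasDerivAt_neg_at_level (F.hasDerivAt_phase hδ _)
    (fun y hyL => F.phaseRate_neg hδ (F.angle_eq_zero_of_cos_phase hδ (by rw [hyL, hL]))) h0 hy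

/-- H has no zero below y₁, so the phase stays on the principal branch; hence its limit at the pole
is 0. -/
theorem phase_eq_arctan (F : BaseFamily ε m n y₁ H K) (hδ : δ ∈ Icc (0 : ℝ) 1) {y : ℝ}
    (hy : y < y₁) : phase H K (y₁ - 1) δ y = Real.arctan (K δ y / H δ y) := by
  have hd : ∀ t ∈ Iio y₁, HasDerivAt
      (fun y => phase H K (y₁ - 1) δ y - Real.arctan (K δ y / H δ y)) 0 t := by
    intro t ht
    have hne : H δ t ≠ 0 := (F.angle_mem_of_lt hδ ht).2.ne
    have h1 := F.hasDerivAt_angle δ hδ t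
    have h2 := F.hasDerivAt_speed δ hδ t
    refine ((F.hasDerivAt_phase hδ (y₁ - 1) t).sub ((h2.div h1 hne).arctan)).congr_deriv ?_
    have hN := (F.normSq_pos hδ t).ne'
    simp only [phaseRate, Pi.div_apply]
    generalize -friction δ t * K δ t - Real.sin (2 * H δ t) = L
    generalize H δ t = A at *
    generalize K δ t = B at *
    field_simp
    ring
  have h1 : y₁ - 1 ∈ Iio y₁ := by simp
  have h2 := (convex_Iio y₁).is_const_of_fderivWithin_eq_zero (𝕜 := ℝ)
    (fun t ht => (hd t ht).differentiableAt.differentiableWithinAt) (fun t ht => by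
      have h3 := (hd t ht).hasFDerivAt.hasFDerivWithinAt (s := Iio y₁)
      rw [h3.fderivWithin (isOpen_Iio.uniqueDiffWithinAt ht)]
      ext
      simp) hy h1
  have h3 : phase H K (y₁ - 1) δ (y₁ - 1) = Real.arctan (K δ (y₁ - 1) / H δ (y₁ - 1)) := by
    simp [phase]
  rw [h3, sub_self] at h2
  linarith

theorem tendsto_poleAngle_arg (F : BaseFamily ε m n y₁ H K) (hδ : δ ∈ Icc (0 : ℝ) 1) :
    Tendsto (fun y => m δ (Real.exp y ^ 2)) atBot (𝓝 1) := by
  have h1 : Tendsto (fun y => Real.exp y ^ 2) atBot (𝓝 0) := by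
    simpa using Real.tendsto_exp_atBot.pow 2
  have h2 := (F.contDiffAt δ hδ 0 (by simpa using F.pos)).continuousAt.tendsto
  rw [F.fst_zero] at h2
  exact h2.comp h1

theorem tendsto_angle (F : BaseFamily ε m n y₁ H K) (hδ : δ ∈ Icc (0 : ℝ) 1) :
    Tendsto (H δ) atBot (𝓝 (-(Real.pi / 2))) := by
  have h1 := Real.tendsto_exp_atBot.mul (F.tendsto_poleAngle_arg hδ)
  have h2 := (((Real.continuous_arctan.tendsto _).comp h1).const_mul 2).sub_const (Real.pi / 2)
  simp only [zero_mul, Real.arctan_zero, mul_zero, zero_sub] at h2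
  refine h2.congr' ?_
  filter_upwards [Iio_mem_atBot y₁] with y hy
  rw [F.angle_eq δ hδ y hy, poleAngle]
  rfl

theorem tendsto_speed (F : BaseFamily ε m n y₁ H K) (hδ : δ ∈ Icc (0 : ℝ) 1) :
    Tendsto (K δ) atBot (𝓝 0) := by
  have h1 : Tendsto (fun y => 3 * Real.exp y) atBot (𝓝 0) := by
    simpa using Real.tendsto_exp_atBot.const_mul 3
  refine squeeze_zero_norm' ?_ h1
  filter_upwards [Iio_mem_atBot y₁] with y hy
  obtain ⟨h2, h3, -⟩ := F.profile_bounds hδ hy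
  rw [abs_lt] at h2 h3
  have hr := Real.exp_pos y
  rw [F.speed_eq δ hδ y hy, poleSpeed, Real.norm_eq_abs, abs_of_nonneg]
  · rw [div_le_iff₀ (by positivity)]
    nlinarith [mul_nonneg hr.le (sq_nonneg (Real.exp y * m δ (Real.exp y ^ 2)))]
  · have : 0 ≤ m δ (Real.exp y ^ 2) + n δ (Real.exp y ^ 2) := by linarith
    positivity

theorem tendsto_phase (F : BaseFamily ε m n y₁ H K) (hδ : δ ∈ Icc (0 : ℝ) 1) :
    Tendsto (phase H K (y₁ - 1) δ) atBot (𝓝 0) := by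
  have hne : -(Real.pi / 2) ≠ 0 := by have := Real.pi_pos; linarith
  have h1 := (F.tendsto_speed hδ).div (F.tendsto_angle hδ) hne
  have h2 := (Real.continuous_arctan.tendsto _).comp h1
  rw [zero_div, Real.arctan_zero] at h2
  refine h2.congr' ?_
  filter_upwards [Iio_mem_atBot y₁] with y hy
  rw [F.phase_eq_arctan hδ hy]
  rfl

/-- For `δ = 0` the angle has arbitrarily late zeros. -/
theorem exists_late_zero (F : BaseFamily ε m n y₁ H K) (y₀ : ℝ) : ∃ y, y₀ < y ∧ H 0 y = 0 := by
  have h00 : (0 : ℝ) ∈ Icc (0 : ℝ) 1 := by simp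
  by_contra! hcon
  have hfr : ∀ y, friction 0 y = 1 := fun y => by simp [friction]
  have hmem : ∀ y, H 0 y ∈ Ioo (-(Real.pi / 2)) (Real.pi / 2) := fun y =>
    F.angle_mem h00 (by simp)
  have hE : ∀ y, K 0 y ^ 2 / 2 + Real.sin (H 0 y) ^ 2 < 1 := fun y =>
    F.energy_lt_one h00 (by simp)
  have hK : ∀ y, HasDerivAt (K 0) (-K 0 y - Real.sin (2 * H 0 y)) y := fun y => by
    simpa [hfr] using F.hasDerivAt_speed 0 h00 y
  have hH := F.hasDerivAt_angle 0 h00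
  have hcont := F.continuous_angle h00
  have hsign : (∀ y, y₀ + 1 ≤ y → 0 < H 0 y) ∨ ∀ y, y₀ + 1 ≤ y → H 0 y < 0 := by
    by_contra! hc
    obtain ⟨⟨a, ha, ha'⟩, ⟨b, hb, hb'⟩⟩ := hc
    have h1 : (0 : ℝ) ∈ H 0 '' (Ici (y₀ + 1)) :=
      (isPreconnected_Ici.image (H 0) hcont.continuousOn).Icc_subset
        (mem_image_of_mem _ ha) (mem_image_of_mem _ hb) ⟨ha', hb'⟩
    obtain ⟨t, ht, ht'⟩ := h1
    exact hcon t (by have : y₀ + 1 ≤ t := ht; linarith) ht'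
  rcases hsign with h | h
  · exact false_of_pos_autonomous hH hK h (fun y _ => (hmem y).2) (hE _)
  · refine false_of_pos_autonomous (h := fun y => -H 0 y) (k := fun y => -K 0 y) (y₀ := y₀ + 1)
      (fun y => (hH y).neg) (fun y => ((hK y).neg).congr_deriv ?_)
      (fun y hy => by have := h y hy; linarith) (fun y _ => by have := (hmem y).1; linarith) ?_
    · rw [mul_neg, Real.sin_neg]
      ring
    · simpa using hE (y₀ + 1)

/-- Each later zero of H puts the phase on a level with cos = 0, strictly below the previous such
level, hence lower by at least π. -/
theorem exists_phase_le (F : BaseFamily ε m n y₁ H K) (k : ℕ) :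
    ∃ y, y₁ - 1 ≤ y ∧ phase H K (y₁ - 1) 0 y ≤ -(Real.pi / 2) - k * Real.pi := by
  have h00 : (0 : ℝ) ∈ Icc (0 : ℝ) 1 := by simp
  have step : ∀ j : ℤ, ∀ y, phase H K (y₁ - 1) 0 y ≤ -(Real.pi / 2) - j * Real.pi →
      ∃ z, y < z ∧ phase H K (y₁ - 1) 0 z ≤ -(Real.pi / 2) - (j + 1 : ℤ) * Real.pi := by
    intro j y hy
    obtain ⟨z, hz, hz0⟩ := F.exists_late_zero y
    refine ⟨z, hz, ?_⟩
    have hL : Real.cos (-(Real.pi / 2) - j * Real.pi) = 0 :=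
      Real.cos_eq_zero_iff.2 ⟨-1 - j, by push_cast; ring⟩
    have h1 := F.phase_lt h00 hL hy hz
    obtain ⟨i, hi⟩ := Real.cos_eq_zero_iff.1 (F.cos_phase_eq_zero h00 hz0)
    rw [hi] at h1 ⊢
    have hpi := Real.pi_pos
    have h2 : (i : ℝ) < -1 - j := by
      by_contra! hcon
      nlinarith
    have h3 : i < -1 - j := by exact_mod_cast h2
    have h4 : i ≤ -2 - j := by omega
    have h5 : (i : ℝ) ≤ -2 - j := by exact_mod_cast h4
    push_cast
    nlinarith
  induction k with
  | zero =>
    have h1 : phase H K (y₁ - 1) 0 (y₁ - 1) < Real.pi / 2 := by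
      rw [F.phase_eq_arctan h00 (by linarith)]
      exact Real.arctan_lt_pi_div_two _
    -- The index -1 is the level +π/2, below which the initial arctangent certainly lies.
    obtain ⟨z, hz, hz'⟩ := step (-1) (y₁ - 1) (by push_cast; linarith)
    exact ⟨z, hz.le, by simpa using hz'⟩
  | succ k ih =>
    obtain ⟨y, hy, hy'⟩ := ih
    obtain ⟨z, hz, hz'⟩ := step k y (by exact_mod_cast hy')
    exact ⟨z, hy.trans hz.le, by exact_mod_cast hz'⟩

/-- For δ = 1 the solution is explicit; it is the profile of the identity map of the sphere. -/
theorem angle_one (F : BaseFamily ε m n y₁ H K) (y : ℝ) :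
    H 1 y = 2 * Real.arctan (Real.exp y) - Real.pi / 2 := by
  have h11 : (1 : ℝ) ∈ Icc (0 : ℝ) 1 := by simp
  have hlt : y₁ - 1 < y₁ := by linarith
  have habs := F.abs_exp_sq_lt hlt
  refine (solution_pair_unique (abs_friction_le zero_le_one) (a := min y y₁ - 2)
    (b := max y y₁ + 1) (t₀ := y₁ - 1) (t := y)
    ⟨by have := min_le_right y y₁; linarith, by have := le_max_right y y₁; linarith⟩
    (fun t _ => F.hasDerivAt_angle 1 h11 t) (fun t _ => F.hasDerivAt_speed 1 h11 t)
    (H' := fun y => 2 * Real.arctan (Real.exp y) - Real.pi / 2)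
    (K' := fun y => 2 * Real.exp y / (1 + Real.exp y ^ 2)) ?_ ?_ ?_ ?_
    ⟨by have := min_le_left y y₁; linarith, by have := le_max_left y y₁; linarith⟩).1
  · intro t _
    refine (((Real.hasDerivAt_exp t).arctan.const_mul 2).sub_const _).congr_deriv ?_
    ring
  · intro t _
    have hd : 1 + Real.exp t ^ 2 ≠ 0 := by positivity
    refine (((Real.hasDerivAt_exp t).const_mul 2).div
      (((Real.hasDerivAt_exp t).pow 2).const_add 1) hd).congr_deriv ?_
    have := sin_two_mul_poleAngle (fun _ _ => 1) 1 (Real.exp t)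
    simp only [poleAngle, mul_one] at this
    rw [this, friction, one_mul]
    have e : (2 - 1 : ℕ) = 1 := rfl
    simp only [e, pow_one, Nat.cast_ofNat, Pi.pow_apply]
    field_simp
    ring
  · rw [F.angle_eq 1 h11 _ hlt, poleAngle, F.fst_one _ habs, mul_one]
  · rw [F.speed_eq 1 h11 _ hlt, poleSpeed, F.fst_one _ habs, F.snd_one _ habs, mul_one, add_zero,
      mul_one]

/-- The explicit angle is negative for all y < 0, so the phase cannot reach -π/2 before y = 0. -/
theorem phase_one_zero (F : BaseFamily ε m n y₁ H K) :
    -(Real.pi / 2) ≤ phase H K (y₁ - 1) 1 0 := by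
  have h11 : (1 : ℝ) ∈ Icc (0 : ℝ) 1 := by simp
  have hy₁ : y₁ - 1 < 0 := by
    by_contra! hcon
    have h1 := Real.one_le_exp (by linarith : 0 ≤ y₁)
    linarith [F.exp_le]
  have hneg : ∀ y < 0, H 1 y < 0 := by
    intro y hy
    rw [F.angle_one]
    have : Real.arctan (Real.exp y) < Real.pi / 4 := by
      rw [← Real.arctan_one]
      exact Real.arctan_strictMono (by simpa using hy : Real.exp y < 1)
    linarith
  have hcont : Continuous (phase H K (y₁ - 1) 1) :=
    continuous_iff_continuousAt.2 fun t => (F.hasDerivAt_phase h11 _ t).continuousAt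
  have hlow : ∀ y ∈ Ico (y₁ - 1) 0, -(Real.pi / 2) ≤ phase H K (y₁ - 1) 1 y := by
    intro y hy
    by_contra! hcon
    have h1 : -(Real.pi / 2) < phase H K (y₁ - 1) 1 (y₁ - 1) := by
      rw [F.phase_eq_arctan h11 (by linarith)]
      exact Real.neg_pi_div_two_lt_arctan _
    obtain ⟨t, ht, ht'⟩ := intermediate_value_Icc' hy.1 hcont.continuousOn ⟨hcon.le, h1.le⟩
    have h2 := F.angle_eq_zero_of_cos_phase h11 (y := t) (by rw [ht']; simp)
    exact (hneg t (ht.2.trans_lt hy.2)).ne h2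
  have h1 : Tendsto (phase H K (y₁ - 1) 1) (𝓝[<] 0) (𝓝 (phase H K (y₁ - 1) 1 0)) :=
    (hcont.tendsto 0).mono_left nhdsWithin_le_nhds
  refine ge_of_tendsto h1 ?_
  filter_upwards [Ioo_mem_nhdsLT hy₁] with y hy
  exact hlow y (Ioo_subset_Ico_self hy)

/-- Every rotation number is attained. -/
theorem exists_phase_eq (F : BaseFamily ε m n y₁ H K) {k : ℕ} (hk : 1 ≤ k) :
    ∃ δ ∈ Ioc (0 : ℝ) 1,
      phase H K (y₁ - 1) δ (-(Real.log δ / 2)) = -(k * (Real.pi / 2)) := by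
  have hpi := Real.pi_pos
  have hk' : (1 : ℝ) ≤ k := by exact_mod_cast hk
  obtain ⟨y, -, hy'⟩ := F.exists_phase_le k
  have hL : Real.cos (-(Real.pi / 2) - k * Real.pi) = 0 :=
    Real.cos_eq_zero_iff.2 ⟨-1 - k, by push_cast; ring⟩
  -- Waiting one more unit of time makes the inequality strict, hence an open condition on δ.
  have h1 := F.phase_lt (by simp : (0 : ℝ) ∈ Icc (0 : ℝ) 1) hL hy' (by linarith : y < y + 1)
  have hcont := F.continuous_phase
  -- Small δ keeps the strict inequality at y + 1 and also moves the time -(log δ)/2 of x = 0 beyond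
  -- y + 1. The barrier then preserves the inequality up to x = 0.
  obtain ⟨δ₀, hδ₀, hδ₀y, hδ₀φ⟩ : ∃ δ₀ ∈ Ioc (0 : ℝ) 1, δ₀ < Real.exp (-(2 * (y + 1))) ∧
      phase H K (y₁ - 1) δ₀ (y + 1) < -(Real.pi / 2) - k * Real.pi := by
    have h2 : Continuous fun p : Icc (0 : ℝ) 1 => phase H K (y₁ - 1) p (y + 1) :=
      hcont.comp (Continuous.prodMk continuous_id continuous_const :
        Continuous fun p : Icc (0 : ℝ) 1 => (p, y + 1))
    have h3 : {p : Icc (0 : ℝ) 1 | phase H K (y₁ - 1) p (y + 1) < -(Real.pi / 2) - k * Real.pi}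
        ∈ 𝓝 (⟨0, by simp⟩ : Icc (0 : ℝ) 1) := (isOpen_lt h2 continuous_const).mem_nhds h1
    change ∀ᶠ p : Icc (0 : ℝ) 1 in 𝓝 ⟨0, by simp⟩,
      phase H K (y₁ - 1) p (y + 1) < -(Real.pi / 2) - k * Real.pi at h3
    rw [nhds_subtype_eq_comap, eventually_comap] at h3
    have h4 : ∀ᶠ x in 𝓝[>] (0 : ℝ), x ∈ Ioo (0 : ℝ) (min 1 (Real.exp (-(2 * (y + 1))))) :=
      Ioo_mem_nhdsGT (lt_min one_pos (Real.exp_pos _))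
    obtain ⟨x, hx1, hx2⟩ := ((h3.filter_mono nhdsWithin_le_nhds).and h4).exists
    have hx3 : x < 1 := hx2.2.trans_le (min_le_left _ _)
    exact ⟨x, ⟨hx2.1, hx3.le⟩, hx2.2.trans_le (min_le_right _ _),
      hx1 ⟨x, hx2.1.le, hx3.le⟩ rfl⟩
  have hy2 : y + 1 < -(Real.log δ₀ / 2) := by
    have := Real.log_lt_log hδ₀.1 hδ₀y
    rw [Real.log_exp] at this
    linarith
  have hlow : phase H K (y₁ - 1) δ₀ (-(Real.log δ₀ / 2)) ≤ -(k * (Real.pi / 2)) := by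
    have := F.phase_lt ⟨hδ₀.1.le, hδ₀.2⟩ hL hδ₀φ.le hy2
    nlinarith
  have hhigh : -(k * (Real.pi / 2)) ≤ phase H K (y₁ - 1) 1 (-(Real.log 1 / 2)) := by
    rw [Real.log_one, zero_div, neg_zero]
    have := F.phase_one_zero
    nlinarith
  have hc : ContinuousOn (fun δ => phase H K (y₁ - 1) δ (-(Real.log δ / 2))) (Icc δ₀ 1) := by
    rw [continuousOn_iff_continuous_domRestrict]
    have h2 : Continuous fun p : Icc δ₀ 1 =>
        ((⟨p, hδ₀.1.le.trans p.2.1, p.2.2⟩ : Icc (0 : ℝ) 1), -(Real.log p / 2)) := by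
      refine Continuous.prodMk (by fun_prop) ?_
      have : Continuous fun p : Icc δ₀ 1 => Real.log p :=
        continuous_subtype_val.log fun p => (hδ₀.1.trans_le p.2.1).ne'
      fun_prop
    exact hcont.comp h2
  obtain ⟨δ, hδ, hδ'⟩ := intermediate_value_Icc hδ₀.2 hc ⟨hlow, hhigh⟩
  exact ⟨δ, ⟨hδ₀.1.trans_le hδ.1, hδ.2⟩, hδ'⟩

end BaseFamily

/-! ## Solutions of the original equation -/

theorem tanh_eq_exp (x : ℝ) :
    Real.tanh x = (1 - Real.exp (-x) ^ 2) / (1 + Real.exp (-x) ^ 2) := by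
  have h : Real.exp x * Real.exp (-x) = 1 := by rw [← Real.exp_add, add_neg_cancel, Real.exp_zero]
  rw [Real.tanh_eq, div_eq_div_iff (by positivity) (by positivity)]
  linear_combination (2 * Real.exp (-x)) * h

theorem abs_tanh_le (x : ℝ) : |Real.tanh x| ≤ 1 := by
  have := abs_friction_le zero_le_one (-x)
  rwa [friction, one_mul, ← tanh_eq_exp] at this

theorem contDiff_tanh {k : ℕ∞ω} : ContDiff ℝ k Real.tanh := by
  have : Real.tanh = fun x => Real.sinh x / Real.cosh x := by
    ext x
    exact Real.tanh_eq_sinh_div_cosh x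
  rw [this]
  exact Real.contDiff_sinh.div Real.contDiff_cosh fun x => (Real.cosh_pos x).ne'

namespace IsSolution

variable {h : ℝ → ℝ}

theorem hasDerivAt (hs : IsSolution h) (x : ℝ) : HasDerivAt h (deriv h x) x :=
  (hs x).1.hasDerivAt

theorem hasDerivAt_deriv (hs : IsSolution h) (x : ℝ) :
    HasDerivAt (deriv h) (Real.tanh x * deriv h x - Real.sin (2 * h x)) x := by
  refine (hs x).2.1.hasDerivAt.congr_deriv ?_
  linarith [(hs x).2.2]

theorem of_hasDerivAt {k : ℝ → ℝ} (hh : ∀ x, HasDerivAt h (k x) x)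
    (hk : ∀ x, HasDerivAt k (Real.tanh x * k x - Real.sin (2 * h x)) x) : IsSolution h := by
  have : deriv h = k := funext fun x => (hh x).deriv
  intro x
  rw [this]
  refine ⟨(hh x).differentiableAt, (hk x).differentiableAt, ?_⟩
  rw [(hk x).deriv]
  ring

theorem eq_of_eq (hs : IsSolution h) {g : ℝ → ℝ} (hg : IsSolution g) (h0 : h 0 = g 0)
    (h1 : deriv h 0 = deriv g 0) : h = g := by
  ext x
  refine (solution_pair_unique (τ := fun t => -Real.tanh t)
    (fun t => by rw [abs_neg]; exact abs_tanh_le t) (a := min x 0 - 1) (b := max x 0 + 1)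
    (t₀ := 0) (t := x)
    ⟨by have := min_le_right x 0; linarith, by have := le_max_right x 0; linarith⟩
    (fun t _ => hs.hasDerivAt t) (fun t _ => ?_) (fun t _ => hg.hasDerivAt t) (fun t _ => ?_) h0 h1
    ⟨by have := min_le_left x 0; linarith, by have := le_max_left x 0; linarith⟩).1
  · simpa using hs.hasDerivAt_deriv t
  · simpa using hg.hasDerivAt_deriv t

theorem neg (hs : IsSolution h) : IsSolution fun x => -h x := by
  refine of_hasDerivAt (k := fun x => -deriv h x) (fun x => (hs.hasDerivAt x).neg)
    (fun x => (hs.hasDerivAt_deriv x).neg.congr_deriv ?_)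
  rw [mul_neg, mul_neg, Real.sin_neg]
  ring

theorem comp_neg (hs : IsSolution h) : IsSolution fun x => h (-x) := by
  refine of_hasDerivAt (k := fun x => -deriv h (-x)) (fun x => ?_) (fun x => ?_)
  · exact ((hs.hasDerivAt (-x)).comp x (hasDerivAt_neg x)).congr_deriv (by ring)
  · refine ((hs.hasDerivAt_deriv (-x)).comp x (hasDerivAt_neg x)).neg.congr_deriv ?_
    rw [Real.tanh_neg]
    ring

theorem deriv_comp_neg (hs : IsSolution h) (x : ℝ) : deriv (fun x => h (-x)) x = -deriv h (-x) := by
  have : HasDerivAt (fun x => h (-x)) (-deriv h (-x)) x :=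
    ((hs.hasDerivAt (-x)).comp x (hasDerivAt_neg x)).congr_deriv (by ring)
  exact this.deriv

/-- The equation is invariant under x ↦ -x and h ↦ -h, so uniqueness at x = 0 yields the symmetry;
the even case is analogous. -/
theorem odd_of_zero (hs : IsSolution h) (h0 : h 0 = 0) (x : ℝ) : h (-x) = -h x := by
  refine congrFun (hs.comp_neg.eq_of_eq hs.neg ?_ ?_) x
  · simp [h0]
  · rw [hs.deriv_comp_neg, deriv.fun_neg, neg_zero]

theorem even_of_deriv_zero (hs : IsSolution h) (h0 : deriv h 0 = 0) (x : ℝ) : h (-x) = h x := by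
  refine congrFun (hs.comp_neg.eq_of_eq hs ?_ ?_) x
  · simp
  · rw [hs.deriv_comp_neg, neg_zero, h0, neg_zero]

theorem contDiff (hs : IsSolution h) : ContDiff ℝ ∞ h := by
  have key : ∀ k : ℕ, ContDiff ℝ k h ∧ ContDiff ℝ k (deriv h) := by
    intro k
    have hd : Differentiable ℝ h := fun x => (hs x).1
    have hd' : Differentiable ℝ (deriv h) := fun x => (hs x).2.1
    induction k with
    | zero => exact ⟨contDiff_zero.2 hd.continuous, contDiff_zero.2 hd'.continuous⟩
    | succ k ih =>
      constructor
      · exact_mod_cast contDiff_succ_iff_deriv.2 ⟨hd, by simp, ih.2⟩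
      · have : deriv (deriv h) = fun x => Real.tanh x * deriv h x - Real.sin (2 * h x) :=
          funext fun x => (hs.hasDerivAt_deriv x).deriv
        have h3 : ContDiff ℝ k (deriv (deriv h)) := by
          rw [this]
          exact (contDiff_tanh.mul ih.2).sub (Real.contDiff_sin.comp (contDiff_const.mul ih.1))
        exact_mod_cast contDiff_succ_iff_deriv.2 ⟨hd', by simp, h3⟩
  exact contDiff_infty.2 fun k => (key k).1

end IsSolution

theorem isBigO_pow_succ_of_hasDerivAt {g g' : ℝ → ℝ} (hg : ∀ x, HasDerivAt g (g' x) x)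
    (h0 : g 0 = 0) {k : ℕ} (hO : g' =O[𝓝 0] fun x : ℝ => x ^ k) :
    g =O[𝓝 0] fun x : ℝ => x ^ (k + 1) := by
  obtain ⟨C, hC⟩ := hO.bound
  obtain ⟨r, hr, hball⟩ := Metric.eventually_nhds_iff_ball.1 hC
  refine IsBigO.of_bound C ?_
  filter_upwards [Metric.ball_mem_nhds (0 : ℝ) hr] with x hx
  rw [mem_ball_zero_iff, Real.norm_eq_abs] at hx
  have hmv := (convex_Icc (-|x|) |x|).norm_image_sub_le_of_norm_hasDerivWithin_le
    (f := g) (f' := g') (C := C * |x| ^ k) (fun t _ => (hg t).hasDerivWithinAt) (fun t ht => by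
      have htx : |t| ≤ |x| := abs_le.2 ht
      have h1 := hball t (by rw [mem_ball_zero_iff, Real.norm_eq_abs]; linarith)
      refine h1.trans ?_
      rw [norm_pow, Real.norm_eq_abs]
      -- The constant of a big-O bound may be negative; then the bound at |x| forces x = 0, or is
      -- absurd when k = 0.
      have hC0 : 0 ≤ C ∨ C < 0 := le_or_gt 0 C
      rcases hC0 with hC0 | hC0
      · exact mul_le_mul_of_nonneg_left (pow_le_pow_left₀ (abs_nonneg t) htx k) hC0
      · have h2 := hball (|x|) (by rw [mem_ball_zero_iff, Real.norm_eq_abs, abs_abs]; exact hx)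
        have h3 : 0 ≤ C * ‖|x| ^ k‖ := (norm_nonneg _).trans h2
        rw [norm_pow, Real.norm_eq_abs, abs_abs] at h3
        rcases k.eq_zero_or_pos with rfl | hk
        · simp at h3; linarith
        · have h4 : |x| ^ k = 0 := by nlinarith [pow_nonneg (abs_nonneg x) k]
          have h5 : |x| = 0 := pow_eq_zero_iff hk.ne' |>.1 h4
          have h6 : |t| = 0 := le_antisymm (h5 ▸ htx) (abs_nonneg t)
          rw [h6, h5])
    (⟨by linarith [abs_nonneg x], abs_nonneg x⟩ : (0 : ℝ) ∈ Icc (-|x|) |x|)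
    (⟨neg_abs_le x, le_abs_self x⟩ : x ∈ Icc (-|x|) |x|)
  rw [h0, sub_zero, sub_zero] at hmv
  rw [norm_pow, Real.norm_eq_abs x, pow_succ, ← mul_assoc]
  exact hmv

/-- If h(0) = 0, the right-hand side of the equation vanishes at 0, so h'' = O(x). Two applications
of the mean value inequality give the cubic remainder. -/
theorem IsSolution.isOddOrbit {h : ℝ → ℝ} (hs : IsSolution h) (h0 : h 0 = 0) :
    IsOddOrbit (deriv h 0) h := by
  refine ⟨hs, ?_⟩
  have h2 : (fun x => Real.tanh x * deriv h x - Real.sin (2 * h x)) =O[𝓝 0]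
      fun x : ℝ => x ^ 1 := by
    have hd : DifferentiableAt ℝ (fun x => Real.tanh x * deriv h x - Real.sin (2 * h x)) 0 := by
      have h1 : DifferentiableAt ℝ Real.tanh 0 :=
        (contDiff_tanh (k := 1)).contDiffAt.differentiableAt one_ne_zero
      exact (h1.mul (hs 0).2.1).sub ((((hs 0).1).const_mul 2).sin)
    have := hd.isBigO_sub
    simpa [h0] using this
  have h1 : (fun x => deriv h x - deriv h 0) =O[𝓝 0] fun x : ℝ => x ^ 2 :=
    isBigO_pow_succ_of_hasDerivAt (fun x => (hs.hasDerivAt_deriv x).sub_const _) (sub_self _) h2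
  exact isBigO_pow_succ_of_hasDerivAt (g := fun x => h x - deriv h 0 * x)
    (fun x => ((hs.hasDerivAt x).sub ((hasDerivAt_id x).const_mul (deriv h 0))).congr_deriv
      (by rw [mul_one])) (by simp [h0]) h1

theorem IsSolution.isEvenOrbit {h : ℝ → ℝ} (hs : IsSolution h) (h0 : deriv h 0 = 0) :
    IsEvenOrbit (h 0) h := by
  refine ⟨hs, ?_⟩
  have h1 : deriv h =O[𝓝 0] fun x : ℝ => x ^ 1 := by
    have := (hs 0).2.1.isBigO_sub
    simpa [h0] using this
  exact isBigO_pow_succ_of_hasDerivAt (g := fun x => h x - h 0)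
    (fun x => (hs.hasDerivAt x).sub_const _) (sub_self _) h1

/-- A solution in the strip that emanates from `-π/2` at `x = ∞`, regularly in `exp (-x)`, with
leading coefficient `2 κ`. -/
structure PoleOrbit (κ : ℝ) (h : ℝ → ℝ) : Prop where
  isSolution : IsSolution h
  mem_strip : ∀ x, h x ∈ Ioo (-(Real.pi / 2)) (Real.pi / 2)
  exists_pole : ∃ (m : ℝ → ℝ) (η x₁ : ℝ), 0 < η ∧ (∀ s, |s| < η → ContDiffAt ℝ ∞ m s) ∧
    m 0 = κ ∧ (∀ s, |s| < η → 0 < m s) ∧ Real.exp (-x₁) ^ 2 ≤ η ∧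
    ∀ x, x₁ < x → h x = 2 * Real.arctan (Real.exp (-x) * m (Real.exp (-x) ^ 2)) - Real.pi / 2

/-- For every `k ≥ 1` there is an orbit whose phase rotates by `k` quarter turns between `x = 0` and
`x = ∞`. -/
theorem exists_poleOrbit : ∃ (κ : ℕ → ℝ) (h : ℕ → ℝ → ℝ), InjOn κ {k | 1 ≤ k} ∧
    ∀ k, 1 ≤ k → 0 < κ k ∧ PoleOrbit (κ k) (h k) ∧
      (Odd k → h k 0 = 0 ∧ deriv (h k) 0 ≠ 0) ∧ (Even k → deriv (h k) 0 = 0 ∧ h k 0 ≠ 0) ∧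
      ∃ θ : ℝ → ℝ, Continuous θ ∧ θ 0 = k * (Real.pi / 2) ∧
        (∀ x, deriv (h k) x * Real.cos (θ x) = h k x * Real.sin (θ x)) ∧
        Tendsto θ atTop (𝓝 0) := by
  obtain ⟨ε, m, n, y₁, H, K, F⟩ := exists_baseFamily
  have hpi := Real.pi_pos
  have hex : ∀ k : ℕ, ∃ δ, 1 ≤ k → δ ∈ Ioc (0 : ℝ) 1 ∧
      phase H K (y₁ - 1) δ (-(Real.log δ / 2)) = -(k * (Real.pi / 2)) := by
    intro k
    by_cases hk : 1 ≤ k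
    · obtain ⟨δ, h⟩ := F.exists_phase_eq hk
      exact ⟨δ, fun _ => h⟩
    · exact ⟨0, fun h => absurd h hk⟩
  choose δ hδ using hex
  -- κ = e^a and h(x) = H(a - x), where a is determined by δe^{2a} = 1, so that the friction at y =
  -- a - x is tanh x.
  refine ⟨fun k => Real.exp (-(Real.log (δ k) / 2)),
    fun k x => H (δ k) (-(Real.log (δ k) / 2) - x), ?_, ?_⟩
  -- Equal κ give equal δ, and the phase of that one solution at x = 0 is both -jπ/2 and -kπ/2.
  · intro j hj k hk hjk
    simp only [Real.exp_eq_exp] at hjk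
    obtain ⟨h1, h2⟩ := hδ j hj
    obtain ⟨h3, h4⟩ := hδ k hk
    have h5 : δ j = δ k := Real.log_injOn_pos h1.1 h3.1 (by linarith)
    rw [h5, h4, neg_inj] at h2
    have h6 : (k : ℝ) = j := mul_right_cancel₀ (by positivity) h2
    exact_mod_cast h6.symm
  intro k hk
  beta_reduce
  obtain ⟨hδk, hph⟩ := hδ k hk
  generalize δ k = d at hδk hph ⊢
  have hd : d ∈ Icc (0 : ℝ) 1 := ⟨hδk.1.le, hδk.2⟩
  set a := -(Real.log d / 2) with ha
  have hea : d * Real.exp a ^ 2 = 1 := by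
    rw [← Real.exp_nat_mul, ha]
    push_cast
    rw [show 2 * -(Real.log d / 2) = -Real.log d by ring, Real.exp_neg, Real.exp_log hδk.1,
      mul_inv_cancel₀ hδk.1.ne']
  have hexp : ∀ x, d * Real.exp (a - x) ^ 2 = Real.exp (-x) ^ 2 := by
    intro x
    rw [sub_eq_add_neg, Real.exp_add, mul_pow, ← mul_assoc, hea, one_mul]
  have hsub : ∀ x, HasDerivAt (fun x => a - x) (-1) x := fun x => by
    simpa using (hasDerivAt_id x).const_sub a
  have hH : ∀ x, HasDerivAt (fun x => H d (a - x)) (-K d (a - x)) x := fun x => by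
    exact ((F.hasDerivAt_angle d hd (a - x)).comp x (hsub x)).congr_deriv (by ring)
  have hK : ∀ x, HasDerivAt (fun x => -K d (a - x))
      (Real.tanh x * -K d (a - x) - Real.sin (2 * H d (a - x))) x := by
    intro x
    refine ((F.hasDerivAt_speed d hd (a - x)).comp x (hsub x)).neg.congr_deriv ?_
    rw [friction, hexp, ← tanh_eq_exp]
    ring
  have hs : IsSolution fun x => H d (a - x) := .of_hasDerivAt hH hK
  have hderiv : ∀ x, deriv (fun x => H d (a - x)) x = -K d (a - x) := fun x => (hH x).deriv
  have hstrip : ∀ x, 0 ≤ x → H d (a - x) ∈ Ioo (-(Real.pi / 2)) (Real.pi / 2) := by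
    intro x hx
    apply F.angle_mem hd
    rw [hexp]
    exact pow_le_one₀ (Real.exp_pos _).le (Real.exp_le_one_iff.2 (by linarith))
  have hodd : Odd k → H d (a - 0) = 0 ∧ deriv (fun x => H d (a - x)) 0 ≠ 0 := by
    rintro ⟨j, rfl⟩
    have h1 : Real.cos (phase H K (y₁ - 1) d a) = 0 := by
      rw [hph]
      exact Real.cos_eq_zero_iff.2 ⟨-1 - j, by push_cast; ring⟩
    have h2 := F.angle_eq_zero_of_cos_phase hd h1
    have h3 := F.normSq_pos hd a
    rw [hderiv, sub_zero]
    refine ⟨h2, fun h4 => ?_⟩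
    rw [neg_eq_zero] at h4
    rw [h2, h4] at h3
    norm_num at h3
  have heven : Even k → deriv (fun x => H d (a - x)) 0 = 0 ∧ H d (a - 0) ≠ 0 := by
    rintro ⟨j, rfl⟩
    have h1 : Real.sin (phase H K (y₁ - 1) d a) = 0 := by
      rw [hph]
      exact Real.sin_eq_zero_iff.2 ⟨-j, by push_cast; ring⟩
    have h2 := F.cos_phase hd a
    rw [h1, mul_zero] at h2
    have h5 : K d a = 0 := by
      rcases mul_eq_zero.1 h2 with h | h
      · exact h
      · have := Real.sin_sq_add_cos_sq (phase H K (y₁ - 1) d a)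
        rw [h, h1] at this
        norm_num at this
    have h3 := F.normSq_pos hd a
    rw [hderiv, sub_zero]
    refine ⟨by rw [h5, neg_zero], fun h4 => ?_⟩
    rw [h4, h5] at h3
    norm_num at h3
  -- The phase changes sign because x runs against y and h' = -K.
  refine ⟨Real.exp_pos a, ⟨hs, ?_, ?_⟩, hodd, heven,
    fun x => -phase H K (y₁ - 1) d (a - x), ?_, ?_, ?_, ?_⟩
  · intro x
    rcases le_or_gt 0 x with hx | hx
    · exact hstrip x hx
    -- For x < 0 the friction is negative and the energy argument fails; the parity of the orbit
    -- gives the strip instead.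
    · have h1 := hstrip (-x) (by linarith)
      rcases k.even_or_odd with hk' | hk'
      · have h2 := hs.even_of_deriv_zero (heven hk').1 x
        beta_reduce at h2
        rwa [h2] at h1
      · have h2 := hs.odd_of_zero (hodd hk').1 x
        beta_reduce at h2
        rw [h2] at h1
        exact ⟨by linarith [h1.2], by linarith [h1.1]⟩
  -- Since r = e^a e^{-x}, the profile in e^{-x} absorbs one factor e^a, and its argument s is
  -- scaled by e^{2a} = 1/d, whence the radius εd.
  · refine ⟨fun s => Real.exp a * m d (s * Real.exp a ^ 2), ε * d, a - y₁,
      mul_pos F.pos hδk.1, ?_, ?_, ?_, ?_, ?_⟩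
    · intro s hs
      refine contDiffAt_const.mul (ContDiffAt.comp (g := m d)
        (f := fun s : ℝ => s * Real.exp a ^ 2) s (F.contDiffAt d hd _ ?_) (by fun_prop))
      rw [abs_mul, abs_of_pos (by positivity : 0 < Real.exp a ^ 2)]
      calc |s| * Real.exp a ^ 2 < ε * d * Real.exp a ^ 2 :=
            mul_lt_mul_of_pos_right hs (by positivity)
        _ = ε := by rw [mul_assoc, hea, mul_one]
    · simp [F.fst_zero]
    · intro s hs
      refine mul_pos (Real.exp_pos a) ?_
      have := F.abs_fst_sub_one_lt d hd (s * Real.exp a ^ 2) (by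
        rw [abs_mul, abs_of_pos (by positivity : 0 < Real.exp a ^ 2)]
        calc |s| * Real.exp a ^ 2 < ε * d * Real.exp a ^ 2 :=
              mul_lt_mul_of_pos_right hs (by positivity)
          _ = ε := by rw [mul_assoc, hea, mul_one])
      rw [abs_lt] at this
      linarith
    · rw [← hexp, sub_sub_cancel, mul_comm]
      exact mul_le_mul_of_nonneg_right F.exp_lt hδk.1.le
    · intro x hx
      beta_reduce
      rw [F.angle_eq d hd _ (by linarith : a - x < y₁), poleAngle, sub_eq_add_neg a x,
        Real.exp_add, mul_pow, mul_comm (Real.exp a) (Real.exp (-x)),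
        mul_comm (Real.exp a ^ 2) (Real.exp (-x) ^ 2), mul_assoc]
  · have h1 : Continuous (phase H K (y₁ - 1) d) :=
      continuous_iff_continuousAt.2 fun t => (F.hasDerivAt_phase hd _ t).continuousAt
    exact (h1.comp (by fun_prop : Continuous fun x => a - x)).neg
  · simp only [sub_zero, hph, neg_neg]
  · intro x
    rw [hderiv, Real.cos_neg, Real.sin_neg]
    linarith [F.cos_phase hd (a - x)]
  · have h1 : Tendsto (fun x : ℝ => a - x) atTop atBot := tendsto_atBot_add_const_left _ a
      tendsto_neg_atTop_atBot
    simpa using ((F.tendsto_phase hd).comp h1).neg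

/-! ## Asymptotics and rotation of the orbits -/

theorem arctan_sub_self_isBigO :
    (fun x : ℝ => Real.arctan x - x) =O[𝓝 0] fun x : ℝ => x ^ 3 := by
  refine isBigO_pow_succ_of_hasDerivAt (g := fun x => Real.arctan x - x)
    (fun x => (Real.hasDerivAt_arctan x).sub (hasDerivAt_id x)) (by simp) (k := 2) ?_
  refine IsBigO.of_bound 1 (Eventually.of_forall fun x => ?_)
  have h1 : 1 / (1 + x ^ 2) - 1 = -(x ^ 2 / (1 + x ^ 2)) := by field_simp; ring
  rw [h1, norm_neg, Real.norm_of_nonneg (by positivity), Real.norm_of_nonneg (by positivity), one_mul]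
  exact div_le_self (by positivity) (by nlinarith [sq_nonneg x])

namespace PoleOrbit

variable {κ : ℝ} {h : ℝ → ℝ}

/-- With M = e^{-x} m(e^{-2x}), both arctan M - M and e^{-x}(m(e^{-2x}) - κ) are of order e^{-3x},
the latter because m is differentiable at 0. -/
theorem isBigO (P : PoleOrbit κ h) :
    (fun x : ℝ => h x - (-(Real.pi / 2) + 2 * κ * Real.exp (-x)))
      =O[atTop] fun x : ℝ => Real.exp (-(3 * x)) := by
  obtain ⟨m, η, x₁, hη, hm, hm0, -, -, hh⟩ := P.exists_pole
  have hr : Tendsto (fun x : ℝ => Real.exp (-x)) atTop (𝓝 0) := Real.tendsto_exp_neg_atTop_nhds_zero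
  have hs : Tendsto (fun x : ℝ => Real.exp (-x) ^ 2) atTop (𝓝 0) := by
    simpa using hr.pow 2
  have hd : DifferentiableAt ℝ m 0 :=
    (hm 0 (by simpa using hη)).differentiableAt (by simp)
  have hmt : Tendsto (fun x : ℝ => m (Real.exp (-x) ^ 2)) atTop (𝓝 κ) := by
    rw [← hm0]
    exact hd.continuousAt.tendsto.comp hs
  have hM : Tendsto (fun x : ℝ => Real.exp (-x) * m (Real.exp (-x) ^ 2)) atTop (𝓝 0) := by
    simpa using hr.mul hmt
  have hexp : ∀ x : ℝ, Real.exp (-(3 * x)) = Real.exp (-x) ^ 3 := fun x => by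
    rw [← Real.exp_nat_mul]
    congr 1
    push_cast
    ring
  simp only [hexp]
  have h1 : (fun x : ℝ => 2 * (Real.arctan (Real.exp (-x) * m (Real.exp (-x) ^ 2)) -
      Real.exp (-x) * m (Real.exp (-x) ^ 2))) =O[atTop] fun x : ℝ => Real.exp (-x) ^ 3 := by
    have h2 := arctan_sub_self_isBigO.comp_tendsto hM
    have h3 : (fun x : ℝ => Real.exp (-x) * m (Real.exp (-x) ^ 2)) =O[atTop]
        fun x : ℝ => Real.exp (-x) := by
      have := (isBigO_refl (fun x : ℝ => Real.exp (-x)) atTop).mul (hmt.isBigO_one ℝ)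
      simpa using this
    exact (h2.trans (h3.pow 3)).const_mul_left 2
  have h4 : (fun x : ℝ => 2 * (Real.exp (-x) * (m (Real.exp (-x) ^ 2) - m 0))) =O[atTop]
      fun x : ℝ => Real.exp (-x) ^ 3 := by
    have h5 : (fun x : ℝ => m (Real.exp (-x) ^ 2) - m 0) =O[atTop]
        fun x : ℝ => Real.exp (-x) ^ 2 := by
      have := hd.isBigO_sub.comp_tendsto hs
      simpa [Function.comp_def] using this
    have h6 := ((isBigO_refl (fun x : ℝ => Real.exp (-x)) atTop).mul h5).const_mul_left 2
    refine h6.congr_right fun x => ?_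
    ring
  refine (h1.add h4).congr' ?_ EventuallyEq.rfl
  filter_upwards [eventually_gt_atTop x₁] with x hx
  rw [hh x hx, hm0]
  ring

theorem tendsto (P : PoleOrbit κ h) : Tendsto h atTop (𝓝 (-(Real.pi / 2))) := by
  have hr : Tendsto (fun x : ℝ => Real.exp (-x)) atTop (𝓝 0) := Real.tendsto_exp_neg_atTop_nhds_zero
  have h3 : Tendsto (fun x : ℝ => Real.exp (-(3 * x))) atTop (𝓝 0) :=
    hr.comp (tendsto_id.const_mul_atTop (by norm_num : (0 : ℝ) < 3))
  have h1 := (P.isBigO.trans_tendsto h3).add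
    ((hr.const_mul (2 * κ)).const_add (-(Real.pi / 2)))
  simpa using h1

end PoleOrbit

/-- Shifting θ by jπ preserves the line it spans and the total rotation, so j only serves to reach
the prescribed θ(0). -/
theorem hasRotationNumber_of_tendsto_zero {h θ : ℝ → ℝ} {k : ℕ} (hc : Continuous θ)
    (h0 : θ 0 = k * (Real.pi / 2))
    (hp : ∀ x, deriv h x * Real.cos (θ x) = h x * Real.sin (θ x))
    (ht : Tendsto θ atTop (𝓝 0)) (j : ℤ) :
    HasRotationNumber h (k * (Real.pi / 2) + j * Real.pi) (k / 2) := by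
  refine ⟨fun x => θ x + j * Real.pi, (hc.add continuous_const).continuousOn, by simp only [h0], ?_, ?_⟩
  · intro x _
    rw [Real.cos_add_int_mul_pi, Real.sin_add_int_mul_pi, mul_left_comm, hp, mul_left_comm]
  · have h1 := ((ht.add_const (j * Real.pi)).sub_const
      (k * (Real.pi / 2) + j * Real.pi)).const_mul (-(1 / Real.pi))
    refine h1.congr' EventuallyEq.rfl |>.trans (le_of_eq ?_)
    congr 1
    have := Real.pi_ne_zero
    field_simp
    ring

theorem HasRotationNumber.const_mul {h : ℝ → ℝ} {θ₀ Ω : ℝ} (H : HasRotationNumber h θ₀ Ω) (σ : ℝ) :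
    HasRotationNumber (fun x => σ * h x) θ₀ Ω := by
  obtain ⟨θ, h1, h2, h3, h4⟩ := H
  refine ⟨θ, h1, h2, fun x hx => ?_, h4⟩
  have : deriv (fun x => σ * h x) x = σ * deriv h x := deriv_const_mul_field σ
  rw [this, mul_assoc, h3 x hx, mul_assoc]

/-- A pole orbit with either sign is connecting, with constant `2 κ`. -/
theorem PoleOrbit.hasConnectingAsymptotics {κ σ : ℝ} {h : ℝ → ℝ} (P : PoleOrbit κ h)
    (hσ : σ * σ = 1) : HasConnectingAsymptotics (fun x => σ * h x) σ (2 * κ) := by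
  unfold HasConnectingAsymptotics
  simp only [← mul_assoc, hσ, one_mul]
  exact P.isBigO

/-! ## The profile of an orbit as a function of the height on the sphere -/

theorem one_sub_sq_pos {z : ℝ} (hz : z ∈ Ioo (-1 : ℝ) 1) : 0 < 1 - z ^ 2 := by
  nlinarith [hz.1, hz.2]

theorem artanh_neg_eq {z : ℝ} (hz : z ∈ Ioo (-1 : ℝ) 1) : Real.artanh (-z) = -Real.artanh z := by
  conv_lhs => rw [← Real.tanh_artanh hz, ← Real.tanh_neg, Real.artanh_tanh]

theorem exp_artanh_sq {z : ℝ} (hz : z ∈ Ioo (-1 : ℝ) 1) :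
    Real.exp (Real.artanh z) ^ 2 = (1 + z) / (1 - z) := by
  rw [Real.exp_artanh hz, Real.sq_sqrt]
  exact div_nonneg (by linarith [hz.1]) (by linarith [hz.2])

theorem cosh_artanh_sq {z : ℝ} (hz : z ∈ Ioo (-1 : ℝ) 1) :
    Real.cosh (Real.artanh z) ^ 2 = 1 / (1 - z ^ 2) := by
  rw [Real.cosh_artanh hz, div_pow, Real.sq_sqrt (one_sub_sq_pos hz).le, one_pow]

theorem artanh_eventuallyEq {z : ℝ} (hz : z ∈ Ioo (-1 : ℝ) 1) :
    Real.artanh =ᶠ[𝓝 z] fun z => 1 / 2 * Real.log ((1 + z) / (1 - z)) := by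
  filter_upwards [isOpen_Ioo.mem_nhds hz] with x hx
  exact Real.artanh_eq_half_log ⟨hx.1.le, hx.2.le⟩

theorem contDiffAt_artanh {z : ℝ} (hz : z ∈ Ioo (-1 : ℝ) 1) : ContDiffAt ℝ ∞ Real.artanh z := by
  refine ContDiffAt.congr_of_eventuallyEq ?_ (artanh_eventuallyEq hz)
  have h1 : 1 - z ≠ 0 := by linarith [hz.2]
  have h2 : 1 + z ≠ 0 := by linarith [hz.1]
  refine contDiffAt_const.mul (ContDiffAt.log ?_ (div_ne_zero h2 h1))
  exact (contDiffAt_const.add contDiffAt_id).div (contDiffAt_const.sub contDiffAt_id) h1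

theorem hasDerivAt_artanh {z : ℝ} (hz : z ∈ Ioo (-1 : ℝ) 1) :
    HasDerivAt Real.artanh (1 / (1 - z ^ 2)) z := by
  have hd : DifferentiableAt ℝ Real.artanh z := (contDiffAt_artanh hz).differentiableAt (by simp)
  have h1 : HasDerivAt (fun x => Real.exp (Real.artanh x) ^ 2)
      (2 * Real.exp (Real.artanh z) ^ 2 * deriv Real.artanh z) z :=
    (hd.hasDerivAt.exp.pow 2).congr_deriv (by ring)
  have h2 : HasDerivAt (fun x : ℝ => (1 + x) / (1 - x)) (2 / (1 - z) ^ 2) z := by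
    refine (((hasDerivAt_id z).const_add 1).div ((hasDerivAt_id z).const_sub 1)
      (by simp; linarith [hz.2])).congr_deriv ?_
    simp only [id]
    ring
  have h3 := h1.unique (h2.congr_of_eventuallyEq (by
    filter_upwards [isOpen_Ioo.mem_nhds hz] with x hx using exp_artanh_sq hx))
  rw [exp_artanh_sq hz] at h3
  have h4 : 1 - z ≠ 0 := by linarith [hz.2]
  have h5 : 1 + z ≠ 0 := by linarith [hz.1]
  have h6 : 1 - z ^ 2 ≠ 0 := (one_sub_sq_pos hz).ne'
  refine hd.hasDerivAt.congr_deriv ?_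
  rw [eq_div_iff h6]
  field_simp at h3
  linarith

/-- The profile functions of an `SO(3)`-symmetric harmonic map
`p ↦ (A p₀, B p₀ p₁, B p₀ p₂, B p₀ p₃)` of the three-sphere. -/
structure ProfilePair (A B : ℝ → ℝ) : Prop where
  contDiffAt_fst : ∀ z ∈ Icc (-1 : ℝ) 1, ContDiffAt ℝ ∞ A z
  contDiffAt_snd : ∀ z ∈ Icc (-1 : ℝ) 1, ContDiffAt ℝ ∞ B z
  sq_add : ∀ z ∈ Icc (-1 : ℝ) 1, A z ^ 2 + (1 - z ^ 2) * B z ^ 2 = 1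
  pos : ∀ z ∈ Icc (-1 : ℝ) 1, 0 < B z
  ode : ∀ z ∈ Ioo (-1 : ℝ) 1, ∃ e,
    (1 - z ^ 2) * deriv (deriv A) z - 3 * z * deriv A z = -e * A z ∧
    (1 - z ^ 2) * deriv (deriv B) z - 5 * z * deriv B z - 3 * B z = -e * B z

theorem ProfilePair.neg_fst {A B : ℝ → ℝ} (P : ProfilePair A B) :
    ProfilePair (fun z => -A z) B where
  contDiffAt_fst z hz := (P.contDiffAt_fst z hz).neg
  contDiffAt_snd := P.contDiffAt_snd
  sq_add z hz := by rw [neg_sq, P.sq_add z hz]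
  pos := P.pos
  ode z hz := by
    obtain ⟨e, h1, h2⟩ := P.ode z hz
    have h3 : deriv (fun z => -A z) = fun z => -deriv A z := funext fun x => deriv.fun_neg
    refine ⟨e, ?_, h2⟩
    rw [h3, deriv.fun_neg]
    linarith

/-- Extension of a smooth function on `(-1, 1)` with a parity across both end points. -/
theorem exists_extension_of_parity {f L : ℝ → ℝ} {τ : ℝ}
    (hf : ∀ z ∈ Ioo (-1 : ℝ) 1, ContDiffAt ℝ ∞ f z) (hL : ContDiffAt ℝ ∞ L (-1))
    (hfL : ∀ᶠ z in 𝓝 (-1 : ℝ), z ∈ Ioo (-1 : ℝ) 1 → f z = L z)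
    (hτ : ∀ z ∈ Ioo (-1 : ℝ) 1, f z = τ * f (-z)) :
    ∃ A : ℝ → ℝ, (∀ z ∈ Icc (-1 : ℝ) 1, ContDiffAt ℝ ∞ A z) ∧ A (-1) = L (-1) ∧
      A 1 = τ * L (-1) ∧ EqOn A f (Ioo (-1) 1) := by
  classical
  let A : ℝ → ℝ := fun z =>
    if z ∈ Ioo (-1 : ℝ) 1 then f z else if z < 0 then L z else τ * L (-z)
  have hA : EqOn A f (Ioo (-1) 1) := fun z hz => if_pos hz
  refine ⟨A, ?_, ?_, ?_, hA⟩
  · intro z hz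
    rcases eq_or_lt_of_le hz.1 with h1 | h1
    · subst h1
      refine hL.congr_of_eventuallyEq ?_
      filter_upwards [hfL, gt_mem_nhds (show (-1 : ℝ) < 0 by norm_num)] with z hz h0
      by_cases h : z ∈ Ioo (-1 : ℝ) 1
      · rw [hA h, hz h]
      · simp only [A, if_neg h, if_pos h0]
    rcases eq_or_lt_of_le hz.2 with h2 | h2
    · subst h2
      have hL' : ContDiffAt ℝ ∞ (fun z : ℝ => τ * L (-z)) 1 :=
        contDiffAt_const.mul (ContDiffAt.comp (1 : ℝ) hL contDiffAt_id.neg)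
      refine hL'.congr_of_eventuallyEq ?_
      have hneg : Tendsto (fun z : ℝ => -z) (𝓝 1) (𝓝 (-1)) := continuous_neg.tendsto 1
      filter_upwards [hneg.eventually hfL, lt_mem_nhds (show (0 : ℝ) < 1 by norm_num)] with z hz h0
      by_cases h : z ∈ Ioo (-1 : ℝ) 1
      · rw [hA h, hτ z h, hz ⟨by linarith [h.2], by linarith [h.1]⟩]
      · simp only [A, if_neg h, if_neg h0.not_gt]
    · exact (hf z ⟨h1, h2⟩).congr_of_eventuallyEq (hA.eventuallyEq_of_mem (isOpen_Ioo.mem_nhds ⟨h1, h2⟩))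
  · simp [A]
  · simp [A, show ¬ (1 : ℝ) < 0 by norm_num]

theorem deriv_deriv_eq_of_eqOn {f A g : ℝ → ℝ} {s : Set ℝ} (hs : IsOpen s) (hA : EqOn A f s)
    (hf : ∀ z ∈ s, HasDerivAt f (g z) z) {z g' : ℝ} (hz : z ∈ s) (hg : HasDerivAt g g' z) :
    deriv A z = g z ∧ deriv (deriv A) z = g' := by
  have h1 : EqOn (deriv A) g s := fun x hx => by
    rw [(hA.eventuallyEq_of_mem (hs.mem_nhds hx)).deriv_eq, (hf x hx).deriv]
  exact ⟨h1 hz, by rw [(h1.eventuallyEq_of_mem (hs.mem_nhds hz)).deriv_eq, hg.deriv]⟩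

/-! ### The equation of the orbits in the height variable z = cos ψ, x = -artanh z -/

namespace IsSolution

variable {h : ℝ → ℝ}

theorem hasDerivAt_comp_artanh (hs : IsSolution h) {z : ℝ} (hz : z ∈ Ioo (-1 : ℝ) 1) :
    HasDerivAt (fun z => h (-Real.artanh z))
      (-deriv h (-Real.artanh z) / (1 - z ^ 2)) z :=
  ((hs.hasDerivAt _).comp z (hasDerivAt_artanh hz).neg).congr_deriv (by rw [Pi.neg_apply]; ring)

theorem hasDerivAt_deriv_comp_artanh (hs : IsSolution h) {z : ℝ} (hz : z ∈ Ioo (-1 : ℝ) 1) :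
    HasDerivAt (fun z => deriv h (-Real.artanh z))
      ((z * deriv h (-Real.artanh z) + Real.sin (2 * h (-Real.artanh z))) / (1 - z ^ 2)) z := by
  refine ((hs.hasDerivAt_deriv _).comp z (hasDerivAt_artanh hz).neg).congr_deriv ?_
  rw [Pi.neg_apply, Real.tanh_neg, Real.tanh_artanh hz]
  ring

theorem hasDerivAt_cosh_artanh {z : ℝ} (hz : z ∈ Ioo (-1 : ℝ) 1) :
    HasDerivAt (fun z => Real.cosh (Real.artanh z))
      (z * Real.cosh (Real.artanh z) / (1 - z ^ 2)) z := by
  refine ((hasDerivAt_artanh hz).cosh).congr_deriv ?_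
  have h1 : Real.sinh (Real.artanh z) = z * Real.cosh (Real.artanh z) := by
    have := Real.tanh_artanh hz
    rw [Real.tanh_eq_sinh_div_cosh, div_eq_iff (Real.cosh_pos _).ne'] at this
    exact this
  rw [h1]
  ring

theorem hasDerivAt_profile_fst (hs : IsSolution h) {z : ℝ} (hz : z ∈ Ioo (-1 : ℝ) 1) :
    HasDerivAt (fun z => Real.sin (h (-Real.artanh z)))
      (-(Real.cos (h (-Real.artanh z)) * deriv h (-Real.artanh z)) / (1 - z ^ 2)) z :=
  (hs.hasDerivAt_comp_artanh hz).sin.congr_deriv (by ring)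

theorem hasDerivAt_profile_snd (hs : IsSolution h) {z : ℝ} (hz : z ∈ Ioo (-1 : ℝ) 1) :
    HasDerivAt (fun z => Real.cosh (Real.artanh z) * Real.cos (h (-Real.artanh z)))
      (Real.cosh (Real.artanh z) * (z * Real.cos (h (-Real.artanh z)) +
        Real.sin (h (-Real.artanh z)) * deriv h (-Real.artanh z)) / (1 - z ^ 2)) z :=
  ((hasDerivAt_cosh_artanh hz).mul (hs.hasDerivAt_comp_artanh hz).cos).congr_deriv (by ring)

theorem hasDerivAt_one_sub_sq (z : ℝ) : HasDerivAt (fun z : ℝ => 1 - z ^ 2) (-(2 * z)) z :=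
  ((hasDerivAt_pow 2 z).const_sub 1).congr_deriv (by norm_num)

theorem profile_ode (hs : IsSolution h) {A B : ℝ → ℝ}
    (hA : EqOn A (fun z => Real.sin (h (-Real.artanh z))) (Ioo (-1) 1))
    (hB : EqOn B (fun z => Real.cosh (Real.artanh z) * Real.cos (h (-Real.artanh z))) (Ioo (-1) 1))
    {z : ℝ} (hz : z ∈ Ioo (-1 : ℝ) 1) : ∃ e,
      (1 - z ^ 2) * deriv (deriv A) z - 3 * z * deriv A z = -e * A z ∧
      (1 - z ^ 2) * deriv (deriv B) z - 5 * z * deriv B z - 3 * B z = -e * B z := by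
  have hD := (one_sub_sq_pos hz).ne'
  have h0 := hs.hasDerivAt_comp_artanh hz
  have h1 := hs.hasDerivAt_deriv_comp_artanh hz
  have hw := hasDerivAt_cosh_artanh hz
  obtain ⟨hA1, hA2⟩ := deriv_deriv_eq_of_eqOn isOpen_Ioo hA (fun x hx => hs.hasDerivAt_profile_fst hx)
    hz (((h0.cos.mul h1).neg).div (hasDerivAt_one_sub_sq z) hD)
  obtain ⟨hB1, hB2⟩ := deriv_deriv_eq_of_eqOn isOpen_Ioo hB (fun x hx => hs.hasDerivAt_profile_snd hx)
    hz ((hw.mul (((hasDerivAt_id z).mul h0.cos).add (h0.sin.mul h1))).div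
      (hasDerivAt_one_sub_sq z) hD)
  -- The common factor e is the energy density h'² + 2 cos² h over sin² ψ = 1 - z².
  refine ⟨(deriv h (-Real.artanh z) ^ 2 + 2 * Real.cos (h (-Real.artanh z)) ^ 2) / (1 - z ^ 2), ?_, ?_⟩
  · rw [hA2, hA1, hA hz]
    simp only [Pi.mul_apply, Pi.neg_apply, Real.sin_two_mul]
    generalize h (-Real.artanh z) = a
    generalize deriv h (-Real.artanh z) = p
    field_simp
    ring
  · rw [hB2, hB1, hB hz]
    simp only [Pi.mul_apply, Pi.add_apply, Real.sin_two_mul, id]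
    have hsc := Real.sin_sq_add_cos_sq (h (-Real.artanh z))
    generalize h (-Real.artanh z) = a at *
    generalize deriv h (-Real.artanh z) = p
    generalize Real.cosh (Real.artanh z) = w
    field_simp
    have h2 : Real.sin a ^ 2 = 1 - Real.cos a ^ 2 := by linarith
    ring_nf
    simp only [h2]
    ring

end IsSolution

theorem sin_two_mul_arctan_sub_pi_div_two (M : ℝ) :
    Real.sin (2 * Real.arctan M - Real.pi / 2) = -((1 - M ^ 2) / (1 + M ^ 2)) := by
  rw [Real.sin_sub_pi_div_two, cos_two_mul_arctan]

theorem cos_two_mul_arctan_sub_pi_div_two (M : ℝ) :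
    Real.cos (2 * Real.arctan M - Real.pi / 2) = 2 * M / (1 + M ^ 2) := by
  rw [Real.cos_sub_pi_div_two, sin_two_mul_arctan]

/-- A = sin h and B = cos h / sin ψ. As z → -1 one has x → ∞ and e^{-2x} = S(z) = (1 + z)/(1 - z);
both functions are rational in S and m(S), hence smooth across z = -1. The end z = 1 follows by the
parity τ of h. -/
theorem PoleOrbit.exists_profilePair {κ τ : ℝ} {h : ℝ → ℝ} (P : PoleOrbit κ h)
    (hτ : ∀ x, h (-x) = τ * h x) (hττ : τ = 1 ∨ τ = -1) :
    ∃ A B, ProfilePair A B ∧ A (-1) = -1 ∧ A 1 = -τ ∧ B (-1) = κ ∧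
      EqOn A (fun z => Real.sin (h (-Real.artanh z))) (Ioo (-1) 1) := by
  obtain ⟨m, η, x₁, hη, hm, hm0, hmpos, hx₁, hh⟩ := P.exists_pole
  have hs := P.isSolution
  have hτ2 : τ ^ 2 = 1 := by rcases hττ with rfl | rfl <;> norm_num
  let S : ℝ → ℝ := fun z => (1 + z) / (1 - z)
  have hS0 : S (-1) = 0 := by simp [S]
  have hS : ContDiffAt ℝ ∞ S (-1) :=
    (contDiffAt_const.add contDiffAt_id).div (contDiffAt_const.sub contDiffAt_id) (by norm_num)
  have hmS : ContDiffAt ℝ ∞ (fun z => m (S z)) (-1) :=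
    ContDiffAt.comp (-1 : ℝ) (g := m) (hm _ (by rw [hS0]; simpa using hη)) hS
  have hden : 1 + S (-1) * m (S (-1)) ^ 2 ≠ 0 := by rw [hS0]; norm_num
  have hev : ∀ᶠ z in 𝓝 (-1 : ℝ), z ∈ Ioo (-1 : ℝ) 1 →
      h (-Real.artanh z) = 2 * Real.arctan (Real.exp (Real.artanh z) * m (S z)) - Real.pi / 2 := by
    have h1 : ∀ᶠ z in 𝓝 (-1 : ℝ), S z < Real.exp (-x₁) ^ 2 := by
      refine hS.continuousAt.eventually_lt_const ?_
      rw [hS0]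
      positivity
    filter_upwards [h1] with z hz hzI
    have h2 : Real.exp (Real.artanh z) ^ 2 < Real.exp (-x₁) ^ 2 := by
      rw [exp_artanh_sq hzI]
      exact hz
    have h3 := lt_of_pow_lt_pow_left₀ 2 (Real.exp_pos _).le h2
    have h4 := Real.exp_lt_exp.1 h3
    rw [hh (-Real.artanh z) (by linarith), neg_neg, exp_artanh_sq hzI]
  have hM : ∀ z ∈ Ioo (-1 : ℝ) 1, (Real.exp (Real.artanh z) * m (S z)) ^ 2 = S z * m (S z) ^ 2 := by
    intro z hz
    rw [mul_pow, exp_artanh_sq hz]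
  have hart : ∀ z ∈ Ioo (-1 : ℝ) 1, ContDiffAt ℝ ∞ (fun z => h (-Real.artanh z)) z := fun z hz =>
    ContDiffAt.comp z (g := h) hs.contDiff.contDiffAt (contDiffAt_artanh hz).neg
  obtain ⟨A, hA1, hA2, hA3, hA4⟩ := exists_extension_of_parity (τ := τ)
    (f := fun z => Real.sin (h (-Real.artanh z)))
    (L := fun z => -((1 - S z * m (S z) ^ 2) / (1 + S z * m (S z) ^ 2)))
    (fun z hz => Real.contDiff_sin.contDiffAt.comp z (hart z hz))
    (((contDiffAt_const.sub (hS.mul (hmS.pow 2))).div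
      (contDiffAt_const.add (hS.mul (hmS.pow 2))) hden).neg)
    (by
      filter_upwards [hev] with z hz hzI
      rw [hz hzI, sin_two_mul_arctan_sub_pi_div_two, hM z hzI])
    (fun z hz => by
      rw [artanh_neg_eq hz, hτ (-Real.artanh z)]
      rcases hττ with rfl | rfl
      · simp
      · simp)
  obtain ⟨B, hB1, hB2, hB3, hB4⟩ := exists_extension_of_parity (τ := 1)
    (f := fun z => Real.cosh (Real.artanh z) * Real.cos (h (-Real.artanh z)))
    (L := fun z => (1 + S z) * m (S z) / (1 + S z * m (S z) ^ 2))
    (fun z hz => (Real.contDiff_cosh.contDiffAt.comp z (contDiffAt_artanh hz)).mul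
      (Real.contDiff_cos.contDiffAt.comp z (hart z hz)))
    (((contDiffAt_const.add hS).mul hmS).div
      (contDiffAt_const.add (hS.mul (hmS.pow 2))) hden)
    (by
      filter_upwards [hev] with z hz hzI
      have h1 : Real.cosh (Real.artanh z) * Real.exp (Real.artanh z) = (S z + 1) / 2 := by
        have h2 : Real.exp (-Real.artanh z) * Real.exp (Real.artanh z) = 1 := by
          rw [← Real.exp_add, neg_add_cancel, Real.exp_zero]
        have h3 := exp_artanh_sq hzI
        rw [Real.cosh_eq]
        simp only [S]
        linear_combination (1 / 2 : ℝ) * h3 + (1 / 2 : ℝ) * h2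
      rw [hz hzI, cos_two_mul_arctan_sub_pi_div_two, hM z hzI, mul_div_assoc',
        show Real.cosh (Real.artanh z) * (2 * (Real.exp (Real.artanh z) * m (S z))) =
          2 * (Real.cosh (Real.artanh z) * Real.exp (Real.artanh z)) * m (S z) by ring, h1]
      congr 1
      ring)
    (fun z hz => by
      rw [artanh_neg_eq hz, hτ (-Real.artanh z), Real.cosh_neg]
      rcases hττ with rfl | rfl
      · simp
      · simp)
  have hA2' : A (-1) = -1 := by rw [hA2, hS0]; norm_num
  have hA3' : A 1 = -τ := by rw [hA3, hS0]; norm_num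
  have hB2' : B (-1) = κ := by rw [hB2, hS0, hm0]; norm_num
  have hB3' : B 1 = κ := by rw [hB3, hS0, hm0]; norm_num
  have hκ : 0 < κ := by rw [← hm0]; exact hmpos 0 (by simpa using hη)
  have hcases : ∀ z ∈ Icc (-1 : ℝ) 1, z = -1 ∨ z = 1 ∨ z ∈ Ioo (-1 : ℝ) 1 := by
    intro z hz
    rcases eq_or_lt_of_le hz.1 with h1 | h1
    · exact Or.inl h1.symm
    rcases eq_or_lt_of_le hz.2 with h2 | h2
    · exact Or.inr (Or.inl h2)
    · exact Or.inr (Or.inr ⟨h1, h2⟩)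
  refine ⟨A, B, ⟨hA1, hB1, ?_, ?_, fun z hz => hs.profile_ode hA4 hB4 hz⟩, hA2', hA3', hB2', hA4⟩
  · intro z hz
    rcases hcases z hz with rfl | rfl | hz
    · rw [hA2']; norm_num
    · rw [hA3', neg_sq, hτ2]; norm_num
    · rw [hA4 hz, hB4 hz]
      beta_reduce
      rw [mul_pow, cosh_artanh_sq hz]
      have := (one_sub_sq_pos hz).ne'
      have h2 := Real.sin_sq_add_cos_sq (h (-Real.artanh z))
      field_simp
      exact h2
  · intro z hz
    rcases hcases z hz with rfl | rfl | hz
    · rwa [hB2']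
    · rwa [hB3']
    · rw [hB4 hz]
      exact mul_pos (Real.cosh_pos _) (Real.cos_pos_of_mem_Ioo (P.mem_strip _))

/-! ## The symmetric map of a profile pair -/

/-- The map `y ↦ (A y₀, B y₀ y₁, B y₀ y₂, B y₀ y₃)`. -/
def profileVec (A B : ℝ → ℝ) (y : E4) : E4 :=
  WithLp.toLp 2 fun j => if j = 0 then A (y 0) else B (y 0) * y j

theorem profileVec_zero (A B : ℝ → ℝ) (y : E4) : profileVec A B y 0 = A (y 0) := rfl

theorem profileVec_of_ne (A B : ℝ → ℝ) (y : E4) {j : Fin 4} (hj : j ≠ 0) :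
    profileVec A B y j = B (y 0) * y j := if_neg hj

theorem sum_sq_eq_one {y : E4} (hy : y ∈ Metric.sphere (0 : E4) 1) :
    y 0 ^ 2 + y 1 ^ 2 + y 2 ^ 2 + y 3 ^ 2 = 1 := by
  rw [mem_sphere_zero_iff_norm] at hy
  have := EuclideanSpace.norm_sq_eq y
  rw [hy, Fin.sum_univ_four] at this
  simp only [Real.norm_eq_abs, sq_abs] at this
  linarith

theorem height_mem {y : E4} (hy : y ∈ Metric.sphere (0 : E4) 1) : y 0 ∈ Icc (-1 : ℝ) 1 := by
  have := sum_sq_eq_one hy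
  exact abs_le.1 (abs_le_of_sq_le_sq (by nlinarith [sq_nonneg (y 1), sq_nonneg (y 2), sq_nonneg (y 3)])
    zero_le_one)

namespace ProfilePair

variable {A B : ℝ → ℝ}

theorem profileVec_mem (P : ProfilePair A B) (p : S3) :
    profileVec A B p ∈ Metric.sphere (0 : E4) 1 := by
  have h1 := sum_sq_eq_one p.2
  have h2 := P.sq_add _ (height_mem p.2)
  rw [mem_sphere_zero_iff_norm, EuclideanSpace.norm_eq, Real.sqrt_eq_one, Fin.sum_univ_four]
  simp only [Real.norm_eq_abs, sq_abs, profileVec_zero,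
    profileVec_of_ne A B _ (show (1 : Fin 4) ≠ 0 by decide),
    profileVec_of_ne A B _ (show (2 : Fin 4) ≠ 0 by decide),
    profileVec_of_ne A B _ (show (3 : Fin 4) ≠ 0 by decide)]
  linear_combination h2 + B ((p : E4) 0) ^ 2 * h1

/-- The `SO(3)`-symmetric map of the three-sphere to itself with the given profile functions. -/
def symmetricMap (P : ProfilePair A B) : S3 → S3 :=
  Set.codRestrict (fun p : S3 => profileVec A B p) _ P.profileVec_mem

theorem coe_symmetricMap (P : ProfilePair A B) (p : S3) :
    (P.symmetricMap p : E4) = profileVec A B p := rfl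

theorem contDiffAt_profileVec (P : ProfilePair A B) {y : E4} (hy : y 0 ∈ Icc (-1 : ℝ) 1) :
    ContDiffAt ℝ ∞ (profileVec A B) y := by
  rw [contDiffAt_piLp]
  intro j
  have h0 : ContDiffAt ℝ ∞ (fun y : E4 => y 0) y := contDiffAt_piLp_apply 2
  by_cases hj : j = 0
  · subst hj
    exact ContDiffAt.comp y (g := A) (P.contDiffAt_fst _ hy) h0
  · have : (fun y : E4 => profileVec A B y j) = fun y => B (y 0) * y j :=
      funext fun y => profileVec_of_ne A B y hj
    rw [this]
    exact (ContDiffAt.comp y (g := B) (P.contDiffAt_snd _ hy) h0).mul (contDiffAt_piLp_apply 2)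

theorem isSmoothMap (P : ProfilePair A B) : IsSmoothMap P.symmetricMap := by
  refine ContMDiff.codRestrict_sphere (n := 3) (fun p => ?_) P.profileVec_mem
  exact (P.contDiffAt_profileVec (height_mem p.2)).contMDiffAt.comp p
    (contMDiff_coe_sphere (n := 3)).contMDiffAt

theorem normalize_mem {x : E4} (hx : x ≠ 0) : ‖x‖⁻¹ • x ∈ Metric.sphere (0 : E4) 1 := by
  rw [mem_sphere_zero_iff_norm, norm_smul, norm_inv, norm_norm,
    inv_mul_cancel₀ (norm_ne_zero_iff.mpr hx)]

theorem radialExtension_symmetricMap (P : ProfilePair A B) {x : E4} (hx : x ≠ 0) :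
    radialExtension P.symmetricMap x = profileVec A B (‖x‖⁻¹ • x) := by
  rw [radialExtension, dif_neg hx, coe_symmetricMap]

/-! ### The profile in hyperspherical coordinates -/

theorem log_tan_half {ψ : ℝ} (hψ : ψ ∈ Ioo 0 Real.pi) :
    Real.log (Real.tan (ψ / 2)) = -Real.artanh (Real.cos ψ) := by
  have hs : 0 < Real.sin (ψ / 2) := Real.sin_pos_of_pos_of_lt_pi (by linarith [hψ.1])
    (by linarith [hψ.1, hψ.2])
  have hc : 0 < Real.cos (ψ / 2) := Real.cos_pos_of_mem_Ioo
    ⟨by linarith [hψ.1, Real.pi_pos], by linarith [hψ.2]⟩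
  have h1 : Real.cos ψ = 2 * Real.cos (ψ / 2) ^ 2 - 1 := by
    rw [← Real.cos_two_mul, mul_div_cancel₀ ψ two_ne_zero]
  have h2 := Real.sin_sq_add_cos_sq (ψ / 2)
  have h3 : (1 + Real.cos ψ) / (1 - Real.cos ψ) = (Real.cos (ψ / 2) / Real.sin (ψ / 2)) ^ 2 := by
    have h4 : 1 - Real.cos ψ = 2 * Real.sin (ψ / 2) ^ 2 := by rw [h1]; linarith
    rw [h4, h1]
    field_simp
    ring
  rw [Real.artanh, h3, Real.sqrt_sq (by positivity), ← Real.log_inv, inv_div, Real.tan_eq_sin_div_cos]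

theorem cos_mem_Ioo {ψ : ℝ} (hψ : ψ ∈ Ioo 0 Real.pi) : Real.cos ψ ∈ Ioo (-1 : ℝ) 1 := by
  have hs := Real.sin_pos_of_mem_Ioo hψ
  have h2 := Real.sin_sq_add_cos_sq ψ
  exact abs_lt.1 (abs_lt_of_sq_lt_sq (by nlinarith) zero_le_one)

/-- With f = arccos A the sphere relation gives sin f = ±B sin ψ, and B > 0 selects the right sign
on [0, π]. -/
theorem hasProfile (P : ProfilePair A B) :
    HasProfile P.symmetricMap fun ψ => Real.arccos (A (Real.cos ψ)) := by
  refine ⟨?_, ?_⟩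
  · refine Real.continuous_arccos.comp_continuousOn fun ψ _ => ?_
    have h1 : ContinuousAt A (Real.cos ψ) :=
      (P.contDiffAt_fst _ (Real.cos_mem_Icc ψ)).continuousAt
    exact (ContinuousAt.comp (g := A) h1 Real.continuous_cos.continuousAt).continuousWithinAt
  · intro ψ hψ ϑ φ
    have h1 := P.sq_add _ (Real.cos_mem_Icc ψ)
    have h2 := P.pos _ (Real.cos_mem_Icc ψ)
    have h3 := Real.sin_sq_add_cos_sq ψ
    have h4 : 0 ≤ Real.sin ψ := Real.sin_nonneg_of_mem_Icc hψ
    have h5 : Real.sin (Real.arccos (A (Real.cos ψ))) = B (Real.cos ψ) * Real.sin ψ := by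
      rw [Real.sin_arccos, show 1 - A (Real.cos ψ) ^ 2 = (B (Real.cos ψ) * Real.sin ψ) ^ 2 by
        rw [mul_pow, eq_sub_of_add_eq h3]; linarith]
      exact Real.sqrt_sq (mul_nonneg h2.le h4)
    have h6 : Real.cos (Real.arccos (A (Real.cos ψ))) = A (Real.cos ψ) := by
      have h9 : A (Real.cos ψ) ^ 2 ≤ 1 := by
        have : 0 ≤ (1 - Real.cos ψ ^ 2) * B (Real.cos ψ) ^ 2 :=
          mul_nonneg (by nlinarith) (sq_nonneg _)
        linarith
      obtain ⟨h7, h8⟩ := abs_le.1 ((sq_le_one_iff_abs_le_one _).1 h9)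
      exact Real.cos_arccos h7 h8
    refine Subtype.ext (PiLp.ext fun j => ?_)
    rw [coe_symmetricMap]
    fin_cases j
    · simp [profileVec, hyperspherical, h6]
    · simp [profileVec, hyperspherical, h5]; ring
    · simp [profileVec, hyperspherical, h5]; ring
    · simp [profileVec, hyperspherical, h5]; ring

theorem isInducedBy (P : ProfilePair A B) {H : ℝ → ℝ}
    (hH : ∀ x, H x ∈ Ioo (-(Real.pi / 2)) (Real.pi / 2))
    (hA : ∀ z ∈ Ioo (-1 : ℝ) 1, A z = -Real.sin (H (-Real.artanh z))) :
    IsInducedBy P.symmetricMap H := by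
  refine ⟨_, P.hasProfile, fun ψ hψ => ?_⟩
  rw [hA _ (cos_mem_Ioo hψ), ← log_tan_half hψ, ← Real.cos_add_pi_div_two]
  have := hH (Real.log (Real.tan (ψ / 2)))
  exact Real.arccos_cos (by linarith [this.1]) (by linarith [this.2])

/-! ### Degree -/

/-- Both poles go to the same pole, so its antipode is omitted: since B > 0, only a pole can be sent
to a pole. -/
theorem hasDegree_zero (P : ProfilePair A B) (h : A (-1) = A 1) : HasDegree P.symmetricMap 0 := by
  have h1 : A 1 ^ 2 = 1 := by
    have := P.sq_add 1 (by norm_num)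
    linarith
  refine ⟨P.isSmoothMap, ⟨EuclideanSpace.single 0 (-A 1), ?_⟩, ∅, fun p => ?_, by simp, by simp⟩
  · rw [mem_sphere_zero_iff_norm, PiLp.norm_single, norm_neg, Real.norm_eq_abs]
    rcases eq_or_eq_neg_of_sq_eq_sq (A 1) 1 (by rw [h1, one_pow]) with h | h <;> simp [h]
  · refine iff_of_false (Finset.notMem_empty p) fun hp => ?_
    have hp' := congrArg Subtype.val hp
    rw [coe_symmetricMap] at hp'
    have hB := (P.pos _ (height_mem p.2)).ne'
    have h0 : A ((p : E4) 0) = -A 1 := by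
      have := congrArg (fun y : E4 => y 0) hp'
      simpa [profileVec] using this
    have hj : ∀ j : Fin 4, j ≠ 0 → (p : E4) j = 0 := by
      intro j hj
      have := congrArg (fun y : E4 => y j) hp'
      beta_reduce at this
      rw [profileVec_of_ne A B _ hj] at this
      simpa [hj, hB] using this
    have h2 := sum_sq_eq_one p.2
    rw [hj 1 (by decide), hj 2 (by decide), hj 3 (by decide)] at h2
    have h3 : (p : E4) 0 = 1 ∨ (p : E4) 0 = -1 := eq_or_eq_neg_of_sq_eq_sq _ _ (by linarith)
    have h4 : A ((p : E4) 0) = A 1 := by 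
      rcases h3 with h3 | h3
      · rw [h3]
      · rw [h3, h]
    rw [h4] at h0
    nlinarith

theorem northPole_mem : EuclideanSpace.single (0 : Fin 4) (1 : ℝ) ∈ Metric.sphere (0 : E4) 1 := by
  simp

/-- The north pole maximizes this function, so the derivative vanishes without any computation. -/
theorem hasFDerivAt_normalize_zero :
    HasFDerivAt (fun x : E4 => (‖x‖⁻¹ • x) 0) (0 : E4 →L[ℝ] ℝ) (EuclideanSpace.single 0 1) := by
  have hne : EuclideanSpace.single (0 : Fin 4) (1 : ℝ) ≠ 0 :=
    ne_zero_of_mem_unit_sphere ⟨_, northPole_mem⟩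
  have hd : DifferentiableAt ℝ (fun x : E4 => (‖x‖⁻¹ • x) 0) (EuclideanSpace.single 0 1) := by
    have h1 : DifferentiableAt ℝ (fun x : E4 => ‖x‖⁻¹) (EuclideanSpace.single 0 1) :=
      (differentiableAt_id.norm ℝ hne).inv (norm_ne_zero_iff.2 hne)
    exact h1.mul (EuclideanSpace.proj (𝕜 := ℝ) (0 : Fin 4)).differentiableAt
  have hmax : IsLocalMax (fun x : E4 => (‖x‖⁻¹ • x) 0) (EuclideanSpace.single 0 1) := by
    filter_upwards [isOpen_ne.mem_nhds hne] with x hx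
    refine (height_mem (normalize_mem hx)).2.trans (le_of_eq ?_)
    simp
  have := hd.hasFDerivAt
  rwa [hmax.fderiv_eq_zero] at this

/-- Product rule for |x| · (x/|x|)₀ = x₀, where the second factor is 1 with zero derivative. -/
theorem hasFDerivAt_norm_northPole :
    HasFDerivAt (fun x : E4 => ‖x‖) (EuclideanSpace.proj 0 : E4 →L[ℝ] ℝ)
      (EuclideanSpace.single 0 1) := by
  have hne : EuclideanSpace.single (0 : Fin 4) (1 : ℝ) ≠ 0 :=
    ne_zero_of_mem_unit_sphere ⟨_, northPole_mem⟩
  have hd : DifferentiableAt ℝ (fun x : E4 => ‖x‖) (EuclideanSpace.single 0 1) :=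
    differentiableAt_id.norm ℝ hne
  have h1 := hd.hasFDerivAt.mul hasFDerivAt_normalize_zero
  have h2 : HasFDerivAt (fun x : E4 => ‖x‖ * (‖x‖⁻¹ • x) 0)
      (EuclideanSpace.proj 0 : E4 →L[ℝ] ℝ) (EuclideanSpace.single 0 1) := by
    refine (EuclideanSpace.proj (𝕜 := ℝ) (0 : Fin 4)).hasFDerivAt.congr_of_eventuallyEq ?_
    filter_upwards [isOpen_ne.mem_nhds hne] with x hx
    have := norm_ne_zero_iff.2 hx
    simp [mul_inv_cancel_left₀ this]
  have h3 := h1.unique h2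
  have h4 : fderiv ℝ (fun x : E4 => ‖x‖) (EuclideanSpace.single 0 1) = EuclideanSpace.proj 0 := by
    rw [← h3]
    simp
  rw [← h4]
  exact hd.hasFDerivAt

theorem det_diagonal_euclidean (c : Fin 4 → ℝ) {D : E4 →L[ℝ] E4} (hD : ∀ x j, D x j = c j * x j) :
    D.det = ∏ j, c j := by
  rw [ContinuousLinearMap.det, ← LinearMap.det_toMatrix (EuclideanSpace.basisFun (Fin 4) ℝ).toBasis,
    ← Matrix.det_diagonal]
  congr 1
  ext i j
  rw [LinearMap.toMatrix_apply, Matrix.diagonal_apply]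
  simp only [OrthonormalBasis.coe_toBasis, OrthonormalBasis.coe_toBasis_repr_apply,
    EuclideanSpace.basisFun_repr, EuclideanSpace.basisFun_apply, ContinuousLinearMap.coe_coe, hD]
  by_cases h : i = j
  · subst h; simp
  · simp [h]

/-- All functions of the height are stationary at the pole, so the derivative of the homogeneous
extension is diagonal with entries 1, B(1), B(1), B(1). -/
theorem jacobianDet_northPole (P : ProfilePair A B) (h1 : A 1 = 1) :
    jacobianDet P.symmetricMap ⟨EuclideanSpace.single 0 1, northPole_mem⟩ = B 1 ^ 3 := by
  have hne : EuclideanSpace.single (0 : Fin 4) (1 : ℝ) ≠ 0 :=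
    ne_zero_of_mem_unit_sphere ⟨_, northPole_mem⟩
  let c : Fin 4 → ℝ := fun j => if j = 0 then 1 else B 1
  let D : E4 →L[ℝ] E4 := (PiLp.continuousLinearEquiv 2 ℝ fun _ : Fin 4 => ℝ).symm.toContinuousLinearMap ∘L
    ContinuousLinearMap.pi fun j => c j • (EuclideanSpace.proj j : E4 →L[ℝ] ℝ)
  have hz1 : (‖EuclideanSpace.single (0 : Fin 4) (1 : ℝ)‖⁻¹ •
      EuclideanSpace.single (0 : Fin 4) (1 : ℝ)) 0 = 1 := by simp
  have hcomp : ∀ g : ℝ → ℝ, ContDiffAt ℝ ∞ g 1 →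
      HasFDerivAt (fun x : E4 => g ((‖x‖⁻¹ • x) 0)) (0 : E4 →L[ℝ] ℝ) (EuclideanSpace.single 0 1) := by
    intro g hg
    have hg' : HasDerivAt g (deriv g 1) ((‖EuclideanSpace.single (0 : Fin 4) (1 : ℝ)‖⁻¹ •
      EuclideanSpace.single (0 : Fin 4) (1 : ℝ)) 0) := by
      rw [hz1]
      exact (hg.differentiableAt (by simp)).hasDerivAt
    have := HasDerivAt.comp_hasFDerivAt (f := fun x : E4 => (‖x‖⁻¹ • x) 0)
      (EuclideanSpace.single 0 1) hg' hasFDerivAt_normalize_zero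
    rwa [smul_zero] at this
  have hD : HasFDerivAt (fun x : E4 => ‖x‖ • radialExtension P.symmetricMap x) D
      (EuclideanSpace.single 0 1) := by
    rw [← hasFDerivWithinAt_univ, hasFDerivWithinAt_piLp]
    intro j
    rw [hasFDerivWithinAt_univ]
    by_cases hj : j = 0
    · subst hj
      have h2 := hasFDerivAt_norm_northPole.mul (hcomp A (P.contDiffAt_fst 1 (by norm_num)))
      refine (h2.congr_of_eventuallyEq ?_).congr_fderiv ?_
      · filter_upwards [isOpen_ne.mem_nhds hne] with x hx
        rw [P.radialExtension_symmetricMap hx]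
        rfl
      · ext x
        simp [D, c, h1]
    · have h2 := (hcomp B (P.contDiffAt_snd 1 (by norm_num))).mul
        (EuclideanSpace.proj (𝕜 := ℝ) j).hasFDerivAt
      refine (h2.congr_of_eventuallyEq ?_).congr_fderiv ?_
      · filter_upwards [isOpen_ne.mem_nhds hne] with x hx
        have := norm_ne_zero_iff.2 hx
        rw [P.radialExtension_symmetricMap hx, PiLp.smul_apply, profileVec_of_ne A B _ hj,
          PiLp.smul_apply]
        simp only [smul_eq_mul, Pi.mul_apply, PiLp.smul_apply]
        field_simp
        rfl
      · ext x
        simp [D, c, hj]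
  rw [jacobianDet]
  dsimp only
  rw [hD.fderiv, det_diagonal_euclidean c (fun x j => by simp [D]), Fin.prod_univ_four]
  simp [c]
  ring

/-- As B > 0, a preimage of the north pole is a pole, and the south pole is fixed; so there is one
preimage, with positive Jacobian. -/
theorem hasDegree_one (P : ProfilePair A B) (h1 : A 1 = 1) (h2 : A (-1) = -1) :
    HasDegree P.symmetricMap 1 := by
  have hpos : 0 < jacobianDet P.symmetricMap ⟨EuclideanSpace.single 0 1, northPole_mem⟩ := by
    rw [P.jacobianDet_northPole h1]
    exact pow_pos (P.pos 1 (by norm_num)) 3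
  refine ⟨P.isSmoothMap, ⟨EuclideanSpace.single 0 1, northPole_mem⟩,
    {⟨EuclideanSpace.single 0 1, northPole_mem⟩}, fun p => ?_, ?_, ?_⟩
  · rw [Finset.mem_singleton]
    constructor
    · rintro rfl
      refine Subtype.ext (PiLp.ext fun j => ?_)
      rw [coe_symmetricMap]
      by_cases hj : j = 0
      · subst hj; simp [profileVec, h1]
      · simp [profileVec, hj]
    · intro hp
      have hp' := congrArg Subtype.val hp
      rw [coe_symmetricMap] at hp'
      have hB := (P.pos _ (height_mem p.2)).ne'
      have h0 : A ((p : E4) 0) = 1 := by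
        have := congrArg (fun y : E4 => y 0) hp'
        simpa [profileVec] using this
      have hj : ∀ j : Fin 4, j ≠ 0 → (p : E4) j = 0 := by
        intro j hj
        have := congrArg (fun y : E4 => y j) hp'
        beta_reduce at this
        rw [profileVec_of_ne A B _ hj] at this
        simpa [hj, hB] using this
      have h3 := sum_sq_eq_one p.2
      rw [hj 1 (by decide), hj 2 (by decide), hj 3 (by decide)] at h3
      have h4 : (p : E4) 0 = 1 ∨ (p : E4) 0 = -1 := eq_or_eq_neg_of_sq_eq_sq _ _ (by linarith)
      refine Subtype.ext (PiLp.ext fun j => ?_)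
      by_cases hj0 : j = 0
      · subst hj0
        rcases h4 with h4 | h4
        · simp [h4]
        · rw [h4, h2] at h0
          norm_num at h0
      · simp [hj j hj0, hj0]
  · intro p hp
    rw [Finset.mem_singleton.1 hp]
    exact hpos.ne'
  · rw [Finset.sum_singleton, sign_pos hpos]
    rfl

/-- The symmetric map determines the second profile function. -/
theorem snd_eq_of_symmetricMap_eq {A' B' : ℝ → ℝ} (P : ProfilePair A B) (P' : ProfilePair A' B')
    (h : P.symmetricMap = P'.symmetricMap) : B (-1) = B' (-1) := by
  have key : ∀ ψ ∈ Ioo 0 Real.pi, B (Real.cos ψ) = B' (Real.cos ψ) := by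
    intro ψ hψ
    have h1 := congrArg (fun y : S3 => (y : E4) 1) (congrFun h (hyperspherical ψ 0 0))
    beta_reduce at h1
    rw [coe_symmetricMap, coe_symmetricMap, profileVec_of_ne _ _ _ (by decide),
      profileVec_of_ne _ _ _ (by decide)] at h1
    have h2 : Real.sin ψ ≠ 0 := (Real.sin_pos_of_mem_Ioo hψ).ne'
    simpa [hyperspherical, h2] using h1
  -- The coordinates determine B only where sin ψ ≠ 0, so its value at the south pole is recovered
  -- as a limit.
  have hc : ∀ {A B : ℝ → ℝ}, ProfilePair A B →
      Tendsto (fun ψ => B (Real.cos ψ)) (𝓝[<] Real.pi) (𝓝 (B (-1))) := by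
    intro A B P
    have h1 : ContinuousAt B (Real.cos Real.pi) :=
      (P.contDiffAt_snd _ (Real.cos_mem_Icc _)).continuousAt
    have h2 := (ContinuousAt.comp (g := B) h1 Real.continuous_cos.continuousAt).tendsto
    simp only [Function.comp_def, Real.cos_pi] at h2
    exact h2.mono_left nhdsWithin_le_nhds
  refine tendsto_nhds_unique (hc P) ((hc P').congr' ?_)
  filter_upwards [Ioo_mem_nhdsLT Real.pi_pos] with ψ hψ using (key ψ hψ).symm

end ProfilePair

/-! ## Integration over the sphere by parts -/

/-- Polar coordinates. It trades an integral over the sphere for one over the whole space, where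
integration by parts has no boundary terms. -/
theorem integral_radial_mul (ρ : ℝ → ℝ) (g : E4 → ℝ) :
    ∫ x : E4, ρ ‖x‖ * g (‖x‖⁻¹ • x) =
      (∫ p : S3, g p ∂((volume : Measure E4).toSphere)) *
        ∫ r : Ioi (0 : ℝ), ρ r ∂Measure.volumeIoiPow (Module.finrank ℝ E4 - 1) := by
  calc ∫ x : E4, ρ ‖x‖ * g (‖x‖⁻¹ • x)
      = ∫ x : ({(0 : E4)}ᶜ : Set E4), ρ ‖x.1‖ * g (‖x.1‖⁻¹ • x.1)
          ∂((volume : Measure E4).comap (↑)) := by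
        rw [integral_subtype_comap (measurableSet_singleton _).compl
          fun x : E4 => ρ ‖x‖ * g (‖x‖⁻¹ • x), restrict_compl_singleton]
    _ = ∫ q : S3 × Ioi (0 : ℝ), g q.1 * ρ q.2 ∂((volume : Measure E4).toSphere.prod
          (Measure.volumeIoiPow (Module.finrank ℝ E4 - 1))) := by
        rw [← (volume : Measure E4).measurePreserving_homeomorphUnitSphereProd.integral_comp
          (Homeomorph.measurableEmbedding _)]
        refine integral_congr_ae (Eventually.of_forall fun x => ?_)
        simp [mul_comm]
    _ = _ := integral_prod_mul (fun p : S3 => g p) fun r : Ioi (0 : ℝ) => ρ r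

theorem integral_fderiv_eq_zero {X : E4 → ℝ} (hX : ContDiff ℝ 1 X) (hc : HasCompactSupport X)
    (v : E4) : ∫ x, fderiv ℝ X x v = 0 := by
  have h1 : Continuous fun x => fderiv ℝ X x v :=
    (hX.continuous_fderiv one_ne_zero).clm_apply continuous_const
  have h2 : HasCompactSupport fun x => fderiv ℝ X x v := hc.fderiv_apply ℝ v
  have h3 := integral_mul_fderiv_eq_neg_fderiv_mul_of_integrable (μ := (volume : Measure E4))
    (f := fun _ : E4 => (1 : ℝ)) (g := X) (v := v) (by simp)
    (by simpa using h1.integrable_of_hasCompactSupport h2)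
    (by simpa using hX.continuous.integrable_of_hasCompactSupport hc)
    (fun x _ => differentiableAt_const _) (fun x _ => (hX.differentiable one_ne_zero) x)
  simpa using h3

/-- A smooth cut-off function of the squared radius. -/
def shellBump : ContDiffBump (2 : ℝ) := ⟨1 / 2, 1, by norm_num, by norm_num⟩

theorem shellBump_zero_of_le {t : ℝ} (ht : t ≤ 1) : shellBump t = 0 := by
  refine shellBump.zero_of_le_dist ?_
  rw [Real.dist_eq]
  change (1 : ℝ) ≤ _
  rw [abs_of_nonpos (by linarith)]
  linarith

theorem shellBump_zero_of_three_le {t : ℝ} (ht : 3 ≤ t) : shellBump t = 0 := by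
  refine shellBump.zero_of_le_dist ?_
  rw [Real.dist_eq]
  change (1 : ℝ) ≤ _
  rw [abs_of_nonneg (by linarith)]
  linarith

theorem contDiff_shellBump_normSq : ContDiff ℝ ∞ fun x : E4 => shellBump (‖x‖ ^ 2) :=
  shellBump.contDiff.comp (contDiff_norm_sq ℝ)

theorem hasCompactSupport_shellBump_normSq :
    HasCompactSupport fun x : E4 => shellBump (‖x‖ ^ 2) := by
  refine HasCompactSupport.intro (isCompact_closedBall (0 : E4) 2) fun x hx => ?_
  rw [mem_closedBall_zero_iff, not_le] at hx
  exact shellBump_zero_of_three_le (by nlinarith)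

theorem shellBump_normSq_eventually_zero :
    (fun x : E4 => shellBump (‖x‖ ^ 2)) =ᶠ[𝓝 0] fun _ => 0 := by
  filter_upwards [Metric.ball_mem_nhds (0 : E4) one_pos] with x hx
  rw [mem_ball_zero_iff] at hx
  exact shellBump_zero_of_le (pow_le_one₀ (norm_nonneg x) hx.le)

theorem contDiff_shellBump_mul {Y : E4 → ℝ} (hY : ∀ x ≠ 0, ContDiffAt ℝ 1 Y x) :
    ContDiff ℝ 1 fun x => shellBump (‖x‖ ^ 2) * Y x := by
  refine contDiff_iff_contDiffAt.2 fun x => ?_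
  by_cases hx : x = 0
  · subst hx
    refine (contDiffAt_const (c := (0 : ℝ))).congr_of_eventuallyEq ?_
    filter_upwards [shellBump_normSq_eventually_zero] with y hy
    rw [hy, zero_mul]
  · exact (contDiff_shellBump_normSq.of_le (by simp)).contDiffAt.mul (hY x hx)

/-- Taking the spherical factor constant, a vanishing radial factor would make the integral of a
nonnegative, nonzero continuous function over the space vanish. -/
theorem integral_shellBump_radial_ne_zero :
    ∫ r : Ioi (0 : ℝ), shellBump ((r : ℝ) ^ 2) * ((r : ℝ) ^ 2)⁻¹
      ∂Measure.volumeIoiPow (Module.finrank ℝ E4 - 1) ≠ 0 := by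
  intro h
  have h1 := integral_radial_mul (fun r => shellBump (r ^ 2) * (r ^ 2)⁻¹) fun _ => 1
  rw [h, mul_zero] at h1
  have hY : ∀ x : E4, x ≠ 0 → ContDiffAt ℝ 1 (fun x : E4 => (‖x‖ ^ 2)⁻¹) x := fun x hx =>
    (contDiff_norm_sq ℝ).contDiffAt.inv (by simpa using hx)
  have h2 : 0 < ∫ x : E4, shellBump (‖x‖ ^ 2) * (‖x‖ ^ 2)⁻¹ := by
    obtain ⟨x, hx⟩ := exists_norm_eq E4 (Real.sqrt_nonneg 2)
    refine (contDiff_shellBump_mul hY).continuous.integral_pos_of_hasCompactSupport_nonneg_nonzero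
      hasCompactSupport_shellBump_normSq.mul_right
      (fun x => mul_nonneg shellBump.nonneg (by positivity)) (x := x) ?_
    rw [hx, Real.sq_sqrt zero_le_two]
    have : shellBump (2 : ℝ) = 1 :=
      shellBump.one_of_mem_closedBall (Metric.mem_closedBall_self shellBump.rIn_pos.le)
    rw [this]
    norm_num
  simp only [mul_one] at h1
  exact h2.ne' h1

/-- The divergence theorem on the sphere for the radial extension of a tangential field. -/
theorem integral_sphere_eq_zero {Y : Fin 4 → E4 → ℝ} {g : E4 → ℝ}
    (hY : ∀ i, ∀ x ≠ 0, ContDiffAt ℝ 1 (Y i) x) (hrad : ∀ x ≠ 0, ∑ i, x i * Y i x = 0)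
    (hdiv : ∀ x ≠ 0, ∑ i, fderiv ℝ (Y i) x (EuclideanSpace.single i 1) =
      (‖x‖ ^ 2)⁻¹ * g (‖x‖⁻¹ • x)) :
    ∫ p : S3, g p ∂((volume : Measure E4).toSphere) = 0 := by
  have hX := fun i => contDiff_shellBump_mul (hY i)
  have hXc : ∀ i, HasCompactSupport fun x => shellBump (‖x‖ ^ 2) * Y i x :=
    fun i => hasCompactSupport_shellBump_normSq.mul_right
  have key : ∀ x : E4, ∑ i, fderiv ℝ (fun x => shellBump (‖x‖ ^ 2) * Y i x) x
      (EuclideanSpace.single i 1) = shellBump (‖x‖ ^ 2) * (‖x‖ ^ 2)⁻¹ * g (‖x‖⁻¹ • x) := by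
    intro x
    by_cases hx : x = 0
    · subst hx
      have : ∀ i, fderiv ℝ (fun x => shellBump (‖x‖ ^ 2) * Y i x) 0 = 0 := by
        intro i
        have h1 : (fun x : E4 => shellBump (‖x‖ ^ 2) * Y i x) =ᶠ[𝓝 0] fun _ => 0 := by
          filter_upwards [shellBump_normSq_eventually_zero] with y hy
          rw [hy, zero_mul]
        rw [h1.fderiv_eq, fderiv_fun_const, Pi.zero_apply]
      simp [this]
    -- The derivative of the cut-off is radial, so its total contribution is a multiple of the
    -- radial component of Y, which is zero.
    · have h1 : ∀ i, fderiv ℝ (fun x => shellBump (‖x‖ ^ 2) * Y i x) x (EuclideanSpace.single i 1) =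
          shellBump (‖x‖ ^ 2) * fderiv ℝ (Y i) x (EuclideanSpace.single i 1) +
            2 * deriv shellBump (‖x‖ ^ 2) * (x i * Y i x) := by
        intro i
        have hb : HasDerivAt (fun t => shellBump t) (deriv shellBump (‖x‖ ^ 2)) (‖x‖ ^ 2) :=
          ((shellBump.contDiffAt (n := 1)).differentiableAt one_ne_zero).hasDerivAt
        have h2 := HasDerivAt.comp_hasFDerivAt (f := fun x : E4 => ‖x‖ ^ 2) x hb
          (hasStrictFDerivAt_norm_sq x).hasFDerivAt
        have h3 := h2.mul ((hY i x hx).differentiableAt one_ne_zero).hasFDerivAt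
        have h4 := h3.fderiv
        change fderiv ℝ (fun x : E4 => shellBump (‖x‖ ^ 2) * Y i x) x = _ at h4
        rw [h4]
        simp [EuclideanSpace.inner_single_right]
        ring
      simp only [h1]
      rw [Finset.sum_add_distrib, ← Finset.mul_sum, ← Finset.mul_sum, hrad x hx, hdiv x hx]
      ring
  have h5 := integral_radial_mul (fun r => shellBump (r ^ 2) * (r ^ 2)⁻¹) g
  have h6 : ∫ x : E4, shellBump (‖x‖ ^ 2) * (‖x‖ ^ 2)⁻¹ * g (‖x‖⁻¹ • x) = 0 := by
    simp only [← key]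
    rw [integral_finsetSum]
    · exact Finset.sum_eq_zero fun i _ => integral_fderiv_eq_zero (hX i) (hXc i) _
    · intro i _
      exact (((hX i).continuous_fderiv one_ne_zero).clm_apply
        continuous_const).integrable_of_hasCompactSupport ((hXc i).fderiv_apply ℝ _)
  rw [h6] at h5
  exact (mul_eq_zero.1 h5.symm).resolve_right integral_shellBump_radial_ne_zero

theorem fderiv_eq_of_homogeneous {U : E4 → E4} (hU : ∀ c : ℝ, 0 < c → ∀ x, U (c • x) = U x)
    {c : ℝ} (hc : 0 < c) (x : E4) : fderiv ℝ U x = c • fderiv ℝ U (c • x) := by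
  rw [← fderiv_comp_smul]
  congr 1
  ext1 y
  exact (hU c hc y).symm

theorem fderiv_self_eq_zero_of_homogeneous {U : E4 → E4}
    (hU : ∀ c : ℝ, 0 < c → ∀ x, U (c • x) = U x) {x : E4} (hx : DifferentiableAt ℝ U x) :
    fderiv ℝ U x x = 0 := by
  have h1 : HasDerivAt (fun c : ℝ => U (c • x)) (fderiv ℝ U x x) 1 := by
    have h2 : HasFDerivAt U (fderiv ℝ U x) ((1 : ℝ) • x) := by
      rw [one_smul]
      exact hx.hasFDerivAt
    exact (h2.comp_hasDerivAt (1 : ℝ) ((hasDerivAt_id (1 : ℝ)).smul_const x)).congr_deriv (by simp)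
  refine h1.unique ((hasDerivAt_const (1 : ℝ) (U x)).congr_of_eventuallyEq ?_)
  filter_upwards [lt_mem_nhds (show (0 : ℝ) < 1 by norm_num)] with c hc using hU c hc x

/-- Green's formula on the sphere, for homogeneous extensions of degree zero. -/
theorem integral_sphere_inner_fderiv_eq_zero {U V : E4 → E4}
    (hU : ∀ x ≠ 0, ContDiffAt ℝ ∞ U x) (hV : ∀ x ≠ 0, ContDiffAt ℝ ∞ V x)
    (hU0 : ∀ c : ℝ, 0 < c → ∀ x, U (c • x) = U x) (hV0 : ∀ c : ℝ, 0 < c → ∀ x, V (c • x) = V x)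
    (hΔ : ∀ x ≠ 0, inner ℝ (∑ i, fderiv ℝ (fun y => fderiv ℝ U y (EuclideanSpace.single i 1)) x
      (EuclideanSpace.single i 1)) (V x) = 0) :
    ∫ p : S3, ∑ i : Fin 4, inner ℝ (fderiv ℝ U p (EuclideanSpace.single i 1))
      (fderiv ℝ V p (EuclideanSpace.single i 1)) ∂((volume : Measure E4).toSphere) = 0 := by
  have hU' : ∀ i : Fin 4, ∀ x ≠ 0,
      ContDiffAt ℝ 1 (fun y => fderiv ℝ U y (EuclideanSpace.single i (1 : ℝ))) x := fun i x hx =>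
    ((hU x hx).fderiv_right (m := 1) (show ((2 : ℕ∞) : ℕ∞ω) ≤ ((⊤ : ℕ∞) : ℕ∞ω) from WithTop.coe_le_coe.2 le_top)).clm_apply contDiffAt_const
  have hV' : ∀ x ≠ 0, ContDiffAt ℝ 1 V x := fun x hx => (hV x hx).of_le (by simp)
  refine integral_sphere_eq_zero
    (Y := fun i x => inner ℝ (fderiv ℝ U x (EuclideanSpace.single i 1)) (V x))
    (g := fun y => ∑ i : Fin 4, inner ℝ (fderiv ℝ U y (EuclideanSpace.single i 1))
      (fderiv ℝ V y (EuclideanSpace.single i 1)))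
    (fun i x hx => (hU' i x hx).inner ℝ (hV' x hx)) (fun x hx => ?_) (fun x hx => ?_)
  · have h1 : ∑ i, x i * inner ℝ (fderiv ℝ U x (EuclideanSpace.single i 1)) (V x) =
        inner ℝ (fderiv ℝ U x (∑ i, x i • EuclideanSpace.single i (1 : ℝ))) (V x) := by
      rw [map_sum, sum_inner]
      refine Finset.sum_congr rfl fun i _ => ?_
      rw [map_smul, real_inner_smul_left]
    have h2 : ∑ i, x i • EuclideanSpace.single i (1 : ℝ) = x := by
      have := (EuclideanSpace.basisFun (Fin 4) ℝ).sum_repr x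
      simpa using this
    rw [h1, h2, fderiv_self_eq_zero_of_homogeneous hU0 ((hU x hx).differentiableAt (by simp)),
      inner_zero_left]
  · have h1 : ∀ i : Fin 4, fderiv ℝ
        (fun x => inner ℝ (fderiv ℝ U x (EuclideanSpace.single i 1)) (V x)) x
        (EuclideanSpace.single i 1) =
        inner ℝ (fderiv ℝ U x (EuclideanSpace.single i 1)) (fderiv ℝ V x (EuclideanSpace.single i 1)) +
        inner ℝ (fderiv ℝ (fun y => fderiv ℝ U y (EuclideanSpace.single i 1)) x
          (EuclideanSpace.single i 1)) (V x) := fun i =>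
      fderiv_inner_apply ℝ ((hU' i x hx).differentiableAt one_ne_zero)
        ((hV' x hx).differentiableAt one_ne_zero) _
    simp only [h1]
    rw [Finset.sum_add_distrib, ← sum_inner, hΔ x hx, add_zero, Finset.mul_sum]
    refine Finset.sum_congr rfl fun i _ => ?_
    have hpos : 0 < ‖x‖⁻¹ := inv_pos.2 (norm_pos_iff.2 hx)
    rw [fderiv_eq_of_homogeneous hU0 hpos x, fderiv_eq_of_homogeneous hV0 hpos x]
    simp only [smul_apply, real_inner_smul_left, real_inner_smul_right]
    ring

/-! ## The first variation of the energy -/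

theorem coe_ne_zero_of_sphere (p : S3) : (p : E4) ≠ 0 := ne_zero_of_mem_unit_sphere p

theorem contDiffAt_normalize {x : E4} (hx : x ≠ 0) :
    ContDiffAt ℝ ∞ (fun x : E4 => ‖x‖⁻¹ • x) x :=
  ((contDiffAt_norm ℝ hx).inv (norm_ne_zero_iff.2 hx)).smul contDiffAt_id

theorem radialExtension_smul (u : S3 → S3) {c : ℝ} (hc : 0 < c) (x : E4) :
    radialExtension u (c • x) = radialExtension u x := by
  by_cases hx : x = 0
  · rw [hx, smul_zero]
  · have hcx : c • x ≠ 0 := smul_ne_zero hc.ne' hx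
    rw [radialExtension, radialExtension, dif_neg hx, dif_neg hcx]
    congr 3
    rw [norm_smul, Real.norm_of_nonneg hc.le, smul_smul, mul_inv_rev, mul_assoc,
      inv_mul_cancel₀ hc.ne', mul_one]

theorem norm_radialExtension (u : S3 → S3) {x : E4} (hx : x ≠ 0) : ‖radialExtension u x‖ = 1 := by
  rw [radialExtension, dif_neg hx]
  exact norm_eq_of_mem_sphere _

/-- The radial extension of a smooth variation is smooth away from the origin. -/
theorem contDiffAt_radialExtension_variation {F : ℝ → S3 → S3}
    (hF : ContMDiff (𝓘(ℝ, ℝ).prod (𝓡 3)) (𝓡 3) ∞ (fun q : ℝ × S3 => F q.1 q.2))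
    {q : ℝ × E4} (hq : q.2 ≠ 0) :
    ContDiffAt ℝ ∞ (fun q : ℝ × E4 => radialExtension (F q.1) q.2) q := by
  let O : TopologicalSpace.Opens (ℝ × E4) :=
    ⟨{q | q.2 ≠ 0}, isOpen_ne.preimage continuous_snd⟩
  have hν : ContMDiff 𝓘(ℝ, ℝ × E4) 𝓘(ℝ, E4) ∞ (fun q : O => ‖q.1.2‖⁻¹ • q.1.2) := fun q =>
    contMDiffAt_subtype_iff (U := O) (f := fun q : ℝ × E4 => ‖q.2‖⁻¹ • q.2) |>.2
      (ContDiffAt.contMDiffAt (ContDiffAt.comp q.1 (g := fun x : E4 => ‖x‖⁻¹ • x)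
        (contDiffAt_normalize q.2) contDiffAt_snd))
  have hν' := hν.codRestrict_sphere (n := 3) fun q => ProfilePair.normalize_mem q.2
  have hτ : ContMDiff 𝓘(ℝ, ℝ × E4) 𝓘(ℝ, ℝ) ∞ (fun q : O => q.1.1) := fun q =>
    contMDiffAt_subtype_iff (U := O) (f := fun q : ℝ × E4 => q.1) |>.2
      (ContDiffAt.contMDiffAt contDiffAt_fst)
  have hcomp := (contMDiff_coe_sphere (n := 3) (m := ∞)).comp (hF.comp (hτ.prodMk hν'))
  have h1 : ContMDiffAt 𝓘(ℝ, ℝ × E4) 𝓘(ℝ, E4) ∞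
      (fun q : O => radialExtension (F q.1.1) q.1.2) ⟨q, hq⟩ := by
    refine (hcomp ⟨q, hq⟩).congr_of_eventuallyEq (Eventually.of_forall fun y => ?_)
    have : y.1.2 ≠ 0 := y.2
    simp only [radialExtension, dif_neg this]
    rfl
  exact (contMDiffAt_subtype_iff (U := O)
    (f := fun q : ℝ × E4 => radialExtension (F q.1) q.2) |>.1 h1).contDiffAt

/-- Differentiation under the integral sign: the t-derivative of the density is continuous, hence
bounded on [-1, 1] × S³. Symmetry of second derivatives then replaces the t-derivative of the
differential by the differential of the variation field. -/
theorem hasDerivAt_integral_normSq_fderiv {W : ℝ × E4 → E4}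
    (hW : ∀ q : ℝ × E4, q.2 ≠ 0 → ContDiffAt ℝ ∞ W q) :
    HasDerivAt (fun t : ℝ => ∫ p : S3, ∑ i : Fin 4,
        ‖fderiv ℝ (fun x => W (t, x)) p (EuclideanSpace.single i 1)‖ ^ 2
        ∂((volume : Measure E4).toSphere))
      (∫ p : S3, 2 * ∑ i : Fin 4,
        inner ℝ (fderiv ℝ (fun x => W (0, x)) p (EuclideanSpace.single i 1))
          (fderiv ℝ (fun x => fderiv ℝ W (0, x) (1, 0)) p (EuclideanSpace.single i 1))
        ∂((volume : Measure E4).toSphere)) 0 := by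
  have hW' : ∀ q : ℝ × E4, q.2 ≠ 0 → ContDiffAt ℝ ∞ (fderiv ℝ W) q := fun q hq =>
    (hW q hq).fderiv_right (by simp)
  let e : Fin 4 → E4 := fun i => EuclideanSpace.single i 1
  let D : ℝ × E4 → ℝ := fun q => ∑ i : Fin 4, ‖fderiv ℝ W q (0, e i)‖ ^ 2
  have hD : ∀ q : ℝ × E4, q.2 ≠ 0 → ContDiffAt ℝ ∞ D q := fun q hq =>
    ContDiffAt.sum fun i _ => ((hW' q hq).clm_apply contDiffAt_const).norm_sq ℝ
  have hslice : ∀ (t : ℝ) {x : E4}, x ≠ 0 → ∀ v : E4,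
      fderiv ℝ (fun x => W (t, x)) x v = fderiv ℝ W (t, x) (0, v) := by
    intro t x hx v
    have h1 := ((hW (t, x) hx).differentiableAt (by simp)).hasFDerivAt.comp x
      (hasFDerivAt_prodMk_right t x)
    have h2 : fderiv ℝ (fun x => W (t, x)) x = _ := h1.fderiv
    rw [h2]
    simp
  have hV : ∀ {x : E4}, x ≠ 0 → ∀ v : E4, fderiv ℝ (fun x => fderiv ℝ W (0, x) (1, 0)) x v =
      fderiv ℝ (fderiv ℝ W) (0, x) (0, v) (1, 0) := by
    intro x hx v
    have h1 := (((hW' (0, x) hx).differentiableAt (by simp)).hasFDerivAt.comp x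
      (hasFDerivAt_prodMk_right (0 : ℝ) x)).clm_apply (hasFDerivAt_const ((1 : ℝ), (0 : E4)) x)
    have h2 : fderiv ℝ (fun x => fderiv ℝ W (0, x) (1, 0)) x = _ := h1.fderiv
    rw [h2]
    simp
  have hDt : ∀ (t : ℝ) (p : S3), HasDerivAt (fun t => D (t, p)) (fderiv ℝ D (t, p) (1, 0)) t := by
    intro t p
    have h1 := ((hD (t, p) (coe_ne_zero_of_sphere p)).differentiableAt (by simp)).hasFDerivAt
    exact (h1.comp_hasDerivAt t ((hasDerivAt_id t).prodMk (hasDerivAt_const t (p : E4))))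
  have hcontD : Continuous fun y : ℝ × S3 => D (y.1, y.2) := by
    refine continuous_iff_continuousAt.2 fun y => ?_
    exact ContinuousAt.comp (g := D) (f := fun y : ℝ × S3 => (y.1, (y.2 : E4)))
      (hD (y.1, y.2) (coe_ne_zero_of_sphere _)).continuousAt (by fun_prop)
  have hcontD' : Continuous fun y : ℝ × S3 => fderiv ℝ D (y.1, y.2) (1, 0) := by
    refine continuous_iff_continuousAt.2 fun y => ?_
    exact ContinuousAt.comp (g := fun q => fderiv ℝ D q (1, 0))
      (f := fun y : ℝ × S3 => (y.1, (y.2 : E4)))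
      (((hD (y.1, y.2) (coe_ne_zero_of_sphere _)).fderiv_right (m := ∞)
        (by simp)).clm_apply contDiffAt_const).continuousAt (by fun_prop)
  obtain ⟨C, hC⟩ := (isCompact_Icc (a := (-1 : ℝ)) (b := 1)).prod (isCompact_univ (X := S3))
    |>.exists_bound_of_continuousOn hcontD'.continuousOn
  have hmain := hasDerivAt_integral_of_dominated_loc_of_deriv_le (𝕜 := ℝ)
    (μ := (volume : Measure E4).toSphere) (F := fun t (p : S3) => D (t, p))
    (F' := fun t (p : S3) => fderiv ℝ D (t, p) (1, 0)) (x₀ := 0) (s := Icc (-1) 1)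
    (bound := fun _ => C) (Icc_mem_nhds (by norm_num) (by norm_num))
    (Eventually.of_forall fun t =>
      (hcontD.comp (by fun_prop : Continuous fun p : S3 => (t, p))).aestronglyMeasurable)
    ((hcontD.comp (by fun_prop : Continuous fun p : S3 => ((0 : ℝ), p))).integrable_of_hasCompactSupport
      (HasCompactSupport.of_compactSpace _))
    ((hcontD'.comp (by fun_prop : Continuous fun p : S3 => ((0 : ℝ), p))).aestronglyMeasurable)
    (Eventually.of_forall fun p t ht => hC (t, p) ⟨ht, mem_univ _⟩)
    (integrable_const C) (Eventually.of_forall fun p t _ => hDt t p)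
  refine (hmain.2.congr_of_eventuallyEq (Eventually.of_forall fun t => ?_)).congr_deriv ?_
  · refine integral_congr_ae (Eventually.of_forall fun p => ?_)
    exact Finset.sum_congr rfl fun i _ => by rw [hslice t (coe_ne_zero_of_sphere p)]
  · refine integral_congr_ae (Eventually.of_forall fun p => ?_)
    have hp := coe_ne_zero_of_sphere p
    have hsymm : IsSymmSndFDerivAt ℝ W (0, (p : E4)) :=
      (hW (0, p) hp).isSymmSndFDerivAt (by
        rw [minSmoothness_of_isRCLikeNormedField]
        exact (WithTop.coe_le_coe.2 le_top : ((2 : ℕ∞) : ℕ∞ω) ≤ ((⊤ : ℕ∞) : ℕ∞ω)))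
    have h1 : HasDerivAt (fun t => D (t, p)) (∑ i, 2 * inner ℝ (fderiv ℝ W (0, p) (0, e i))
        (fderiv ℝ (fderiv ℝ W) (0, p) (1, 0) (0, e i))) 0 := by
      refine HasDerivAt.fun_sum fun i _ => ?_
      have h2 := ((hW' (0, p) hp).differentiableAt (by simp)).hasFDerivAt.comp_hasDerivAt (0 : ℝ)
        ((hasDerivAt_id (0 : ℝ)).prodMk (hasDerivAt_const (0 : ℝ) (p : E4)))
      have h3 := (h2.clm_apply (hasDerivAt_const (0 : ℝ) ((0 : ℝ), e i))).norm_sq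
      exact h3.congr_deriv (by simp)
    beta_reduce
    rw [(hDt 0 p).unique h1, ← Finset.mul_sum]
    congr 1
    refine Finset.sum_congr rfl fun i _ => ?_
    rw [hslice 0 hp, hV hp, hsymm.eq]

/-- A smooth map whose tension field vanishes is a critical point of the energy. -/
theorem isHarmonicMap_of_laplacian {u : S3 → S3} (hu : IsSmoothMap u)
    (hΔ : ∀ x ≠ 0, ∀ v : E4, inner ℝ (radialExtension u x) v = 0 →
      inner ℝ (∑ i, fderiv ℝ (fun y => fderiv ℝ (radialExtension u) y (EuclideanSpace.single i 1)) x
        (EuclideanSpace.single i 1)) v = 0) : IsHarmonicMap u := by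
  refine ⟨hu, fun F hF hF0 => ?_⟩
  subst hF0
  let W : ℝ × E4 → E4 := fun q => radialExtension (F q.1) q.2
  have hW : ∀ q : ℝ × E4, q.2 ≠ 0 → ContDiffAt ℝ ∞ W q := fun q hq =>
    contDiffAt_radialExtension_variation hF hq
  have hderiv : ∀ x : E4, x ≠ 0 → HasDerivAt (fun t => W (t, x)) (fderiv ℝ W (0, x) (1, 0)) 0 := by
    intro x hx
    exact ((hW (0, x) hx).differentiableAt (by simp)).hasFDerivAt.comp_hasDerivAt (0 : ℝ)
      ((hasDerivAt_id (0 : ℝ)).prodMk (hasDerivAt_const (0 : ℝ) x))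
  have h1 := hasDerivAt_integral_normSq_fderiv hW
  have h2 : ∫ p : S3, ∑ i : Fin 4,
        inner ℝ (fderiv ℝ (fun x => W (0, x)) p (EuclideanSpace.single i 1))
          (fderiv ℝ (fun x => fderiv ℝ W (0, x) (1, 0)) p (EuclideanSpace.single i 1))
        ∂((volume : Measure E4).toSphere) = 0 := by
    refine integral_sphere_inner_fderiv_eq_zero (U := fun x => W (0, x))
      (V := fun x => fderiv ℝ W (0, x) (1, 0)) (fun x hx => ?_) (fun x hx => ?_)
      (fun c hc x => radialExtension_smul _ hc x) (fun c hc x => ?_) (fun x hx => ?_)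
    · exact ContDiffAt.comp x (g := W) (hW (0, x) hx) (contDiffAt_const.prodMk contDiffAt_id)
    · exact (ContDiffAt.comp x (g := fderiv ℝ W) ((hW (0, x) hx).fderiv_right (by simp))
        (contDiffAt_const.prodMk contDiffAt_id)).clm_apply contDiffAt_const
    · by_cases hx : x = 0
      · rw [hx, smul_zero]
      · refine (hderiv _ (smul_ne_zero hc.ne' hx)).unique
          ((hderiv x hx).congr_of_eventuallyEq (Eventually.of_forall fun t => ?_))
        exact radialExtension_smul _ hc x
    -- The variation field is tangent to the target, because |W|² = 1 for all t.
    · refine hΔ x hx _ ?_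
      have h3 := (hderiv x hx).norm_sq
      have h4 : HasDerivAt (fun t => ‖W (t, x)‖ ^ 2) 0 0 := by
        refine (hasDerivAt_const (0 : ℝ) (1 : ℝ)).congr_of_eventuallyEq
          (Eventually.of_forall fun t => ?_)
        change ‖radialExtension (F t) x‖ ^ 2 = 1
        rw [norm_radialExtension _ hx, one_pow]
      have h5 := h3.unique h4
      linarith
  rw [integral_const_mul, h2, mul_zero] at h1
  exact h1

/-! ## The Laplacian of the radial extension of a symmetric map -/

section LineDeriv

variable {E : Type*} [NormedAddCommGroup E] [NormedSpace ℝ E] {f g : E → ℝ} {f' g' : ℝ} {x v : E}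

theorem hasLineDerivAt_mul (hf : HasLineDerivAt ℝ f f' x v) (hg : HasLineDerivAt ℝ g g' x v) :
    HasLineDerivAt ℝ (fun y => f y * g y) (f' * g x + f x * g') x v := by
  simpa only [HasLineDerivAt, zero_smul, add_zero] using HasDerivAt.fun_mul hf hg

theorem hasLineDerivAt_add (hf : HasLineDerivAt ℝ f f' x v) (hg : HasLineDerivAt ℝ g g' x v) :
    HasLineDerivAt ℝ (fun y => f y + g y) (f' + g') x v :=
  HasDerivAt.fun_add hf hg

theorem hasLineDerivAt_const_sub (c : ℝ) (hf : HasLineDerivAt ℝ f f' x v) :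
    HasLineDerivAt ℝ (fun y => c - f y) (-f') x v :=
  HasDerivAt.const_sub c hf

theorem hasLineDerivAt_congr {f'' : ℝ} (hf : HasLineDerivAt ℝ f f' x v) (h : f' = f'') :
    HasLineDerivAt ℝ f f'' x v :=
  h ▸ hf

theorem hasLineDerivAt_comp {φ : ℝ → ℝ} {φ' : ℝ} (hφ : HasDerivAt φ φ' (f x))
    (hf : HasLineDerivAt ℝ f f' x v) : HasLineDerivAt ℝ (fun y => φ (f y)) (φ' * f') x v := by
  refine HasDerivAt.comp (h₂ := φ) (0 : ℝ) ?_ hf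
  simpa using hφ

end LineDeriv

/-- The standard basis of the ambient space. -/
def stdVec (i : Fin 4) : E4 := EuclideanSpace.single i 1

/-- The `k`-th coordinate of `x / |x|`. -/
def dirCoord (k : Fin 4) (x : E4) : ℝ := ‖x‖⁻¹ * x k

/-- The derivative of `dirCoord k` in the direction `i`. -/
def dirCoordDeriv (i k : Fin 4) (x : E4) : ℝ :=
  ((if i = k then 1 else 0) - dirCoord i x * dirCoord k x) * ‖x‖⁻¹

theorem hasLineDerivAt_norm_inv {x : E4} (hx : x ≠ 0) (i : Fin 4) :
    HasLineDerivAt ℝ (fun x : E4 => ‖x‖⁻¹) (-(dirCoord i x * ‖x‖⁻¹ ^ 2)) x (stdVec i) := by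
  have hn := norm_ne_zero_iff.2 hx
  have hd : DifferentiableAt ℝ (fun x : E4 => ‖x‖) x := differentiableAt_id.norm ℝ hx
  have h1 := hd.hasFDerivAt.hasLineDerivAt (stdVec i)
  have h2 := hasLineDerivAt_mul h1 h1
  have h3 : HasLineDerivAt ℝ (fun x : E4 => ‖x‖ * ‖x‖) (2 * x i) x (stdVec i) := by
    have h4 := (hasStrictFDerivAt_norm_sq x).hasFDerivAt.hasLineDerivAt (stdVec i)
    simp only [← pow_two]
    refine hasLineDerivAt_congr h4 ?_
    simp [stdVec, EuclideanSpace.inner_single_right]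
  have h5 := h2.unique h3
  have h6 : fderiv ℝ (fun x : E4 => ‖x‖) x (stdVec i) = dirCoord i x := by
    rw [dirCoord]
    field_simp
    linarith
  rw [h6] at h1
  refine hasLineDerivAt_congr (hasLineDerivAt_comp (φ := fun r => r⁻¹) (hasDerivAt_inv hn) h1) ?_
  ring

theorem hasLineDerivAt_dirCoord {x : E4} (hx : x ≠ 0) (i k : Fin 4) :
    HasLineDerivAt ℝ (dirCoord k) (dirCoordDeriv i k x) x (stdVec i) := by
  have h1 := (EuclideanSpace.proj (𝕜 := ℝ) k : E4 →L[ℝ] ℝ).hasFDerivAt (x := x)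
    |>.hasLineDerivAt (stdVec i)
  have h2 := hasLineDerivAt_mul (hasLineDerivAt_norm_inv hx i) h1
  have h3 : (EuclideanSpace.proj (𝕜 := ℝ) k : E4 →L[ℝ] ℝ) (stdVec i) = if i = k then 1 else 0 := by
    simp [stdVec, eq_comm]
  rw [h3] at h2
  refine hasLineDerivAt_congr h2 ?_
  simp only [dirCoordDeriv, dirCoord, EuclideanSpace.coe_proj]
  ring

theorem hasLineDerivAt_dirCoordDeriv {x : E4} (hx : x ≠ 0) (i k : Fin 4) :
    HasLineDerivAt ℝ (dirCoordDeriv i k)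
      (-(dirCoordDeriv i i x * dirCoord k x + dirCoord i x * dirCoordDeriv i k x) * ‖x‖⁻¹ +
        ((if i = k then 1 else 0) - dirCoord i x * dirCoord k x) * -(dirCoord i x * ‖x‖⁻¹ ^ 2))
      x (stdVec i) :=
  hasLineDerivAt_mul (hasLineDerivAt_const_sub _
    (hasLineDerivAt_mul (hasLineDerivAt_dirCoord hx i i) (hasLineDerivAt_dirCoord hx i k)))
    (hasLineDerivAt_norm_inv hx i)

theorem sum_dirCoord_sq {x : E4} (hx : x ≠ 0) :
    dirCoord 0 x ^ 2 + dirCoord 1 x ^ 2 + dirCoord 2 x ^ 2 + dirCoord 3 x ^ 2 = 1 :=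
  sum_sq_eq_one (ProfilePair.normalize_mem hx)

/-- Inner products of the gradients of the coordinates of x/|x|: the gradients are the projections
of the basis vectors to the tangent space, divided by |x|. -/
theorem sum_dirCoordDeriv_mul {x : E4} (hx : x ≠ 0) (j k : Fin 4) :
    ∑ i, dirCoordDeriv i j x * dirCoordDeriv i k x =
      ((if j = k then 1 else 0) - dirCoord j x * dirCoord k x) * ‖x‖⁻¹ ^ 2 := by
  have h := sum_dirCoord_sq hx
  have h1 : ∑ i, dirCoordDeriv i j x * dirCoordDeriv i k x =
      ((∑ i, (if i = j then (1 : ℝ) else 0) * (if i = k then 1 else 0)) -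
        dirCoord k x * (∑ i, (if i = j then (1 : ℝ) else 0) * dirCoord i x) -
        dirCoord j x * (∑ i, (if i = k then (1 : ℝ) else 0) * dirCoord i x) +
        dirCoord j x * dirCoord k x * ∑ i, dirCoord i x ^ 2) * ‖x‖⁻¹ ^ 2 := by
    simp only [Finset.mul_sum, ← Finset.sum_sub_distrib, ← Finset.sum_add_distrib, Finset.sum_mul]
    refine Finset.sum_congr rfl fun i _ => ?_
    rw [dirCoordDeriv, dirCoordDeriv]
    ring
  rw [h1, Fin.sum_univ_four (fun i => dirCoord i x ^ 2), h]
  simp only [ite_mul, one_mul, zero_mul, Finset.sum_ite_eq', Finset.mem_univ, if_true]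
  ring

/-- The coordinate functions are spherical harmonics of degree one on S³, with eigenvalue -3. -/
theorem sum_dirCoordDeriv_snd {x : E4} (hx : x ≠ 0) (k : Fin 4) :
    ∑ i, (-(dirCoordDeriv i i x * dirCoord k x + dirCoord i x * dirCoordDeriv i k x) * ‖x‖⁻¹ +
        ((if i = k then 1 else 0) - dirCoord i x * dirCoord k x) * -(dirCoord i x * ‖x‖⁻¹ ^ 2)) =
      -3 * dirCoord k x * ‖x‖⁻¹ ^ 2 := by
  have h := sum_dirCoord_sq hx
  have h1 : ∑ i, (-(dirCoordDeriv i i x * dirCoord k x + dirCoord i x * dirCoordDeriv i k x) *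
        ‖x‖⁻¹ + ((if i = k then 1 else 0) - dirCoord i x * dirCoord k x) *
          -(dirCoord i x * ‖x‖⁻¹ ^ 2)) =
      (-dirCoord k x * (∑ _i : Fin 4, (1 : ℝ)) + 3 * dirCoord k x * (∑ i, dirCoord i x ^ 2) -
        2 * ∑ i, (if i = k then (1 : ℝ) else 0) * dirCoord i x) * ‖x‖⁻¹ ^ 2 := by
    simp only [Finset.mul_sum, ← Finset.sum_sub_distrib, ← Finset.sum_add_distrib, Finset.sum_mul]
    refine Finset.sum_congr rfl fun i _ => ?_
    rw [dirCoordDeriv, dirCoordDeriv, if_pos rfl]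
    ring
  rw [h1, Fin.sum_univ_four (fun i => dirCoord i x ^ 2), h]
  simp only [ite_mul, one_mul, zero_mul, Finset.sum_ite_eq', Finset.mem_univ, if_true,
    Finset.sum_const, Finset.card_univ, Fintype.card_fin]
  norm_num
  ring

/-- The second directional derivatives of a smooth map, computed coordinatewise. -/
theorem snd_fderiv_apply_eq {U : E4 → E4} (hU : ∀ x ≠ 0, ContDiffAt ℝ ∞ U x) {i j : Fin 4}
    {g : E4 → ℝ} {g' : ℝ} (hg : ∀ y ≠ 0, HasLineDerivAt ℝ (fun y => U y j) (g y) y (stdVec i))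
    {x : E4} (hx : x ≠ 0) (hg' : HasLineDerivAt ℝ g g' x (stdVec i)) :
    fderiv ℝ (fun y => fderiv ℝ U y (stdVec i)) x (stdVec i) j = g' := by
  have hcoord : ∀ {V : E4 → E4} {y : E4}, DifferentiableAt ℝ V y →
      HasLineDerivAt ℝ (fun y => V y j) (fderiv ℝ V y (stdVec i) j) y (stdVec i) := fun hV =>
    ((EuclideanSpace.proj (𝕜 := ℝ) j : E4 →L[ℝ] ℝ).hasFDerivAt.comp _ hV.hasFDerivAt).hasLineDerivAt _
  have h1 : ∀ y ≠ 0, fderiv ℝ U y (stdVec i) j = g y := fun y hy =>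
    (hcoord ((hU y hy).differentiableAt (by simp))).unique (hg y hy)
  have h2 : DifferentiableAt ℝ (fun y => fderiv ℝ U y (stdVec i)) x :=
    (((hU x hx).fderiv_right (m := ∞) (by simp)).clm_apply contDiffAt_const).differentiableAt
      (by simp)
  refine (hcoord h2).unique (hg'.congr_of_eventuallyEq ?_)
  filter_upwards [isOpen_ne.mem_nhds hx] with y hy using h1 y hy

/-! ### The symmetric map satisfies the harmonic map equation -/

namespace ProfilePair

variable {A B : ℝ → ℝ}

theorem dirCoord_zero_mem {x : E4} (hx : x ≠ 0) : dirCoord 0 x ∈ Icc (-1 : ℝ) 1 :=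
  height_mem (normalize_mem hx)

theorem contDiffAt_radialExtension (P : ProfilePair A B) {x : E4} (hx : x ≠ 0) :
    ContDiffAt ℝ ∞ (radialExtension P.symmetricMap) x := by
  refine ContDiffAt.congr_of_eventuallyEq (ContDiffAt.comp x (g := profileVec A B)
    (f := fun x : E4 => ‖x‖⁻¹ • x)
    (P.contDiffAt_profileVec (height_mem (normalize_mem hx))) (contDiffAt_normalize hx)) ?_
  filter_upwards [isOpen_ne.mem_nhds hx] with y hy using P.radialExtension_symmetricMap hy

theorem radialExtension_coord_zero (P : ProfilePair A B) {x : E4} (hx : x ≠ 0) :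
    radialExtension P.symmetricMap x 0 = A (dirCoord 0 x) := by
  rw [P.radialExtension_symmetricMap hx]
  rfl

theorem radialExtension_coord_ne (P : ProfilePair A B) {x : E4} (hx : x ≠ 0) {j : Fin 4}
    (hj : j ≠ 0) : radialExtension P.symmetricMap x j = B (dirCoord 0 x) * dirCoord j x := by
  rw [P.radialExtension_symmetricMap hx, profileVec_of_ne A B _ hj]
  rfl

theorem hasDerivAt_of_contDiffAt {φ : ℝ → ℝ} {z : ℝ} (h : ContDiffAt ℝ ∞ φ z) :
    HasDerivAt φ (deriv φ z) z ∧ HasDerivAt (deriv φ) (deriv (deriv φ) z) z := by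
  refine ⟨(h.differentiableAt (by simp)).hasDerivAt, DifferentiableAt.hasDerivAt ?_⟩
  exact ((h.fderiv_right (m := ∞) (by simp)).clm_apply contDiffAt_const).differentiableAt (by simp)

theorem hasLineDerivAt_radialExtension (P : ProfilePair A B) {x : E4} (hx : x ≠ 0) {i j : Fin 4}
    {f : E4 → ℝ} {f' : ℝ} (hf : ∀ y ≠ 0, radialExtension P.symmetricMap y j = f y)
    (h : HasLineDerivAt ℝ f f' x (stdVec i)) :
    HasLineDerivAt ℝ (fun y => radialExtension P.symmetricMap y j) f' x (stdVec i) := by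
  refine h.congr_of_eventuallyEq ?_
  filter_upwards [isOpen_ne.mem_nhds hx] with y hy using hf y hy

theorem laplacian_coord_zero (P : ProfilePair A B) {x : E4} (hx : x ≠ 0) :
    (∑ i, fderiv ℝ (fun y => fderiv ℝ (radialExtension P.symmetricMap) y (stdVec i)) x
      (stdVec i)) 0 =
      ((1 - dirCoord 0 x ^ 2) * deriv (deriv A) (dirCoord 0 x) -
        3 * dirCoord 0 x * deriv A (dirCoord 0 x)) * ‖x‖⁻¹ ^ 2 := by
  have hA := fun {y : E4} (hy : y ≠ 0) =>
    hasDerivAt_of_contDiffAt (P.contDiffAt_fst _ (dirCoord_zero_mem hy))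
  have h1 : ∀ i : Fin 4, fderiv ℝ
      (fun y => fderiv ℝ (radialExtension P.symmetricMap) y (stdVec i)) x (stdVec i) 0 = _ := fun i =>
    snd_fderiv_apply_eq (fun x hx => P.contDiffAt_radialExtension hx)
      (fun y hy => P.hasLineDerivAt_radialExtension hy
        (fun y hy => P.radialExtension_coord_zero hy)
        (hasLineDerivAt_comp (hA hy).1 (hasLineDerivAt_dirCoord hy i 0))) hx
      (hasLineDerivAt_mul (hasLineDerivAt_comp (hA hx).2 (hasLineDerivAt_dirCoord hx i 0))
        (hasLineDerivAt_dirCoordDeriv hx i 0))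
  have h2 := sum_dirCoordDeriv_mul hx 0 0
  have h3 := sum_dirCoordDeriv_snd hx 0
  rw [if_pos rfl] at h2
  rw [WithLp.ofLp_sum, Finset.sum_apply]
  simp only [h1]
  rw [Finset.sum_add_distrib, ← Finset.mul_sum, h3]
  simp only [mul_assoc]
  rw [← Finset.mul_sum, h2]
  ring

/-- Product rule for B(ν₀)ν_j with ν = x/|x|: the first order coefficient 5 is 3 from the Laplacian
of ν₀ plus 2 from the cross term, and -3B comes from the Laplacian of ν_j. -/
theorem laplacian_coord_ne (P : ProfilePair A B) {x : E4} (hx : x ≠ 0) {j : Fin 4} (hj : j ≠ 0) :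
    (∑ i, fderiv ℝ (fun y => fderiv ℝ (radialExtension P.symmetricMap) y (stdVec i)) x
      (stdVec i)) j =
      ((1 - dirCoord 0 x ^ 2) * deriv (deriv B) (dirCoord 0 x) -
        5 * dirCoord 0 x * deriv B (dirCoord 0 x) - 3 * B (dirCoord 0 x)) *
          dirCoord j x * ‖x‖⁻¹ ^ 2 := by
  have hB := fun {y : E4} (hy : y ≠ 0) =>
    hasDerivAt_of_contDiffAt (P.contDiffAt_snd _ (dirCoord_zero_mem hy))
  have h1 : ∀ i : Fin 4, fderiv ℝ
      (fun y => fderiv ℝ (radialExtension P.symmetricMap) y (stdVec i)) x (stdVec i) j = _ := fun i =>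
    snd_fderiv_apply_eq (fun x hx => P.contDiffAt_radialExtension hx)
      (fun y hy => P.hasLineDerivAt_radialExtension hy
        (fun y hy => P.radialExtension_coord_ne hy hj)
        (hasLineDerivAt_mul (hasLineDerivAt_comp (hB hy).1 (hasLineDerivAt_dirCoord hy i 0))
          (hasLineDerivAt_dirCoord hy i j))) hx
      (hasLineDerivAt_add
        (hasLineDerivAt_mul
          (hasLineDerivAt_mul (hasLineDerivAt_comp (hB hx).2 (hasLineDerivAt_dirCoord hx i 0))
            (hasLineDerivAt_dirCoordDeriv hx i 0)) (hasLineDerivAt_dirCoord hx i j))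
        (hasLineDerivAt_mul (hasLineDerivAt_comp (hB hx).1 (hasLineDerivAt_dirCoord hx i 0))
          (hasLineDerivAt_dirCoordDeriv hx i j)))
  have h2 := sum_dirCoordDeriv_mul hx 0 0
  have h3 := sum_dirCoordDeriv_snd hx 0
  have h4 := sum_dirCoordDeriv_mul hx 0 j
  have h5 := sum_dirCoordDeriv_snd hx j
  rw [if_pos rfl] at h2
  rw [if_neg hj.symm] at h4
  rw [WithLp.ofLp_sum, Finset.sum_apply]
  simp only [h1]
  set q : Fin 4 → Fin 4 → ℝ := fun i k =>
    -(dirCoordDeriv i i x * dirCoord k x + dirCoord i x * dirCoordDeriv i k x) * ‖x‖⁻¹ +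
        ((if i = k then 1 else 0) - dirCoord i x * dirCoord k x) * -(dirCoord i x * ‖x‖⁻¹ ^ 2) with hq
  calc _ = deriv (deriv B) (dirCoord 0 x) * dirCoord j x *
            (∑ i, dirCoordDeriv i 0 x * dirCoordDeriv i 0 x) +
          deriv B (dirCoord 0 x) * dirCoord j x * (∑ i, q i 0) +
          2 * deriv B (dirCoord 0 x) * (∑ i, dirCoordDeriv i 0 x * dirCoordDeriv i j x) +
          B (dirCoord 0 x) * ∑ i, q i j := by
        simp only [Finset.mul_sum, ← Finset.sum_add_distrib]
        refine Finset.sum_congr rfl fun i _ => ?_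
        simp only [hq]
        ring
    _ = _ := by
        rw [h2, h4]
        simp only [hq]
        rw [h3, h5]
        ring

/-- Away from the poles the two equations share the factor e, so the Laplacian is -e/|x|² times the
map and hence orthogonal to every tangent vector. -/
theorem isHarmonicMap (P : ProfilePair A B) : IsHarmonicMap P.symmetricMap := by
  refine isHarmonicMap_of_laplacian P.isSmoothMap fun x hx v hv => ?_
  change inner ℝ (∑ i, fderiv ℝ (fun y => fderiv ℝ (radialExtension P.symmetricMap) y (stdVec i)) x
    (stdVec i)) v = 0
  have h0 := P.laplacian_coord_zero hx
  have hj := fun {j : Fin 4} (hj : j ≠ 0) => P.laplacian_coord_ne hx hj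
  have hs := sum_dirCoord_sq hx
  have hz := dirCoord_zero_mem hx
  generalize ∑ i, fderiv ℝ (fun y => fderiv ℝ (radialExtension P.symmetricMap) y (stdVec i)) x
    (stdVec i) = L at h0 hj
  rw [PiLp.inner_apply, Fin.sum_univ_four] at hv ⊢
  simp only [RCLike.inner_apply, conj_trivial] at hv ⊢
  rw [P.radialExtension_coord_zero hx, P.radialExtension_coord_ne hx (by decide : (1 : Fin 4) ≠ 0),
    P.radialExtension_coord_ne hx (by decide : (2 : Fin 4) ≠ 0),
    P.radialExtension_coord_ne hx (by decide : (3 : Fin 4) ≠ 0)] at hv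
  rw [h0, hj (by decide : (1 : Fin 4) ≠ 0), hj (by decide : (2 : Fin 4) ≠ 0),
    hj (by decide : (3 : Fin 4) ≠ 0)]
  by_cases hi : dirCoord 0 x ∈ Ioo (-1 : ℝ) 1
  · obtain ⟨e, h1, h2⟩ := P.ode _ hi
    rw [h1, h2]
    linear_combination (-e * ‖x‖⁻¹ ^ 2) * hv
  -- At the poles the equation is not needed: the map points along the axis, so v₀ = 0, and the
  -- other components of the Laplacian vanish with the coordinates.
  · have h1 : dirCoord 0 x = -1 ∨ dirCoord 0 x = 1 := by
      rcases eq_or_lt_of_le hz.1 with h | h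
      · exact Or.inl h.symm
      · rcases eq_or_lt_of_le hz.2 with h' | h'
        · exact Or.inr h'
        · exact absurd ⟨h, h'⟩ hi
    have h2 : dirCoord 0 x ^ 2 = 1 := by rcases h1 with h | h <;> rw [h] <;> norm_num
    have h3 : dirCoord 1 x = 0 := by
      nlinarith [sq_nonneg (dirCoord 1 x), sq_nonneg (dirCoord 2 x), sq_nonneg (dirCoord 3 x)]
    have h4 : dirCoord 2 x = 0 := by
      nlinarith [sq_nonneg (dirCoord 1 x), sq_nonneg (dirCoord 2 x), sq_nonneg (dirCoord 3 x)]
    have h5 : dirCoord 3 x = 0 := by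
      nlinarith [sq_nonneg (dirCoord 1 x), sq_nonneg (dirCoord 2 x), sq_nonneg (dirCoord 3 x)]
    have h6 := P.sq_add _ hz
    rw [h2, sub_self, zero_mul, add_zero] at h6
    rw [h3, h4, h5] at hv ⊢
    have h7 : A (dirCoord 0 x) ≠ 0 := fun h => by rw [h] at h6; norm_num at h6
    have h8 : v 0 = 0 := by
      simp only [mul_zero, add_zero] at hv
      exact (mul_eq_zero.1 hv).resolve_right h7
    rw [h8]
    ring

end ProfilePair

/-! ## The two families of harmonic maps -/

theorem exists_sign_mul_pos {a : ℝ} (ha : a ≠ 0) :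
    ∃ σ : ℝ, (σ = 1 ∨ σ = -1) ∧ σ * σ = 1 ∧ 0 < σ * a := by
  rcases ha.lt_or_gt with h | h
  · exact ⟨-1, Or.inr rfl, by norm_num, by linarith⟩
  · exact ⟨1, Or.inl rfl, by norm_num, by linarith⟩

theorem IsSolution.sign_mul {h : ℝ → ℝ} (hs : IsSolution h) {σ : ℝ} (hσ : σ = 1 ∨ σ = -1) :
    IsSolution fun x => σ * h x := by
  rcases hσ with rfl | rfl
  · simpa only [one_mul] using hs
  · simpa only [neg_mul, one_mul] using hs.neg

theorem sign_mul_mem_strip {σ a c : ℝ} (hσ : σ = 1 ∨ σ = -1) (ha : a ∈ Ioo (-c) c) :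
    σ * a ∈ Ioo (-c) c := by
  rcases hσ with rfl | rfl
  · rwa [one_mul]
  · exact ⟨by linarith [ha.2], by linarith [ha.1]⟩

theorem PoleOrbit.tendsto_sign_mul {κ σ : ℝ} {h : ℝ → ℝ} (P : PoleOrbit κ h) (hσ : σ * σ = 1) :
    Tendsto (fun x => σ * (σ * h x)) atTop (𝓝 (-(Real.pi / 2))) := by
  simpa only [← mul_assoc, hσ, one_mul] using P.tendsto

/-- The harmonic map of degree one induced by an odd pole orbit. -/
theorem PoleOrbit.exists_harmonicMap_degree_one {κ : ℝ} {h : ℝ → ℝ} (P : PoleOrbit κ h)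
    (h0 : h 0 = 0) : ∃ (A B : ℝ → ℝ) (Q : ProfilePair A B), B (-1) = κ ∧
      IsInducedBy Q.symmetricMap (fun x => -h x) ∧ HasDegree Q.symmetricMap 1 := by
  obtain ⟨A, B, Q, hA1, hA2, hB, hA⟩ := P.exists_profilePair (τ := -1)
    (fun x => by rw [P.isSolution.odd_of_zero h0 x]; ring) (Or.inr rfl)
  refine ⟨A, B, Q, hB, Q.isInducedBy (fun x => ?_) fun z hz => ?_, ?_⟩
  · have := P.mem_strip x
    exact ⟨by linarith [this.2], by linarith [this.1]⟩
  · rw [hA hz, Real.sin_neg, neg_neg]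
  · exact Q.hasDegree_one (by rw [hA2, neg_neg]) hA1

/-- The harmonic map of degree zero induced by an even pole orbit. -/
theorem PoleOrbit.exists_harmonicMap_degree_zero {κ σ : ℝ} {h : ℝ → ℝ} (P : PoleOrbit κ h)
    (hσ : σ = 1 ∨ σ = -1) (h0 : deriv h 0 = 0) :
    ∃ (A B : ℝ → ℝ) (Q : ProfilePair A B), B (-1) = κ ∧
      IsInducedBy Q.symmetricMap (fun x => σ * h x) ∧ HasDegree Q.symmetricMap 0 := by
  obtain ⟨A, B, Q, hA1, hA2, hB, hA⟩ := P.exists_profilePair (τ := 1)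
    (fun x => by rw [P.isSolution.even_of_deriv_zero h0 x, one_mul]) (Or.inl rfl)
  have hstrip : ∀ x, σ * h x ∈ Ioo (-(Real.pi / 2)) (Real.pi / 2) := fun x =>
    sign_mul_mem_strip hσ (P.mem_strip x)
  have hdeg : A (-1) = A 1 := by rw [hA1, hA2]
  -- The induced map needs A = -sin(σh), while the profile pair has A = sin h; for σ = 1 this calls
  -- for reflecting A.
  rcases hσ with rfl | rfl
  · refine ⟨_, B, Q.neg_fst, hB, Q.neg_fst.isInducedBy hstrip fun z hz => ?_,
      Q.neg_fst.hasDegree_zero (by rw [hdeg])⟩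
    rw [hA hz, one_mul]
  · refine ⟨A, B, Q, hB, Q.isInducedBy hstrip fun z hz => ?_, Q.hasDegree_zero hdeg⟩
    rw [hA hz, neg_one_mul, Real.sin_neg, neg_neg]

end

theorem theorem1 :
    (∃ (b : ℕ → ℝ) (h : ℕ → ℝ → ℝ) (u : ℕ → S3 → S3),
      (∀ n : ℕ, Odd n →
        0 < b n ∧ IsOddOrbit (b n) (h n) ∧ StaysInStrip (h n) ∧
        HasRotationNumber (h n) (-(Real.pi / 2)) ((n : ℝ) / 2) ∧
        ∃ σ c : ℝ, (σ = 1 ∨ σ = -1) ∧ 0 < c ∧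
          Tendsto (fun x : ℝ => σ * h n x) atTop (𝓝 (-(Real.pi / 2))) ∧
          HasConnectingAsymptotics (h n) σ c ∧
          IsInducedBy (u n) (fun x : ℝ => -σ * h n x) ∧
          IsHarmonicMap (u n) ∧ HasDegree (u n) 1) ∧
      InjOn u {n : ℕ | Odd n}) ∧
    (∃ (d : ℕ → ℝ) (h : ℕ → ℝ → ℝ) (u : ℕ → S3 → S3),
      (∀ n : ℕ, Even n → 0 < n →
        0 < d n ∧ IsEvenOrbit (d n) (h n) ∧ StaysInStrip (h n) ∧
        HasRotationNumber (h n) 0 ((n : ℝ) / 2) ∧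
        (∃ σ c : ℝ, (σ = 1 ∨ σ = -1) ∧ 0 < c ∧
          Tendsto (fun x : ℝ => σ * h n x) atTop (𝓝 (-(Real.pi / 2))) ∧
          HasConnectingAsymptotics (h n) σ c) ∧
        IsInducedBy (u n) (h n) ∧
        IsHarmonicMap (u n) ∧ HasDegree (u n) 0) ∧
      InjOn u {n : ℕ | Even n ∧ 0 < n}) := by
  obtain ⟨κ, g, hinj, H⟩ := exists_poleOrbit
  -- The map determines B(-1) = κ(n), and κ is injective on n ≥ 1.
  have hclass : ∀ (u : ℕ → S3 → S3) (s : Set ℕ), (∀ n ∈ s, 1 ≤ n ∧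
      ∃ (A B : ℝ → ℝ) (Q : ProfilePair A B), B (-1) = κ n ∧ u n = Q.symmetricMap) → InjOn u s := by
    intro u s hu j hj k hk hjk
    obtain ⟨hj1, A, B, Q, hB, hQ⟩ := hu j hj
    obtain ⟨hk1, A', B', Q', hB', hQ'⟩ := hu k hk
    refine hinj hj1 hk1 ?_
    rw [← hB, ← hB']
    exact Q.snd_eq_of_symmetricMap_eq Q' (by rw [← hQ, ← hQ', hjk])
  constructor
  · have key : ∀ n : ℕ, ∃ (b : ℝ) (h : ℝ → ℝ) (u : S3 → S3), Odd n →
        (0 < b ∧ IsOddOrbit b h ∧ StaysInStrip h ∧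
        HasRotationNumber h (-(Real.pi / 2)) ((n : ℝ) / 2) ∧
        ∃ σ c : ℝ, (σ = 1 ∨ σ = -1) ∧ 0 < c ∧
          Tendsto (fun x : ℝ => σ * h x) atTop (𝓝 (-(Real.pi / 2))) ∧
          HasConnectingAsymptotics h σ c ∧
          IsInducedBy u (fun x : ℝ => -σ * h x) ∧
          IsHarmonicMap u ∧ HasDegree u 1) ∧
        ∃ (A B : ℝ → ℝ) (Q : ProfilePair A B), B (-1) = κ n ∧ u = Q.symmetricMap := by
      intro n
      by_cases hn : Odd n
      swap
      -- Arbitrary values: nothing is asked for the indices outside the family.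
      · exact ⟨0, 0, id, fun h => absurd h hn⟩
      obtain ⟨hκ, P, hodd, -, θ, hθc, hθ0, hθp, hθt⟩ := H n hn.pos
      obtain ⟨h0, h1⟩ := hodd hn
      -- The sign that makes the slope at 0 positive is also the σ of the asymptotics. The map is
      -- induced by -σ(σg) = -g, so it does not depend on the sign.
      obtain ⟨σ, hσ, hσσ, hσpos⟩ := exists_sign_mul_pos h1
      obtain ⟨A, B, Q, hB, hind, hdeg⟩ := P.exists_harmonicMap_degree_one h0
      have hd : deriv (fun x => σ * g n x) 0 = σ * deriv (g n) 0 := deriv_const_mul_field σ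
      refine ⟨σ * deriv (g n) 0, fun x => σ * g n x, Q.symmetricMap, fun _ =>
        ⟨⟨hσpos, ?_, fun x _ => sign_mul_mem_strip hσ (P.mem_strip x), ?_, σ, 2 * κ n, hσ,
          by positivity, P.tendsto_sign_mul hσσ, P.hasConnectingAsymptotics hσσ, ?_,
          Q.isHarmonicMap, hdeg⟩, A, B, Q, hB, rfl⟩⟩
      · rw [← hd]
        exact (P.isSolution.sign_mul hσ).isOddOrbit (by rw [h0, mul_zero])
      · obtain ⟨j, rfl⟩ := hn
        -- For n = 2j + 1 the shift takes nπ/2 to nπ/2 - (1 + j)π = -π/2.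
        have := (hasRotationNumber_of_tendsto_zero hθc hθ0 hθp hθt (-1 - j)).const_mul σ
        convert this using 1
        push_cast
        ring
      · convert hind using 2 with x
        linear_combination (-g n x) * hσσ
    choose b h u hu using key
    refine ⟨b, h, u, fun n hn => (hu n hn).1, hclass u _ fun n hn => ⟨Odd.pos hn, (hu n hn).2⟩⟩
  · have key : ∀ n : ℕ, ∃ (d : ℝ) (h : ℝ → ℝ) (u : S3 → S3), Even n ∧ 0 < n →
        (0 < d ∧ IsEvenOrbit d h ∧ StaysInStrip h ∧
        HasRotationNumber h 0 ((n : ℝ) / 2) ∧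
        (∃ σ c : ℝ, (σ = 1 ∨ σ = -1) ∧ 0 < c ∧
          Tendsto (fun x : ℝ => σ * h x) atTop (𝓝 (-(Real.pi / 2))) ∧
          HasConnectingAsymptotics h σ c) ∧
        IsInducedBy u h ∧ IsHarmonicMap u ∧ HasDegree u 0) ∧
        ∃ (A B : ℝ → ℝ) (Q : ProfilePair A B), B (-1) = κ n ∧ u = Q.symmetricMap := by
      intro n
      by_cases hn : Even n ∧ 0 < n
      swap
      · exact ⟨0, 0, id, fun h => absurd h hn⟩
      obtain ⟨hκ, P, -, heven, θ, hθc, hθ0, hθp, hθt⟩ := H n hn.2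
      obtain ⟨h0, h1⟩ := heven hn.1
      obtain ⟨σ, hσ, hσσ, hσpos⟩ := exists_sign_mul_pos h1
      obtain ⟨A, B, Q, hB, hind, hdeg⟩ := P.exists_harmonicMap_degree_zero hσ h0
      have hd : deriv (fun x => σ * g n x) 0 = σ * deriv (g n) 0 := deriv_const_mul_field σ
      refine ⟨σ * g n 0, fun x => σ * g n x, Q.symmetricMap, fun _ =>
        ⟨⟨hσpos, ?_, fun x _ => sign_mul_mem_strip hσ (P.mem_strip x), ?_, ⟨σ, 2 * κ n, hσ,
          by positivity, P.tendsto_sign_mul hσσ, P.hasConnectingAsymptotics hσσ⟩, hind,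
          Q.isHarmonicMap, hdeg⟩, A, B, Q, hB, rfl⟩⟩
      · exact (P.isSolution.sign_mul hσ).isEvenOrbit (by rw [hd, h0, mul_zero])
      · obtain ⟨⟨j, rfl⟩, -⟩ := hn
        have := (hasRotationNumber_of_tendsto_zero hθc hθ0 hθp hθt (-j)).const_mul σ
        convert this using 1
        push_cast
        ring
    choose d h u hu using key
    exact ⟨d, h, u, fun n hn hpos => (hu n ⟨hn, hpos⟩).1, hclass u _ fun n hn =>
      ⟨hn.2, (hu n hn).2⟩⟩
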